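/- **Setting.** Let $G$ be a DAG on a finite vertex set $V$, $|V|=n$. Two DAGs are Markov equivalent if they have the same skeleton and the same v-structures ($u\to v\gets w$ with $u\neq w$, $u\not\sim w$). An intervention is a set $S\subseteq V$; $G_S$ is $G$ with all arcs into vertices of $S$ removed. For a set $\mathcal I$ of interventions, the $\mathcal I$-essential graph $\mathcal E_{\mathcal I}(G)$ is the partially directed graph that is the union of all DAGs $G'$ such that $G'$ is Markov equivalent to $G$ and $G'_S$ is Markov equivalent to $G_S$ for all $S\in\mathcal I$ (an edge on which two such $G'$ disagree is unoriented). Put $\mathcal E(G)=\mathcal E_\emptyset(G)$. Chain components are the connected components of the subgraph of unoriented edges. $\nu_k(G)$ is the least size of a set $\mathcal I$ of interventions of size at most $k$ with $\mathcal E_{\mathcal I}(G)=G$. A $1/2$-clique separator of a connected graph $H$ is a clique $K_H$ of $H$ such that every connected component of $H-K_H$ has at most $|V(H)|/2$ vertices. **Algorithm 1.** Input: $\mathcal E(G^*)$ for an unknown DAG $G^*$ on $n$ vertices, and an integer $k\ge 1$. Start with $\mathcal I_0=\emptyset$, $i=0$. While $\mathcal E_{\mathcal I_i}(G^*)$ has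 unoriented edges: 1. for each chain component $H$ of $\mathcal E_{\mathcal I_i}(G^*)$ with at least $2$ vertices choose a $1/2$-clique separator $K_H$, and let $Q=\bigcup_H K_H$; 2. if $k=1$ or $|Q|=1$, let $C=\{\{v\}:v\in Q\}$; otherwise let $k'=\min\{k,|Q|/2\}$, $a=\lceil |Q|/k'\rceil$, $\ell=\lceil\log_a|Q|\rceil$, choose distinct labels in $[a]^\ell$ for the vertices of $Q$ such that in every position every letter is used at most $\lceil |Q|/a\rceil$ times, and let $C=\{S_{x,y}:x\in[\ell],y\in[a]\}$, where $S_{x,y}\subseteq Q$ is the set of vertices whose $x$-th letter is $y$; 3. intervene on the sets in $C$, observe $\mathcal E_{\mathcal I_{i+1}}(G^*)$ for $\mathcal I_{i+1}=\mathcal I_i\cup C$, and increase $i$ by one. **Theorem.** There is an absolute constant $c$ such that the following holds for all $n$, all $k>1$ and all DAGs $G^*$ on $n$ vertices. (a) In every run of Algorithm 1, whichever separators and labels it chooses, all interventions have size at most $k$; an iteration can be carried out whenever unoriented edges remain; there are at most $c\log n$ iterations; when no unoriented edge remains, $\mathcal E_{\mathcal I}(G^*)=G^*$ for the set $\mathcal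 I$ of performed interventions; and the number of interventions, added up over the iterations, is at most $c\cdot\log n\cdot\log k\cdot\nu_k(G^*)$. (b) Algorithm 1 can be implemented, deterministically and adaptively, in polynomial time: there are one fixed deterministic program for a random access machine (with unit-cost addition and truncated subtraction), whose only access to $G^*$ is the input $\mathcal E(G^*)$ and an instruction that performs an intervention and returns $\mathcal E_{\mathcal I}(G^*)$ for the set $\mathcal I$ of all interventions performed so far, and one fixed polynomial $p$, such that for all $n$, $k>1$ and $G^*$ the program halts within $p(n)$ steps, the interventions it performs form a run of Algorithm 1 and have size at most $k$, their set $\mathcal I$ satisfies $\mathcal E_{\mathcal I}(G^*)=G^*$, the program outputs $G^*$, and it performs at most $c\cdot\log n\cdot\log k\cdot\nu_k(G^*)$ interventions. -/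

import Mathlib

namespace CausalSearch

/-! ### Graphs

A partially directed graph on `V` is a `Digraph V`: the pair `u v` carries the arc `u → v` if
`Adj u v` and not `Adj v u`, and the unoriented edge `u - v` if both `Adj u v` and `Adj v u`. -/

section Graphs

variable {V : Type*}

/-- `u ∼ v`: the vertices are joined by an unoriented edge or by an arc in some direction. -/
def Joined (D : Digraph V) (u v : V) : Prop := D.Adj u v ∨ D.Adj v u

/-- `u → v ← w` with `u ≠ w` and `u ≁ w`. -/
def IsVStructure (D : Digraph V) (u v w : V) : Prop :=
  (D.Adj u v ∧ ¬ D.Adj v u) ∧ (D.Adj w v ∧ ¬ D.Adj v w) ∧ u ≠ w ∧ ¬ Joined D u w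

/-- Markov equivalence of DAGs: same skeleton and same v-structures. -/
def MarkovEquiv (D D' : Digraph V) : Prop :=
  (∀ u v, Joined D u v ↔ Joined D' u v) ∧ ∀ u v w, IsVStructure D u v w ↔ IsVStructure D' u v w

/-- The undirected part of a partially directed graph. Its connected components are the chain
components. -/
def undirectedPart (D : Digraph V) : SimpleGraph V where
  Adj u v := u ≠ v ∧ D.Adj u v ∧ D.Adj v u
  symm := ⟨fun _ _ h => ⟨h.1.symm, h.2.2, h.2.1⟩⟩
  loopless := ⟨fun _ h => h.1 rfl⟩

/-- No unoriented edge is left. -/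
def FullyOriented (D : Digraph V) : Prop := ∀ u v, ¬ (undirectedPart D).Adj u v

variable (V) in
/-- Directed acyclic graphs on `V`. -/
structure DAG where
  graph : Digraph V
  acyclic : ∀ v, ¬ Relation.TransGen graph.Adj v v

/-- The interventional graph `G_S`: all arcs into vertices of `S` are removed. -/
def DAG.intervened (G : DAG V) (S : Finset V) : Digraph V where
  Adj u v := G.graph.Adj u v ∧ v ∉ S

/-- `G'` is `𝓘`-Markov equivalent to `G`: it is Markov equivalent to `G` (observational data), and
`G'_S` is Markov equivalent to `G_S` for every intervention `S ∈ 𝓘`. -/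
def InterventionEquiv (I : Set (Finset V)) (G G' : DAG V) : Prop :=
  MarkovEquiv G.graph G'.graph ∧ ∀ S ∈ I, MarkovEquiv (G.intervened S) (G'.intervened S)

/-- The `𝓘`-essential graph `𝓔_𝓘(G)`: the union of all DAGs in the `𝓘`-Markov equivalence class
of `G`. So an edge is oriented `u → v` if it is so in all of these DAGs, and unoriented if two of
them disagree. `𝓔(G)` is the case `𝓘 = ∅`. -/
def essentialGraph (I : Set (Finset V)) (G : DAG V) : Digraph V where
  Adj u v := ∃ G' : DAG V, InterventionEquiv I G G' ∧ G'.graph.Adj u v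

/-- `ν_k(G)`: the least number of interventions, each of size at most `k`, in a verifying set
of `G`, that is, in a set `𝓘` with `𝓔_𝓘(G) = G`. -/
noncomputable def verificationNumber (k : ℕ) (G : DAG V) : ℕ :=
  sInf {m | ∃ I : Finset (Finset V), (∀ S ∈ I, S.card ≤ k) ∧
    essentialGraph (I : Set (Finset V)) G = G.graph ∧ I.card = m}

end Graphs

/-! ### The search algorithm -/

section Algorithm

variable {V : Type*}

/-- `K` is a `1/2`-clique separator of the connected component `H` of `U`: a clique of `H` such that
every connected component of `H - K` has at most `|H| / 2` vertices. -/
def IsHalfCliqueSeparator (U : SimpleGraph V) (H : U.ConnectedComponent) (K : Finset V) : Prop :=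
  (K : Set V) ⊆ H.supp ∧ U.IsClique (K : Set V) ∧
    ∀ D : (U.induce (H.supp \ (K : Set V))).ConnectedComponent, 2 * D.supp.ncard ≤ H.supp.ncard

/-- `Q` is a union of `1/2`-clique separators `K_H`, one for each component `H` of size `≥ 2`. -/
def IsSeparatorUnion (U : SimpleGraph V) (Q : Finset V) : Prop :=
  ∃ K : U.ConnectedComponent → Finset V,
    (∀ H, 2 ≤ H.supp.ncard → IsHalfCliqueSeparator U H (K H)) ∧
    ∀ v, v ∈ Q ↔ ∃ H : U.ConnectedComponent, 2 ≤ H.supp.ncard ∧ v ∈ K H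

/-- The number of letters `a = ⌈m / k'⌉` for `m` vertices, where `k' = min {k, m / 2}`. -/
def alphabetSize (k m : ℕ) : ℕ := ⌈(m : ℚ) / min (k : ℚ) ((m : ℚ) / 2)⌉₊

/-- A labelling scheme on `Q`: distinct labels of length `ℓ` over an alphabet of `a` letters, every
letter being used at most `⌈|Q| / a⌉` times in every position. -/
structure IsLabelling (Q : Finset V) {a l : ℕ} (lab : V → Fin l → Fin a) : Prop where
  distinct : Set.InjOn lab (Q : Set V)
  balanced : ∀ x y, (Q.filter fun v => lab v x = y).card ≤ ⌈(Q.card : ℚ) / (a : ℚ)⌉₊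

variable [DecidableEq V]

/-- `C` is a set of interventions that one iteration of the algorithm may perform when the current
partially oriented graph is `E`. Note `Nat.clog a m = ⌈log_a m⌉`. -/
def IsBatch (k : ℕ) (E : Digraph V) (C : Finset (Finset V)) : Prop :=
  ∃ Q : Finset V, IsSeparatorUnion (undirectedPart E) Q ∧
    if k = 1 ∨ Q.card = 1 then C = Q.image fun v => {v}
    else ∃ lab : V → Fin (Nat.clog (alphabetSize k Q.card) Q.card) → Fin (alphabetSize k Q.card),
      IsLabelling Q lab ∧
      C = Finset.univ.image fun p : Fin (Nat.clog (alphabetSize k Q.card) Q.card) ×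
        Fin (alphabetSize k Q.card) => Q.filter fun v => lab v p.1 = p.2

/-- All interventions of a list of batches. -/
def interventions (Cs : List (Finset (Finset V))) : Set (Finset V) := {S | ∃ C ∈ Cs, S ∈ C}

/-- `SearchRun k G [C₁, …, Cᵢ]`: the algorithm, with intervention size `k` and ground truth `G`, may
perform the batches `C₁, …, Cᵢ` in its first `i` iterations. The ground truth enters only through
the interventional essential graphs observed. -/
inductive SearchRun (k : ℕ) (G : DAG V) : List (Finset (Finset V)) → Prop
  | start : SearchRun k G []
  | iterate (Cs : List (Finset (Finset V))) (C : Finset (Finset V)) (run : SearchRun k G Cs)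
      (unfinished : ¬ FullyOriented (essentialGraph (interventions Cs) G))
      (batch : IsBatch k (essentialGraph (interventions Cs) G) C) :
      SearchRun k G (Cs ++ [C])

end Algorithm

/-! ### Programs with interventions, and their running time

A random access machine with a finite program, natural number registers, two-dimensional arrays and
unit cost addition and truncated subtraction. Its only access to the ground truth is the input
`𝓔(G)` and the instruction `intervene`. -/

section Machine

/-- Registers and array names are numbered. Registers `i`, `j` hold array indices. -/
inductive Program
  /-- `x := c` -/
  | const (x c : ℕ)
  /-- `x := y + z` -/
  | add (x y z : ℕ)
  /-- `x := y - z`, truncated at `0` -/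
  | sub (x y z : ℕ)
  /-- `x := A[i, j]` -/
  | read (x A i j : ℕ)
  /-- `A[i, j] := x` -/
  | write (A i j x : ℕ)
  /-- intervene on the set of all vertices `v` with `A[i, v] ≠ 0` -/
  | intervene (A i : ℕ)
  | seq (P P' : Program)
  /-- if `x ≠ 0` then `P` else `P'` -/
  | ite (x : ℕ) (P P' : Program)
  /-- while `x ≠ 0` do `P` -/
  | while (x : ℕ) (P : Program)

variable {n : ℕ}

/-- Registers, arrays, and the list of all interventions performed so far. -/
structure State (n : ℕ) where
  reg : ℕ → ℕ
  arr : ℕ → ℕ → ℕ → ℕ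
  performed : List (Finset (Fin n))

/-- The adjacency matrix of a graph on `n` vertices, `0` outside. -/
noncomputable def adjMatrix (D : Digraph (Fin n)) (u v : ℕ) : ℕ :=
  open Classical in if ∃ (hu : u < n) (hv : v < n), D.Adj ⟨u, hu⟩ ⟨v, hv⟩ then 1 else 0

/-- Input: register `0` holds `n`, register `1` holds `k`, array `0` holds `𝓔(G)`, all else is `0`. -/
noncomputable def initialState (k : ℕ) (G : DAG (Fin n)) : State n where
  reg x := if x = 0 then n else if x = 1 then k else 0
  arr A := if A = 0 then adjMatrix (essentialGraph ∅ G) else fun _ _ => 0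
  performed := []

/-- The effect of an intervention on `S` when `G` is the ground truth: with `𝓘` the set of all
interventions performed so far, including `S`, array `0` is overwritten by `𝓔_𝓘(G)`. -/
noncomputable def State.doIntervene (G : DAG (Fin n)) (s : State n) (S : Finset (Fin n)) :
    State n where
  reg := s.reg
  arr := Function.update s.arr 0 (adjMatrix (essentialGraph {T | T ∈ s.performed ++ [S]} G))
  performed := s.performed ++ [S]

/-- One step of computation, on a stack of programs still to be executed and a state. -/
noncomputable def step (G : DAG (Fin n)) : List Program × State n → List Program × State n
  | ([], s) => ([], s)
  | (.const x c :: L, s) => (L, { s with reg := Function.update s.reg x c })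
  | (.add x y z :: L, s) => (L, { s with reg := Function.update s.reg x (s.reg y + s.reg z) })
  | (.sub x y z :: L, s) => (L, { s with reg := Function.update s.reg x (s.reg y - s.reg z) })
  | (.read x A i j :: L, s) =>
      (L, { s with reg := Function.update s.reg x (s.arr A (s.reg i) (s.reg j)) })
  | (.write A i j x :: L, s) =>
      (L, { s with arr := Function.update s.arr A (Function.update (s.arr A) (s.reg i)
        (Function.update (s.arr A (s.reg i)) (s.reg j) (s.reg x))) })
  | (.intervene A i :: L, s) =>
      (L, s.doIntervene G (Finset.univ.filter fun v : Fin n => s.arr A (s.reg i) v ≠ 0))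
  | (.seq P P' :: L, s) => (P :: P' :: L, s)
  | (.ite x P P' :: L, s) => if s.reg x ≠ 0 then (P :: L, s) else (P' :: L, s)
  | (.while x P :: L, s) => if s.reg x ≠ 0 then (P :: .while x P :: L, s) else (L, s)

/-- Started on input `𝓔(G)`, `k`, with ground truth `G`, the program `P` halts within `t` steps, in
the state `s`. -/
def HaltsIn (P : Program) (k : ℕ) (G : DAG (Fin n)) (t : ℕ) (s : State n) : Prop :=
  (step G)^[t] ([P], initialState k G) = ([], s)

end Machine

end CausalSearch

open CausalSearch

/-!
The theorem rests on a description of the chain components of the essential graph of `G`, for a set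
`I` of interventions, by *blocks* (`IsBlock`): sets `M` of vertices that have the same parents
outside `M`, contain no v-structure, and are not separated by an intervention. Overlapping blocks
have a block as their union, so there are maximal blocks. An arc between different maximal blocks
has the same direction in all equivalent DAGs (`adj_of_not_blockRel`). The edges inside a block can
be oriented along any perfect elimination ordering of the block, so each of them is reversed in some
equivalent DAG (`IsBlock.exists_reversed`). Hence the unoriented edges are the edges inside blocks
(`undirectedPart_adj_iff`), chain components are blocks (`isBlock_supp`), and the undirected part is
chordal (`eliminableOn_undirectedPart`).

*Lower bound.* An arc `p → q` is covered if `p` and `q` have the same other parents. Its ends form a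
block unless an intervention separates them, so a verifying set contains `p` or `q` in some
intervention. From the last vertex of a clique with `m` vertices in a chain component, a path along
the latest parents uses at least `m - 1` covered arcs inside the component, so a verifying set
intervenes on at least `(m - 1) / 2` vertices of the component (`card_clique_le`).
Summed over the components, this bounds the size of the union `Q` of clique separators by
`3 k ν_k(G)` (`card_separatorUnion_le`).

*Upper bound.* The interventions of an iteration separate each vertex of `Q` from all others and so
orient all edges at `Q`. A new component that still has an edge therefore lies in a component of an
old one without its separator, and has at most half of its size. So there are at most `log₂ n`
iterations (`SearchRun.length_mul_log_le`). An iteration uses at most `4 ν_k(G)` letters and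
`2 + log₂ k` positions (`IsBatch.card_le`), and no intervention has more than `k` vertices, since
every letter is used at most `⌈|Q| / a⌉ ≤ k` times in each position (`IsBatch.card_mem_le`).

*Existence and computation of the choices.* In a chordal graph, a clique that misses a component
`C` with more than half of the vertices is replaced by its vertices with a neighbour in `C`, together
with a vertex of `C` adjacent to all of them, which exists by `EliminableOn.exists_adj_all`. Every
such step shrinks the big component (`not_isBig_iterate`), so a clique separator is found after at
most `n` steps. The labels are running digit sums modulo `a` of the ranks in `Q` (`digitLabel`):
numbers with the same quotient by `a` get different letters in each position, which makes the labels
balanced.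

*The program.* It is written in a small language of terms and bounded loops, in which the search is
expressed by reachability in graphs, bounded quantifiers and counting. A command of the language is
compiled to a random access machine, and its running time is bounded by a polynomial that is computed
along with it (`Cmd.runs`, `Cmd.haltsIn`). The remaining task is to show that the command `searchCmd`
performs a run of the search (`searchCmd_spec`).
-/

namespace CausalSearch

/-! ### Blocks and the chain components of essential graphs -/

section Blocks

variable {V : Type*}

theorem DAG.not_adj_self (G : DAG V) (v : V) : ¬ G.graph.Adj v v := fun h => G.acyclic v (.single h)

theorem DAG.asymm (G : DAG V) {u v : V} (h : G.graph.Adj u v) : ¬ G.graph.Adj v u :=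
  fun h' => G.acyclic u (.tail (.single h) h')

theorem DAG.no_triangle (G : DAG V) {u v w : V} (h : G.graph.Adj u v) (h' : G.graph.Adj v w) :
    ¬ G.graph.Adj w u :=
  fun h'' => G.acyclic u (.tail (.tail (.single h) h') h'')

theorem DAG.ne (G : DAG V) {u v : V} (h : G.graph.Adj u v) : u ≠ v := by
  rintro rfl; exact G.not_adj_self _ h

theorem Joined.symm {D : Digraph V} {u v : V} (h : Joined D u v) : Joined D v u := Or.symm h

theorem joined_comm {D : Digraph V} {u v : V} : Joined D u v ↔ Joined D v u := or_comm

theorem DAG.isVStructure_iff (G : DAG V) {u v w : V} :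
    IsVStructure G.graph u v w ↔
      G.graph.Adj u v ∧ G.graph.Adj w v ∧ u ≠ w ∧ ¬ Joined G.graph u w :=
  ⟨fun h => ⟨h.1.1, h.2.1.1, h.2.2⟩,
    fun h => ⟨⟨h.1, G.asymm h.1⟩, ⟨h.2.1, G.asymm h.2.1⟩, h.2.2⟩⟩

theorem InterventionEquiv.refl (I : Set (Finset V)) (G : DAG V) : InterventionEquiv I G G :=
  ⟨⟨fun _ _ => Iff.rfl, fun _ _ _ => Iff.rfl⟩,
    fun _ _ => ⟨fun _ _ => Iff.rfl, fun _ _ _ => Iff.rfl⟩⟩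

theorem InterventionEquiv.symm {I : Set (Finset V)} {G G' : DAG V} (h : InterventionEquiv I G G') :
    InterventionEquiv I G' G :=
  ⟨⟨fun u v => (h.1.1 u v).symm, fun u v w => (h.1.2 u v w).symm⟩,
    fun S hS => ⟨fun u v => ((h.2 S hS).1 u v).symm, fun u v w => ((h.2 S hS).2 u v w).symm⟩⟩

theorem InterventionEquiv.mono {I J : Set (Finset V)} (hIJ : I ⊆ J) {G G' : DAG V}
    (h : InterventionEquiv J G G') : InterventionEquiv I G G' :=
  ⟨h.1, fun S hS => h.2 S (hIJ hS)⟩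

theorem InterventionEquiv.vStructure {I : Set (Finset V)} {G G' : DAG V}
    (h : InterventionEquiv I G G') {u v w : V} (huv : G.graph.Adj u v) (hwv : G.graph.Adj w v)
    (hne : u ≠ w) (hj : ¬ Joined G.graph u w) : G'.graph.Adj u v ∧ G'.graph.Adj w v := by
  have := (h.1.2 u v w).1 (G.isVStructure_iff.2 ⟨huv, hwv, hne, hj⟩)
  exact ⟨this.1.1, this.2.1.1⟩

/-- An arc whose ends are separated by an intervention has the same direction in all members of
the interventional equivalence class: exactly one of its two directions survives the
intervention. -/
theorem InterventionEquiv.not_adj_of_separated {I : Set (Finset V)} {G G' : DAG V}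
    (h : InterventionEquiv I G G') {S : Finset V} (hS : S ∈ I) {a b : V} (hab : G.graph.Adj a b)
    (hsep : ¬ (a ∈ S ↔ b ∈ S)) : ¬ G'.graph.Adj b a := by
  intro hba
  have := (h.2 S hS).1 a b
  have h1 := G.asymm hab
  have h2 := G'.asymm hba
  simp only [Joined, DAG.intervened, hab, hba, h1, h2, true_and, false_and, or_false,
    false_or] at this
  tauto

/-- A block of `G` is a set `M` of vertices that an `I`-equivalent DAG may orient on its own: all
vertices of `M` have the same parents outside `M`, no v-structure lies inside `M`, and no
intervention separates two vertices of `M`. It need not be connected. -/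
structure IsBlock (I : Set (Finset V)) (G : DAG V) (M : Set V) : Prop where
  parents : ∀ u ∈ M, ∀ v ∈ M, ∀ w ∉ M, G.graph.Adj w u → G.graph.Adj w v
  moral : ∀ v ∈ M, ∀ u ∈ M, ∀ w ∈ M, G.graph.Adj u v → G.graph.Adj w v → u ≠ w →
    Joined G.graph u w
  unsplit : ∀ S ∈ I, ∀ u ∈ M, ∀ v ∈ M, u ∈ S → v ∈ S

theorem isBlock_singleton (I : Set (Finset V)) (G : DAG V) (v : V) : IsBlock I G {v} where
  parents := by rintro u rfl v rfl w _ h; exact h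
  moral := by rintro v rfl u rfl w rfl h; exact (G.not_adj_self _ h).elim
  unsplit := by rintro S _ u rfl v rfl h; exact h

theorem IsBlock.union {I : Set (Finset V)} {G : DAG V} {M N : Set V} (hM : IsBlock I G M)
    (hN : IsBlock I G N) {z : V} (hzM : z ∈ M) (hzN : z ∈ N) : IsBlock I G (M ∪ N) where
  parents := by
    intro u hu v hv w hw hwu
    simp only [Set.mem_union, not_or] at hw hu hv
    have hz : G.graph.Adj w z := hu.elim (fun h => hM.parents u h z hzM w hw.1 hwu)
      (fun h => hN.parents u h z hzN w hw.2 hwu)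
    exact hv.elim (fun h => hM.parents z hzM v h w hw.1 hz)
      (fun h => hN.parents z hzN v h w hw.2 hz)
  moral := by
    -- by symmetry the common child may be taken in the first block
    have key : ∀ {M N : Set V}, IsBlock I G M → IsBlock I G N → z ∈ M → z ∈ N → ∀ v ∈ M,
        ∀ u ∈ M ∪ N, ∀ w ∈ M ∪ N, G.graph.Adj u v → G.graph.Adj w v → u ≠ w →
        Joined G.graph u w := by
      intro M N hM hN hzM hzN v hv u hu w hw huv hwv hne
      by_cases huM : u ∈ M <;> by_cases hwM : w ∈ M
      · exact hM.moral v hv u huM w hwM huv hwv hne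
      · exact Or.inr (hM.parents v hv u huM w hwM hwv)
      · exact Or.inl (hM.parents v hv w hwM u huM huv)
      · exact hN.moral z hzN u (hu.resolve_left huM) w (hw.resolve_left hwM)
          (hM.parents v hv z hzM u huM huv) (hM.parents v hv z hzM w hwM hwv) hne
    intro v hv u hu w hw
    rcases hv with hv | hv
    · exact key hM hN hzM hzN v hv u hu w hw
    · exact key hN hM hzN hzM v hv u (Or.symm hu) w (Or.symm hw)
  unsplit := by
    intro S hS u hu v hv huS
    have hz : z ∈ S := hu.elim (fun h => hM.unsplit S hS u h z hzM huS)
      (fun h => hN.unsplit S hS u h z hzN huS)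
    exact hv.elim (fun h => hM.unsplit S hS z hzM v h hz) (fun h => hN.unsplit S hS z hzN v h hz)

/-- Two vertices are block-related if some block contains both. -/
def BlockRel (I : Set (Finset V)) (G : DAG V) (u v : V) : Prop :=
  ∃ M, IsBlock I G M ∧ u ∈ M ∧ v ∈ M

namespace BlockRel

variable {I : Set (Finset V)} {G : DAG V} {u v w : V}

theorem refl (I : Set (Finset V)) (G : DAG V) (v : V) : BlockRel I G v v :=
  ⟨{v}, isBlock_singleton I G v, rfl, rfl⟩

theorem symm (h : BlockRel I G u v) : BlockRel I G v u := by
  obtain ⟨M, hM, hu, hv⟩ := h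
  exact ⟨M, hM, hv, hu⟩

theorem trans (h : BlockRel I G u v) (h' : BlockRel I G v w) : BlockRel I G u w := by
  obtain ⟨M, hM, hu, hv⟩ := h
  obtain ⟨N, hN, hv', hw⟩ := h'
  exact ⟨M ∪ N, hM.union hN hv hv', Or.inl hu, Or.inr hw⟩

theorem mem_iff (h : BlockRel I G u v) {S : Finset V} (hS : S ∈ I) : u ∈ S ↔ v ∈ S := by
  obtain ⟨M, hM, hu, hv⟩ := h
  exact ⟨hM.unsplit S hS u hu v hv, hM.unsplit S hS v hv u hu⟩

/-- Block-related vertices have the same parents among the vertices not related to them. -/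
theorem adj (h : BlockRel I G u v) (hw : ¬ BlockRel I G w u) (hwu : G.graph.Adj w u) :
    G.graph.Adj w v := by
  obtain ⟨M, hM, hu, hv⟩ := h
  exact hM.parents u hu v hv w (fun hwM => hw ⟨M, hM, hwM, hu⟩) hwu

end BlockRel

/-- The classes of the block relation are the maximal blocks. -/
theorem isBlock_class (I : Set (Finset V)) (G : DAG V) (z : V) :
    IsBlock I G {v | BlockRel I G v z} where
  parents := by
    intro u hu v hv w hw hwu
    exact (BlockRel.trans hu (BlockRel.symm hv)).adj (fun h => hw (h.trans hu)) hwu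
  moral := by
    intro v hv u hu w hw huv hwv hne
    obtain ⟨M, hM, hvM, huM⟩ := BlockRel.trans hv (BlockRel.symm hu)
    obtain ⟨N, hN, hvN, hwN⟩ := BlockRel.trans hv (BlockRel.symm hw)
    exact (hM.union hN hvM hvN).moral v (Or.inl hvM) u (Or.inl huM) w (Or.inr hwN) huv hwv hne
  unsplit := by
    intro S hS u hu v hv
    exact ((BlockRel.trans hu (BlockRel.symm hv)).mem_iff hS).1

/-- A topological numbering of a finite DAG. -/
theorem DAG.exists_rank [Finite V] (G : DAG V) :
    ∃ f : V → ℕ, ∀ u v, G.graph.Adj u v → f u < f v := by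
  refine ⟨fun v => {u | Relation.TransGen G.graph.Adj u v}.ncard, fun u v h => ?_⟩
  refine Set.ncard_lt_ncard ?_ (Set.toFinite _)
  refine ⟨fun w hw => Relation.TransGen.tail hw h, fun hsub => G.acyclic u (hsub ?_)⟩
  exact Relation.TransGen.single h

/-- A numbering of the classes of the block relation that increases along all arcs between
different classes. -/
theorem exists_classRank [Finite V] (I : Set (Finset V)) (G : DAG V) :
    ∃ r : V → ℕ, (∀ u v, BlockRel I G u v → r u = r v) ∧
      ∀ u v, G.graph.Adj u v → ¬ BlockRel I G u v → r u < r v := by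
  obtain ⟨f, hf⟩ := G.exists_rank
  refine ⟨fun v => sInf (f '' {u | BlockRel I G u v}), fun u v h => ?_, fun u v h hn => ?_⟩
  · have : {w | BlockRel I G w u} = {w | BlockRel I G w v} := by
      ext w
      exact ⟨fun hw => BlockRel.trans hw h, fun hw => BlockRel.trans hw h.symm⟩
    simp only [this]
  · have hne : (f '' {w | BlockRel I G w v}).Nonempty := ⟨f v, v, BlockRel.refl I G v, rfl⟩
    obtain ⟨w, hw, hwv⟩ := Nat.sInf_mem hne
    have hu : sInf (f '' {w | BlockRel I G w u}) ≤ f u :=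
      Nat.sInf_le ⟨u, BlockRel.refl I G u, rfl⟩
    have : f u < f w := hf u w ((BlockRel.symm hw).adj hn h)
    simp only
    omega

/-- Arcs between different maximal blocks have the same direction in all equivalent DAGs.
For an arc into the class `N` of `b`, let `M` be the latest class with an arc into `N`. If an
equivalent DAG reversed an arc from `M` to `N`, then `M ∪ N` would be a block. The remaining arcs
into `N` are forced by v-structures, or by acyclicity via `M`. -/
theorem adj_of_not_blockRel [Finite V] {I : Set (Finset V)} {G G' : DAG V}
    (hG : InterventionEquiv I G G') {a b : V} (hab : G.graph.Adj a b)
    (hn : ¬ BlockRel I G a b) : G'.graph.Adj a b := by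
  obtain ⟨r, hr, hr'⟩ := exists_classRank I G
  induction hk : r b using Nat.strong_induction_on generalizing a b with
  | _ k ih =>
  subst hk
  have skel : ∀ u v, Joined G.graph u v ↔ Joined G'.graph u v := hG.1.1
  -- the class of `m` is the latest class with an arc into the class of `b`
  obtain ⟨m, ⟨hmb, hmn⟩, hmax⟩ : ∃ m, (G.graph.Adj m b ∧ ¬ BlockRel I G m b) ∧
      ∀ d, G.graph.Adj d b ∧ ¬ BlockRel I G d b → r d ≤ r m := by
    obtain ⟨m, hm, hmax⟩ := Set.exists_max_image {m | G.graph.Adj m b ∧ ¬ BlockRel I G m b} r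
      (Set.toFinite _) ⟨a, hab, hn⟩
    exact ⟨m, hm, hmax⟩
  have hmlt : r m < r b := hr' m b hmb hmn
  -- arcs from the latest class keep their direction: otherwise the two classes form a block
  have claim : ∀ a, BlockRel I G a m → G.graph.Adj a b → G'.graph.Adj a b := by
    intro a ham hab
    by_contra hcon
    have hba : G'.graph.Adj b a := ((skel a b).1 (Or.inl hab)).resolve_left hcon
    have hanb : ¬ BlockRel I G a b := fun h => hmn (ham.symm.trans h)
    have hra : r a = r m := hr _ _ ham
    -- a parent of `b` that is not joined to `a` would make a v-structure with `a → b`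
    have joined_a : ∀ d, G.graph.Adj d b → d ≠ a → Joined G.graph d a := by
      intro d hdb hda
      by_contra hj
      exact hcon (hG.vStructure hdb hab hda hj).2
    have hM := isBlock_class I G m
    have hN := isBlock_class I G b
    -- `a` and `b` have the same parents outside the two classes
    have key : ∀ w, ¬ BlockRel I G w m → ¬ BlockRel I G w b →
        (G.graph.Adj w a ↔ G.graph.Adj w b) := by
      intro w hwm hwb
      have hwa : ¬ BlockRel I G w a := fun h => hwm (h.trans ham)
      constructor
      · intro h
        by_contra hnwb
        have hj : ¬ Joined G.graph w b := by
          rintro (h' | h')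
          · exact hnwb h'
          · exact G.no_triangle h hab h'
        have hwa' : G'.graph.Adj w a := ih (r a) (by omega) h hwa rfl
        have hwne : w ≠ b := by rintro rfl; exact hwb (BlockRel.refl _ _ _)
        have := (hG.symm.vStructure hwa' hba hwne (fun h => hj ((skel _ _).2 h))).2
        exact G.asymm hab this
      · intro h
        have hne : w ≠ a := by rintro rfl; exact hwa (BlockRel.refl _ _ _)
        refine (joined_a w h hne).resolve_right fun h' => ?_
        have h1 := hr' a w h' (fun h => hwa h.symm)
        have h2 := hmax w ⟨h, hwb⟩
        omega
    have hblock : IsBlock I G ({v | BlockRel I G v m} ∪ {v | BlockRel I G v b}) := by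
      refine ⟨?_, ?_, ?_⟩
      · intro u hu v hv w hw hwu
        simp only [Set.mem_union, Set.mem_ofPred_eq, not_or] at hu hv hw
        have hwb : G.graph.Adj w b := by
          rcases hu with hu | hu
          · exact (key w hw.1 hw.2).1 ((hu.trans ham.symm).adj (fun h => hw.1 (h.trans hu)) hwu)
          · exact hu.adj (fun h => hw.2 (h.trans hu)) hwu
        rcases hv with hv | hv
        · exact (ham.trans hv.symm).adj (fun h => hw.1 (h.trans ham)) ((key w hw.1 hw.2).2 hwb)
        · exact hv.symm.adj hw.2 hwb
      · intro v hv u hu w hw huv hwv hne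
        simp only [Set.mem_union, Set.mem_ofPred_eq] at hu hv hw
        rcases hv with hv | hv
        · have aux : ∀ u, BlockRel I G u m ∨ BlockRel I G u b → G.graph.Adj u v →
              BlockRel I G u m := by
            intro u hu huv
            refine hu.resolve_right fun hub => ?_
            have h1 := hr' u v huv fun h => hmn (hv.symm.trans (h.symm.trans hub))
            have h2 := hr _ _ hub
            have h3 := hr _ _ hv
            omega
          exact hM.moral v hv u (aux u hu huv) w (aux w hw hwv) huv hwv hne
        · by_cases hub : BlockRel I G u b <;> by_cases hwb : BlockRel I G w b
          · exact hN.moral v hv u hub w hwb huv hwv hne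
          · exact Or.inr (hN.parents v hv u hub w hwb hwv)
          · exact Or.inl (hN.parents v hv w hwb u hub huv)
          · have hum := hu.resolve_right hub
            have hwm := hw.resolve_right hwb
            have hub' := hN.parents v hv b (BlockRel.refl _ _ _) u hub huv
            have hwb' := hN.parents v hv b (BlockRel.refl _ _ _) w hwb hwv
            by_contra hj
            have hua : u ≠ a := by
              rintro rfl; exact hj (joined_a w hwb' hne.symm).symm
            have hwa : w ≠ a := by
              rintro rfl; exact hj (joined_a u hub' hne)
            obtain ⟨hub1, hwb1⟩ := hG.vStructure hub' hwb' hne hj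
            have hua' : G'.graph.Adj u a :=
              ((skel _ _).1 (joined_a u hub' hua)).resolve_right
                (fun h => G'.no_triangle hub1 hba h)
            have hwa' : G'.graph.Adj w a :=
              ((skel _ _).1 (joined_a w hwb' hwa)).resolve_right
                (fun h => G'.no_triangle hwb1 hba h)
            have := hG.symm.vStructure hua' hwa' hne (fun h => hj ((skel _ _).2 h))
            exact hj (hM.moral a ham u hum w hwm this.1 this.2 hne)
      · intro S hS u hu v hv huS
        simp only [Set.mem_union, Set.mem_ofPred_eq] at hu hv
        have hSab : a ∈ S ↔ b ∈ S := by
          by_contra hsep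
          exact hG.not_adj_of_separated hS hab hsep hba
        have hub : b ∈ S := by
          rcases hu with hu | hu
          · exact hSab.1 (((hu.trans ham.symm).mem_iff hS).1 huS)
          · exact (hu.mem_iff hS).1 huS
        rcases hv with hv | hv
        · exact ((hv.trans ham.symm).mem_iff hS).2 (hSab.2 hub)
        · exact (hv.mem_iff hS).2 hub
    exact hanb ⟨_, hblock, Or.inl ham, Or.inr (BlockRel.refl _ _ _)⟩
  -- for an earlier class, the arc is in a v-structure with `m → b`, or the path `a → m → b` has its
  -- direction by induction and by the first case
  by_cases ham : BlockRel I G a m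
  · exact claim a ham hab
  · have hne : a ≠ m := by rintro rfl; exact ham (BlockRel.refl _ _ _)
    by_cases hj : Joined G.graph a m
    · have ham' : G.graph.Adj a m := by
        refine hj.resolve_right fun h => ?_
        have h1 := hr' m a h (fun h => ham h.symm)
        have h2 := hmax a ⟨hab, hn⟩
        omega
      have h1 : G'.graph.Adj a m := ih (r m) hmlt ham' ham rfl
      have h2 : G'.graph.Adj m b := claim m (BlockRel.refl _ _ _) hmb
      exact ((skel a b).1 (Or.inl hab)).resolve_right (fun h => G'.no_triangle h1 h2 h)
    · exact (hG.vStructure hab hmb hne hj).1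

end Blocks

/-! ### Graphs with perfect elimination orderings -/

section Elimination

variable {V : Type*}

/-- `s` is a simplicial vertex of the subgraph of `U` induced by `A`: its neighbours in `A` form a
clique. -/
def IsSimplicialIn (U : SimpleGraph V) (A : Finset V) (s : V) : Prop :=
  s ∈ A ∧ ∀ u ∈ A, ∀ w ∈ A, U.Adj s u → U.Adj s w → u ≠ w → U.Adj u w

/-- Every nonempty induced subgraph of `U` on a subset of `A` has a simplicial vertex. For finite
`A` this says that the subgraph induced by `A` is chordal. -/
def EliminableOn (U : SimpleGraph V) (A : Finset V) : Prop :=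
  ∀ B ⊆ A, B.Nonempty → ∃ s, IsSimplicialIn U B s

theorem EliminableOn.subset {U : SimpleGraph V} {A B : Finset V} (h : EliminableOn U A)
    (hBA : B ⊆ A) : EliminableOn U B :=
  fun C hC => h C (hC.trans hBA)

variable [DecidableEq V]

/-- Dirac's theorem: a chordal graph is complete or has two nonadjacent simplicial vertices. -/
theorem EliminableOn.clique_or_two_simplicial {U : SimpleGraph V} {A : Finset V}
    (h : EliminableOn U A) : U.IsClique (A : Set V) ∨
      ∃ s t, IsSimplicialIn U A s ∧ IsSimplicialIn U A t ∧ s ≠ t ∧ ¬ U.Adj s t := by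
  induction hk : A.card using Nat.strong_induction_on generalizing A with
  | _ k ih =>
  subst hk
  rcases A.eq_empty_or_nonempty with rfl | hne
  · left; simp
  obtain ⟨s, hs⟩ := h A subset_rfl hne
  have hsA := hs.1
  have lift : ∀ x, x ∈ A → x ≠ s → ¬ U.Adj s x →
      (∀ u ∈ A.erase s, ∀ w ∈ A.erase s, U.Adj x u → U.Adj x w → u ≠ w → U.Adj u w) →
      ∃ s t, IsSimplicialIn U A s ∧ IsSimplicialIn U A t ∧ s ≠ t ∧ ¬ U.Adj s t := by
    intro x hx hxs hadj hsimp
    refine ⟨s, x, hs, ⟨hx, fun u hu w hw hxu hxw => ?_⟩, hxs.symm, hadj⟩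
    exact hsimp u (Finset.mem_erase.2 ⟨by rintro rfl; exact hadj hxu.symm, hu⟩) w
      (Finset.mem_erase.2 ⟨by rintro rfl; exact hadj hxw.symm, hw⟩) hxu hxw
  rcases ih _ (Finset.card_erase_lt_of_mem hsA) (h.subset (Finset.erase_subset s A)) rfl with
    hcl | ⟨x, y, hx, hy, hxy, hadj⟩
  · by_cases hall : ∀ x ∈ A, x ≠ s → U.Adj s x
    · left
      intro u hu w hw huw
      by_cases hus : u = s
      · subst hus; exact hall w hw huw.symm
      by_cases hws : w = s
      · subst hws; exact (hall u hu huw).symm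
      exact hcl (by simpa using ⟨hu, hus⟩) (by simpa using ⟨hw, hws⟩) huw
    · push Not at hall
      obtain ⟨x, hx, hxs, hadj⟩ := hall
      exact Or.inr (lift x hx hxs hadj fun u hu w hw _ _ huw => hcl hu hw huw)
  · right
    have hxA := Finset.mem_erase.1 hx.1
    have hyA := Finset.mem_erase.1 hy.1
    by_cases hsx : U.Adj s x
    · by_cases hsy : U.Adj s y
      · exact (hadj (hs.2 x hxA.2 y hyA.2 hsx hsy hxy)).elim
      · exact lift y hyA.2 hyA.1 hsy hy.2
    · exact lift x hxA.2 hxA.1 hsx hx.2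

theorem EliminableOn.exists_simplicial_ne {U : SimpleGraph V} {A : Finset V}
    (h : EliminableOn U A) {v x : V} (hx : x ∈ A) (hxv : x ≠ v) :
    ∃ s, IsSimplicialIn U A s ∧ s ≠ v := by
  rcases h.clique_or_two_simplicial with hcl | ⟨s, t, hs, ht, hst, -⟩
  · exact ⟨x, ⟨hx, fun u hu w hw _ _ huw => hcl hu hw huw⟩, hxv⟩
  · by_cases hsv : s = v
    · exact ⟨t, ht, fun htv => hst (hsv.trans htv.symm)⟩
    · exact ⟨s, hs, hsv⟩

/-- A chordal graph has an ordering that starts at any given vertex and in which the earlier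
neighbours of every vertex form a clique. -/
theorem EliminableOn.exists_ordering {U : SimpleGraph V} {A : Finset V} (h : EliminableOn U A)
    {v : V} (hv : v ∈ A) :
    ∃ g : V → ℕ, Set.InjOn g (A : Set V) ∧ (∀ u ∈ A, u ≠ v → g v < g u) ∧
      ∀ x ∈ A, ∀ u ∈ A, ∀ w ∈ A, U.Adj x u → U.Adj x w → g u < g x → g w < g x → u ≠ w →
        U.Adj u w := by
  induction hk : A.card using Nat.strong_induction_on generalizing A with
  | _ k ih =>
  subst hk
  by_cases hA : ∃ x ∈ A, x ≠ v
  · obtain ⟨x, hx, hxv⟩ := hA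
    obtain ⟨s, hs, hsv⟩ := h.exists_simplicial_ne hx hxv
    obtain ⟨g, hinj, hmin, hcl⟩ := ih _ (Finset.card_erase_lt_of_mem hs.1)
      (h.subset (Finset.erase_subset s A)) (Finset.mem_erase.2 ⟨hsv.symm, hv⟩) rfl
    -- the simplicial vertex `s` is put at the end
    have hlt : ∀ u ∈ A, u ≠ s → g u < A.sup g + 1 := fun u hu _ =>
      Nat.lt_succ_of_le (Finset.le_sup (f := g) hu)
    have hgs : ∀ u, u ≠ s → Function.update g s (A.sup g + 1) u = g u := fun u hu =>
      Function.update_of_ne hu _ _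
    have hss : Function.update g s (A.sup g + 1) s = A.sup g + 1 := Function.update_self ..
    refine ⟨Function.update g s (A.sup g + 1), ?_, ?_, ?_⟩
    · intro a ha b hb hab
      by_cases has : a = s <;> by_cases hbs : b = s
      · rw [has, hbs]
      · rw [has, hss, hgs b hbs] at hab; have := hlt b hb hbs; omega
      · rw [hbs, hss, hgs a has] at hab; have := hlt a ha has; omega
      · rw [hgs a has, hgs b hbs] at hab
        exact hinj (by simpa using ⟨ha, has⟩) (by simpa using ⟨hb, hbs⟩) hab
    · intro u hu huv
      rw [hgs v hsv.symm]
      by_cases hus : u = s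
      · rw [hus, hss]; exact hlt v hv hsv.symm
      · rw [hgs u hus]; exact hmin u (Finset.mem_erase.2 ⟨hus, hu⟩) huv
    · intro x hx u hu w hw hxu hxw hux hwx huw
      by_cases hxs : x = s
      · subst hxs; exact hs.2 u hu w hw hxu hxw huw
      rw [hgs x hxs] at hux hwx
      have key : ∀ u ∈ A, Function.update g s (A.sup g + 1) u < g x → u ≠ s := by
        rintro u hu hux rfl
        rw [hss] at hux; have := hlt x hx hxs; omega
      have hus := key u hu hux
      have hws := key w hw hwx
      rw [hgs u hus] at hux
      rw [hgs w hws] at hwx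
      exact hcl x (Finset.mem_erase.2 ⟨hxs, hx⟩) u (Finset.mem_erase.2 ⟨hus, hu⟩) w
        (Finset.mem_erase.2 ⟨hws, hw⟩) hxu hxw hux hwx huw
  · push Not at hA
    refine ⟨fun _ => 0, fun a ha b hb _ => (hA a ha).trans (hA b hb).symm,
      fun u hu huv => (huv (hA u hu)).elim, fun x _ u hu w hw _ _ h1 => (lt_irrefl _ h1).elim⟩

/-- In a chordal graph, if `C` is connected (stated by cuts) and every vertex of the clique `N` has
a neighbour in `C`, then some vertex of `C` is adjacent to all of `N`. -/
theorem EliminableOn.exists_adj_all {U : SimpleGraph V} {C N : Finset V}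
    (h : EliminableOn U (C ∪ N)) (hne : C.Nonempty) (hdisj : Disjoint C N)
    (hconn : ∀ B ⊆ C, B.Nonempty → B ≠ C → ∃ b ∈ B, ∃ c ∈ C \ B, U.Adj b c)
    (hcl : U.IsClique (N : Set V)) (hN : ∀ w ∈ N, ∃ c ∈ C, U.Adj c w) :
    ∃ x ∈ C, ∀ w ∈ N, U.Adj x w := by
  induction hk : C.card using Nat.strong_induction_on generalizing C with
  | _ k ih =>
  subst hk
  rcases h.clique_or_two_simplicial with hall | ⟨s, t, hs, ht, hst, hadj⟩
  · obtain ⟨x, hx⟩ := hne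
    refine ⟨x, hx, fun w hw => hall (by simp [hx]) (by simp [hw]) ?_⟩
    rintro rfl
    exact Finset.disjoint_left.1 hdisj hx hw
  obtain ⟨s, hsC, hs⟩ : ∃ s ∈ C, IsSimplicialIn U (C ∪ N) s := by
    rcases Finset.mem_union.1 hs.1 with h1 | h1
    · exact ⟨s, h1, hs⟩
    rcases Finset.mem_union.1 ht.1 with h2 | h2
    · exact ⟨t, h2, ht⟩
    exact (hadj (hcl h1 h2 hst)).elim
  by_cases hone : {s} = C
  · refine ⟨s, hsC, fun w hw => ?_⟩
    obtain ⟨c, hc, hcw⟩ := hN w hw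
    rw [← hone, Finset.mem_singleton] at hc
    rwa [hc] at hcw
  -- the simplicial vertex `s` can be removed from `C`: its neighbours in `C` and `N` are adjacent
  obtain ⟨b, hb, d, hd, hsd⟩ := hconn {s} (by simpa using hsC) (by simp) hone
  rw [Finset.mem_singleton] at hb
  subst hb
  rw [Finset.mem_sdiff, Finset.mem_singleton] at hd
  have hsub : C.erase b ⊆ C := Finset.erase_subset _ _
  suffices hrec : _ ∧ _ by
    obtain ⟨x, hx, hxN⟩ := ih _ (Finset.card_erase_lt_of_mem hsC)
      (h.subset (Finset.union_subset_union hsub subset_rfl)) ⟨d, Finset.mem_erase.2 ⟨hd.2, hd.1⟩⟩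
      (Finset.disjoint_of_subset_left hsub hdisj) hrec.1 hrec.2 rfl
    exact ⟨x, hsub hx, hxN⟩
  constructor
  · intro B hB hBne hBC
    obtain ⟨p, hp, q, hq, hpq⟩ := hconn B (hB.trans hsub) hBne (by
      rintro rfl; exact Finset.notMem_erase b B (hB hsC))
    rw [Finset.mem_sdiff] at hq
    by_cases hqb : q = b
    · subst hqb
      have hins : insert q B ≠ C := by
        rintro rfl
        refine hBC (Finset.Subset.antisymm hB fun z hz => ?_)
        obtain ⟨h1, h2⟩ := Finset.mem_erase.1 hz
        exact (Finset.mem_insert.1 h2).resolve_left h1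
      obtain ⟨p', hp', q', hq', hpq'⟩ := hconn (insert q B)
        (Finset.insert_subset hsC (hB.trans hsub)) (by simp) hins
      rw [Finset.mem_sdiff, Finset.mem_insert, not_or] at hq'
      have hq'' : q' ∈ C.erase q \ B := by simp [hq']
      rcases Finset.mem_insert.1 hp' with rfl | hp'
      · refine ⟨p, hp, q', hq'', hs.2 p ?_ q' ?_ hpq.symm hpq' ?_⟩
        · exact Finset.mem_union_left _ (hsub (hB hp))
        · exact Finset.mem_union_left _ hq'.1
        · rintro rfl; exact hq'.2.2 hp
      · exact ⟨p', hp', q', hq'', hpq'⟩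
    · exact ⟨p, hp, q, by simp [hqb, hq], hpq⟩
  · intro w hw
    obtain ⟨c, hc, hcw⟩ := hN w hw
    by_cases hcb : c = b
    · subst hcb
      refine ⟨d, Finset.mem_erase.2 ⟨hd.2, hd.1⟩, hs.2 d (Finset.mem_union_left _ hd.1) w
        (Finset.mem_union_right _ hw) hsd hcw ?_⟩
      rintro rfl
      exact Finset.disjoint_left.1 hdisj hd.1 hw
    · exact ⟨c, Finset.mem_erase.2 ⟨hcb, hc⟩, hcw⟩

end Elimination

/-! ### Reorienting a block -/

section Reorient

variable {V : Type*}

/-- The digraph obtained from `G` by orienting the edges inside `M` along the numbering `g`. -/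
def reorient (G : DAG V) (M : Set V) (g : V → ℕ) : Digraph V where
  Adj u v := (u ∈ M ∧ v ∈ M ∧ Joined G.graph u v ∧ g u < g v) ∨
    (¬ (u ∈ M ∧ v ∈ M) ∧ G.graph.Adj u v)

theorem reorient_acyclic {I : Set (Finset V)} {G : DAG V} {M : Set V} (hM : IsBlock I G M)
    (g : V → ℕ) (v : V) : ¬ Relation.TransGen (reorient G M g).Adj v v := by
  -- a path stays in `M` and increases `g`, or it gives a path of `G` whose ends may be moved
  -- within `M`
  have key : ∀ u v, Relation.TransGen (reorient G M g).Adj u v →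
      (u ∈ M ∧ v ∈ M ∧ g u < g v) ∨ ∃ u', (u' = u ∨ (u ∈ M ∧ u' ∈ M)) ∧
        ∀ v', (v' = v ∨ (v ∈ M ∧ v' ∈ M)) → Relation.TransGen G.graph.Adj u' v' := by
    have move : ∀ u v, ¬ (u ∈ M ∧ v ∈ M) → G.graph.Adj u v →
        ∀ v', (v' = v ∨ (v ∈ M ∧ v' ∈ M)) → G.graph.Adj u v' := by
      rintro u v hn huv v' (rfl | ⟨hv, hv'⟩)
      · exact huv
      · exact hM.parents v hv v' hv' u (fun hu => hn ⟨hu, hv⟩) huv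
    intro u v h
    induction h with
    | single h =>
      rcases h with ⟨hu, hv, -, hg⟩ | ⟨hn, h⟩
      · exact Or.inl ⟨hu, hv, hg⟩
      · exact Or.inr ⟨u, Or.inl rfl, fun v' hv' => .single (move _ _ hn h v' hv')⟩
    | tail _ h ih =>
      rename_i w v _
      rcases h with ⟨hw, hv, -, hg⟩ | ⟨hn, h⟩
      · rcases ih with ⟨hu, _, hg'⟩ | ⟨u', hu', ih⟩
        · exact Or.inl ⟨hu, hv, hg'.trans hg⟩
        · refine Or.inr ⟨u', hu', fun v' hv' => ih v' (Or.inr ⟨hw, ?_⟩)⟩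
          rcases hv' with rfl | hv'
          · exact hv
          · exact hv'.2
      · rcases ih with ⟨hu, hw, _⟩ | ⟨u', hu', ih⟩
        · exact Or.inr ⟨w, Or.inr ⟨hu, hw⟩, fun v' hv' => .single (move _ _ hn h v' hv')⟩
        · exact Or.inr ⟨u', hu', fun v' hv' => (ih w (Or.inl rfl)).tail (move _ _ hn h v' hv')⟩
  intro h
  rcases key v v h with ⟨_, _, hg⟩ | ⟨u', hu', h'⟩
  · exact lt_irrefl _ hg
  · exact G.acyclic u' (h' u' hu')

/-- Two DAGs are `I`-equivalent if they differ only in the directions of the edges inside a set `M`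
that is a block of the first and has no v-structure in the second. -/
theorem interventionEquiv_of_agree {I : Set (Finset V)} {G G' : DAG V} {M : Set V}
    (hM : IsBlock I G M)
    (hmoral : ∀ v ∈ M, ∀ u ∈ M, ∀ w ∈ M, G'.graph.Adj u v → G'.graph.Adj w v → u ≠ w →
      Joined G'.graph u w)
    (hskel : ∀ u v, Joined G.graph u v ↔ Joined G'.graph u v)
    (hout : ∀ u v, ¬ (u ∈ M ∧ v ∈ M) → (G.graph.Adj u v ↔ G'.graph.Adj u v)) :
    InterventionEquiv I G G' := by
  have hM' : IsBlock I G' M := by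
    refine ⟨fun u hu v hv w hw h => ?_, hmoral, hM.unsplit⟩
    exact (hout w v (fun h => hw h.1)).1 (hM.parents u hu v hv w hw
      ((hout w u (fun h => hw h.1)).2 h))
  have skel : ∀ S : Finset V, (∀ u ∈ M, ∀ v ∈ M, u ∈ S → v ∈ S) → ∀ u v,
      Joined (G.intervened S) u v ↔ Joined (G'.intervened S) u v := by
    intro S hS u v
    by_cases huv : u ∈ M ∧ v ∈ M
    · have h1 : v ∉ S ↔ u ∉ S := not_congr ⟨hS v huv.2 u huv.1, hS u huv.1 v huv.2⟩
      have := hskel u v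
      simp only [Joined, DAG.intervened, h1] at this ⊢
      tauto
    · have h1 := hout u v huv
      have h2 := hout v u (fun h => huv ⟨h.2, h.1⟩)
      simp only [Joined, DAG.intervened, h1, h2]
  have vstr : ∀ S : Finset V, (∀ u ∈ M, ∀ v ∈ M, u ∈ S → v ∈ S) → ∀ {G G' : DAG V},
      IsBlock I G M → (∀ u v, Joined (G.intervened S) u v ↔ Joined (G'.intervened S) u v) →
      (∀ u v, ¬ (u ∈ M ∧ v ∈ M) → (G.graph.Adj u v ↔ G'.graph.Adj u v)) →
      ∀ u v w, IsVStructure (G.intervened S) u v w → IsVStructure (G'.intervened S) u v w := by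
    rintro S hS G G' hM hskel hout u v w ⟨⟨⟨huv, hvS⟩, -⟩, ⟨⟨hwv, -⟩, -⟩, hne, hj⟩
    have hj' := fun h => hj ((hskel u w).2 h)
    have main : ¬ (u ∈ M ∧ v ∈ M) ∧ ¬ (w ∈ M ∧ v ∈ M) := by
      refine ⟨fun ⟨hu, hv⟩ => ?_, fun ⟨hw, hv⟩ => ?_⟩
      · have huS : u ∉ S := fun h => hvS (hS u hu v hv h)
        by_cases hw : w ∈ M
        · have hwS : w ∉ S := fun h => hvS (hS w hw v hv h)
          exact hj ((hM.moral v hv u hu w hw huv hwv hne).imp (fun h => ⟨h, hwS⟩)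
            (fun h => ⟨h, huS⟩))
        · exact hj (Or.inr ⟨hM.parents v hv u hu w hw hwv, huS⟩)
      · have hwS : w ∉ S := fun h => hvS (hS w hw v hv h)
        by_cases hu : u ∈ M
        · have huS : u ∉ S := fun h => hvS (hS u hu v hv h)
          exact hj ((hM.moral v hv u hu w hw huv hwv hne).imp (fun h => ⟨h, hwS⟩)
            (fun h => ⟨h, huS⟩))
        · exact hj (Or.inl ⟨hM.parents v hv w hw u hu huv, hwS⟩)
    have huv' := (hout u v main.1).1 huv
    have hwv' := (hout w v main.2).1 hwv
    exact ⟨⟨⟨huv', hvS⟩, fun h => G'.asymm huv' h.1⟩, ⟨⟨hwv', hvS⟩, fun h => G'.asymm hwv' h.1⟩,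
      hne, hj'⟩
  have equiv : ∀ S : Finset V, (∀ u ∈ M, ∀ v ∈ M, u ∈ S → v ∈ S) →
      MarkovEquiv (G.intervened S) (G'.intervened S) := fun S hS =>
    ⟨skel S hS, fun u v w => ⟨vstr S hS hM (skel S hS) hout u v w,
      vstr S hS hM' (fun u v => (skel S hS u v).symm) (fun u v h => (hout u v h).symm) u v w⟩⟩
  refine ⟨?_, fun S hS => equiv S (hM.unsplit S hS)⟩
  have := equiv ∅ (by simp)
  simpa [DAG.intervened] using this

/-- Every arc inside a block is reversed in some equivalent DAG. -/
theorem IsBlock.exists_reversed [Finite V] {I : Set (Finset V)} {G : DAG V} {M : Set V}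
    (hM : IsBlock I G M) {a b : V} (hab : G.graph.Adj a b) (ha : a ∈ M) (hb : b ∈ M) :
    ∃ G' : DAG V, InterventionEquiv I G G' ∧ G'.graph.Adj b a := by
  classical
  obtain ⟨f, hf⟩ := G.exists_rank
  let U : SimpleGraph V := ⟨fun u v => Joined G.graph u v, ⟨fun _ _ h => h.symm⟩,
    ⟨fun v h => h.elim (G.not_adj_self v) (G.not_adj_self v)⟩⟩
  have hMf : M.Finite := Set.toFinite M
  have helim : EliminableOn U hMf.toFinset := by
    intro B hB hne
    obtain ⟨s, hs, hmax⟩ := B.exists_max_image f hne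
    have hBM : ∀ u ∈ B, u ∈ M := fun u hu => hMf.mem_toFinset.1 (hB hu)
    have par : ∀ u ∈ B, Joined G.graph s u → G.graph.Adj u s := fun u hu h =>
      h.resolve_left fun h => by have := hf s u h; have := hmax u hu; omega
    exact ⟨s, hs, fun u hu w hw hsu hsw hne =>
      hM.moral s (hBM s hs) u (hBM u hu) w (hBM w hw) (par u hu hsu) (par w hw hsw) hne⟩
  obtain ⟨g, hinj, hmin, hcl⟩ := helim.exists_ordering (hMf.mem_toFinset.2 hb)
  simp only [Set.Finite.mem_toFinset] at hmin hcl
  rw [Set.Finite.coe_toFinset] at hinj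
  let G' : DAG V := ⟨reorient G M g, reorient_acyclic hM g⟩
  have hskel : ∀ u v, Joined G.graph u v ↔ Joined G'.graph u v := by
    intro u v
    by_cases huv : u ∈ M ∧ v ∈ M
    · have huv' : v ∈ M ∧ u ∈ M := huv.symm
      have hlt : Joined G.graph u v → g u < g v ∨ g v < g u := by
        intro h
        refine lt_or_gt_of_ne fun hg => ?_
        rw [hinj huv.1 huv.2 hg] at h
        exact h.elim (G.not_adj_self v) (G.not_adj_self v)
      have hc : Joined G.graph v u ↔ Joined G.graph u v := joined_comm
      change _ ↔ (_ ∨ _) ∨ (_ ∨ _)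
      rw [hc]
      simp only [huv, and_self, true_and, not_true, false_and, or_false]
      exact ⟨fun h => (hlt h).imp (⟨h, ·⟩) (⟨h, ·⟩), fun h => h.elim And.left And.left⟩
    · have huv' : ¬ (v ∈ M ∧ u ∈ M) := fun h => huv h.symm
      change _ ↔ (_ ∨ _) ∨ (_ ∨ _)
      simp only [Joined]
      tauto
  refine ⟨G', interventionEquiv_of_agree hM ?_ hskel ?_,
    Or.inl ⟨hb, ha, Or.inr hab, hmin a ha (G.ne hab)⟩⟩
  · rintro v hv u hu w hw huv hwv hne
    rcases huv with ⟨-, -, huv, hguv⟩ | ⟨h, -⟩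
    · rcases hwv with ⟨-, -, hwv, hgwv⟩ | ⟨h, -⟩
      · exact (hskel u w).1 (hcl v hv u hu w hw huv.symm hwv.symm hguv hgwv hne)
      · exact (h ⟨hw, hv⟩).elim
    · exact (h ⟨hu, hv⟩).elim
  · intro u v huv
    change _ ↔ _ ∨ _
    tauto

end Reorient

/-! ### Chain components of essential graphs -/

section Essential

variable {V : Type*} {I J : Set (Finset V)} {G : DAG V}

theorem essentialGraph_joined {u v : V} (h : (essentialGraph I G).Adj u v) :
    Joined G.graph u v := by
  obtain ⟨G', hG, h⟩ := h
  exact (hG.1.1 u v).2 (Or.inl h)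

theorem essentialGraph_of_adj {u v : V} (h : G.graph.Adj u v) : (essentialGraph I G).Adj u v :=
  ⟨G, InterventionEquiv.refl I G, h⟩

theorem undirectedPart_anti (h : I ⊆ J) :
    undirectedPart (essentialGraph J G) ≤ undirectedPart (essentialGraph I G) := by
  rintro u v ⟨hne, ⟨G₁, h₁, h₁'⟩, ⟨G₂, h₂, h₂'⟩⟩
  exact ⟨hne, ⟨G₁, h₁.mono h, h₁'⟩, ⟨G₂, h₂.mono h, h₂'⟩⟩

theorem essentialGraph_eq_of_fullyOriented (h : FullyOriented (essentialGraph I G)) :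
    essentialGraph I G = G.graph := by
  have : ∀ u v, (essentialGraph I G).Adj u v ↔ G.graph.Adj u v := by
    refine fun u v => ⟨fun huv => ?_, essentialGraph_of_adj⟩
    refine (essentialGraph_joined huv).resolve_right fun hvu => h u v ⟨?_, huv, ?_⟩
    · exact (G.ne hvu).symm
    · exact essentialGraph_of_adj hvu
  cases hE : essentialGraph I G
  cases hG : G.graph
  rw [hE, hG] at this
  congr
  funext u v
  exact propext (this u v)

/-- The unoriented edges are the edges inside the maximal blocks. -/
theorem undirectedPart_adj_iff [Finite V] {u v : V} :
    (undirectedPart (essentialGraph I G)).Adj u v ↔ Joined G.graph u v ∧ BlockRel I G u v := by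
  constructor
  · rintro ⟨hne, huv, hvu⟩
    have aux : ∀ {u v}, (essentialGraph I G).Adj v u → G.graph.Adj u v → BlockRel I G u v := by
      rintro u v ⟨G', hG', hvu⟩ h
      by_contra hn
      exact G'.asymm hvu (adj_of_not_blockRel hG' h hn)
    have hj := essentialGraph_joined huv
    exact ⟨hj, hj.elim (aux hvu) (fun h => (aux huv h).symm)⟩
  · rintro ⟨hj, M, hM, hu, hv⟩
    have aux : ∀ {u v}, u ∈ M → v ∈ M → G.graph.Adj u v →
        (undirectedPart (essentialGraph I G)).Adj u v := fun hu hv h =>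
      ⟨G.ne h, essentialGraph_of_adj h, hM.exists_reversed h hu hv⟩
    exact hj.elim (aux hu hv) (fun h => (aux hv hu h).symm)

/-- The undirected part of an essential graph is chordal: the last vertex of a set in a
topological order is simplicial. -/
theorem eliminableOn_undirectedPart [Finite V] (A : Finset V) :
    EliminableOn (undirectedPart (essentialGraph I G)) A := by
  obtain ⟨f, hf⟩ := G.exists_rank
  intro B _ hne
  obtain ⟨s, hs, hmax⟩ := B.exists_max_image f hne
  refine ⟨s, hs, fun u hu w hw hsu hsw hne => ?_⟩
  rw [undirectedPart_adj_iff] at *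
  have par : ∀ u ∈ B, Joined G.graph s u → G.graph.Adj u s := fun u hu h =>
    h.resolve_left fun h => by have := hf s u h; have := hmax u hu; omega
  exact ⟨(isBlock_class I G s).moral s (BlockRel.refl _ _ _) u hsu.2.symm w hsw.2.symm
    (par u hu hsu.1) (par w hw hsw.1) hne, hsu.2.symm.trans hsw.2⟩

theorem blockRel_of_reachable [Finite V] {u v : V}
    (h : (undirectedPart (essentialGraph I G)).Reachable u v) : BlockRel I G u v := by
  obtain ⟨p⟩ := h
  induction p with
  | nil => exact BlockRel.refl _ _ _
  | cons h _ ih => exact (undirectedPart_adj_iff.1 h).2.trans ih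

/-- Chain components are blocks. -/
theorem isBlock_supp [Finite V]
    (H : (undirectedPart (essentialGraph I G)).ConnectedComponent) : IsBlock I G H.supp := by
  have hrel : ∀ u ∈ H.supp, ∀ v ∈ H.supp, BlockRel I G u v := fun u hu v hv =>
    blockRel_of_reachable (SimpleGraph.ConnectedComponent.exact (hu.trans hv.symm))
  refine ⟨fun u hu v hv w hw hwu => ?_, fun v hv u hu w hw huv hwv hne => ?_,
    fun S hS u hu v hv => ((hrel u hu v hv).mem_iff hS).1⟩
  · refine (hrel u hu v hv).adj (fun h => hw ?_) hwu
    have hadj : (undirectedPart (essentialGraph I G)).Adj w u :=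
      undirectedPart_adj_iff.2 ⟨Or.inl hwu, h⟩
    exact (SimpleGraph.ConnectedComponent.sound hadj.reachable).trans hu
  · exact (isBlock_class I G v).moral v (BlockRel.refl _ _ _) u (hrel u hu v hv) w
      (hrel w hw v hv) huv hwv hne

theorem not_adj_of_separated [Finite V] {S : Finset V} (hS : S ∈ I) {u v : V}
    (h : ¬ (u ∈ S ↔ v ∈ S)) : ¬ (undirectedPart (essentialGraph I G)).Adj u v := fun hadj =>
  h ((undirectedPart_adj_iff.1 hadj).2.mem_iff hS)

end Essential

/-! ### The lower bound on the verification number -/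

section LowerBound

variable {V : Type*} {I J : Set (Finset V)} {G : DAG V}

/-- A verifying set meets every covered arc: the ends of an arc `p → q` for which `p` and `q` have
the same other parents form a block for all interventions that avoid them. -/
theorem mem_or_mem_of_covered [Finite V] (hJ : essentialGraph J G = G.graph) {T : Finset V}
    (hT : ∀ S ∈ J, S ⊆ T) {p q : V} (hpq : G.graph.Adj p q)
    (hcov : ∀ w, w ≠ p → (G.graph.Adj w p ↔ G.graph.Adj w q)) : p ∈ T ∨ q ∈ T := by
  by_contra! hn
  have hblock : IsBlock J G {p, q} := by
    refine ⟨?_, ?_, ?_⟩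
    · rintro u hu v hv w hw hwu
      have hw' : w ≠ p := fun h => hw (Or.inl h)
      have := hcov w hw'
      rcases hu with rfl | rfl <;> rcases hv with rfl | rfl <;> tauto
    · rintro v hv u hu w hw huv hwv hne
      rcases hu with rfl | rfl <;> rcases hw with rfl | rfl
      · exact (hne rfl).elim
      · exact Or.inl hpq
      · exact Or.inr hpq
      · exact (hne rfl).elim
    · rintro S hS u hu v hv huS
      have := hT S hS huS
      rcases hu with rfl | rfl
      · exact (hn.1 this).elim
      · exact (hn.2 this).elim
  have hadj : (undirectedPart (essentialGraph J G)).Adj p q :=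
    undirectedPart_adj_iff.2 ⟨Or.inl hpq, _, hblock, Or.inl rfl, Or.inr rfl⟩
  have hqp : G.graph.Adj q p := hJ ▸ hadj.2.2
  exact G.asymm hpq hqp

/-- A clique inside a block has at most `2 t + 1` vertices if a verifying set intervenes on `t`
vertices of the block. From the last vertex of the clique follow the latest parents inside the
block: the number of parents drops by at most one in each step, and only along covered arcs. Each
covered arc contains a vertex that is intervened on, and each vertex lies on at most two arcs of the
path. -/
theorem card_clique_le [Fintype V] (hJ : essentialGraph J G = G.graph) {T : Finset V}
    (hT : ∀ S ∈ J, S ⊆ T) {H : Set V} [DecidablePred (· ∈ H)] (hH : IsBlock I G H) {K : Finset V}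
    (hKH : ∀ v ∈ K, v ∈ H) (hcl : ∀ u ∈ K, ∀ w ∈ K, u ≠ w → Joined G.graph u w) :
    K.card ≤ 2 * (T.filter (· ∈ H)).card + 1 := by
  classical
  obtain ⟨f, hf⟩ := G.exists_rank
  set pa : V → Finset V := fun v => Finset.univ.filter fun u => u ∈ H ∧ G.graph.Adj u v with hpa
  have mem_pa : ∀ u v, u ∈ pa v ↔ u ∈ H ∧ G.graph.Adj u v := fun u v => by simp [hpa]
  set below : V → Finset V := fun v => T.filter fun u => u ∈ H ∧ f u ≤ f v with hbelow
  -- the summand for `v ∈ T` reserves the use of `v` for the next covered arc of the path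
  have key : ∀ v ∈ H, (pa v).card + (if v ∈ T then 1 else 0) ≤ 2 * (below v).card := by
    intro v hv
    induction hk : f v using Nat.strong_induction_on generalizing v with
    | _ k ih =>
    subst hk
    rcases (pa v).eq_empty_or_nonempty with he | hne
    · rw [he, Finset.card_empty]
      split_ifs with hvT
      · have : 0 < (below v).card := Finset.card_pos.2 ⟨v, by simp [hbelow, hv, hvT]⟩
        omega
      · omega
    -- `p` is the latest parent of `v`, and is joined to all other parents
    obtain ⟨p, hp, hmax⟩ := (pa v).exists_max_image f hne
    obtain ⟨hpH, hpv⟩ := (mem_pa p v).1 hp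
    have hfp := hf p v hpv
    have ihp := ih (f p) hfp p hpH rfl
    have hsub : pa v ⊆ insert p (pa p) := by
      intro u hu
      obtain ⟨huH, huv⟩ := (mem_pa u v).1 hu
      rw [Finset.mem_insert, mem_pa]
      by_cases hup : u = p
      · exact Or.inl hup
      refine Or.inr ⟨huH, (hH.moral v hv u huH p hpH huv hpv hup).resolve_right fun h => ?_⟩
      have h1 := hf p u h
      have h2 := hmax u hu
      omega
    have hpp : p ∉ pa p := fun h => G.not_adj_self p ((mem_pa p p).1 h).2
    have hcard := Finset.card_le_card hsub
    rw [Finset.card_insert_of_notMem hpp] at hcard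
    have hmono : below p ⊆ below v := by
      intro u hu
      simp only [hbelow, Finset.mem_filter] at hu ⊢
      exact ⟨hu.1, hu.2.1, by omega⟩
    have hmono' := Finset.card_le_card hmono
    have hlt : v ∈ T → (below p).card + 1 ≤ (below v).card := by
      intro hvT
      refine Finset.card_lt_card ⟨hmono, fun h => ?_⟩
      have : v ∈ below p := h (by simp [hbelow, hv, hvT])
      simp only [hbelow, Finset.mem_filter] at this
      omega
    by_cases heq : (pa v).card = (pa p).card + 1
    · have hEq : pa v = insert p (pa p) := Finset.eq_of_subset_of_card_le hsub (by
        rw [Finset.card_insert_of_notMem hpp, heq])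
      have hcov : ∀ w, w ≠ p → (G.graph.Adj w p ↔ G.graph.Adj w v) := by
        intro w hwp
        by_cases hwH : w ∈ H
        · have := mem_pa w v
          rw [hEq, Finset.mem_insert, mem_pa] at this
          tauto
        · exact ⟨hH.parents p hpH v hv w hwH, hH.parents v hv p hpH w hwH⟩
      have := mem_or_mem_of_covered hJ hT hpv hcov
      by_cases hvT : v ∈ T
      · have := hlt hvT
        simp only [hvT, if_true] at ihp ⊢
        split_ifs at ihp <;> omega
      · have hpT := this.resolve_right hvT
        simp only [hvT, hpT, if_true, if_false] at ihp ⊢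
        omega
    · by_cases hvT : v ∈ T
      · have := hlt hvT
        simp only [hvT, if_true] at ihp ⊢
        split_ifs at ihp <;> omega
      · simp only [hvT, if_false] at ihp ⊢
        split_ifs at ihp <;> omega
  rcases K.eq_empty_or_nonempty with rfl | hne
  · simp
  obtain ⟨s, hs, hmax⟩ := K.exists_max_image f hne
  have hsub : K.erase s ⊆ pa s := by
    intro u hu
    obtain ⟨hus, huK⟩ := Finset.mem_erase.1 hu
    refine (mem_pa u s).2 ⟨hKH u huK, (hcl u huK s hs hus).resolve_right fun h => ?_⟩
    have h1 := hf s u h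
    have h2 := hmax u huK
    omega
  have h1 := Finset.card_le_card hsub
  rw [Finset.card_erase_of_mem hs] at h1
  have h2 := key s (hKH s hs)
  have h3 : (below s).card ≤ (T.filter (· ∈ H)).card := by
    refine Finset.card_le_card fun u hu => ?_
    simp only [hbelow, Finset.mem_filter] at hu ⊢
    exact ⟨hu.1, hu.2.1⟩
  omega

/-- The infimum in the verification number is attained: intervening on all single vertices
orients all edges. -/
theorem exists_verifying [Fintype V] (G : DAG V) {k : ℕ} (hk : 1 ≤ k) :
    ∃ J : Finset (Finset V), (∀ S ∈ J, S.card ≤ k) ∧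
      essentialGraph (J : Set (Finset V)) G = G.graph ∧ J.card = verificationNumber k G := by
  classical
  refine Nat.sInf_mem (s := {m | ∃ I : Finset (Finset V), (∀ S ∈ I, S.card ≤ k) ∧
    essentialGraph (I : Set (Finset V)) G = G.graph ∧ I.card = m})
    ⟨_, Finset.univ.image (fun v : V => ({v} : Finset V)), ?_, ?_, rfl⟩
  · intro S hS
    obtain ⟨v, -, rfl⟩ := Finset.mem_image.1 hS
    simpa using hk
  · refine essentialGraph_eq_of_fullyOriented fun u v huv => ?_
    refine not_adj_of_separated (S := {u}) (by simp) ?_ huv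
    simpa using huv.ne.symm

theorem exists_adj_of_two_le {U : SimpleGraph V} [Finite V] {H : U.ConnectedComponent}
    (h : 2 ≤ H.supp.ncard) : ∃ u ∈ H.supp, ∃ v ∈ H.supp, U.Adj u v := by
  obtain ⟨u, v, hu, hv, hne⟩ := (Set.one_lt_ncard_iff (Set.toFinite _)).1 h
  obtain ⟨p⟩ := SimpleGraph.ConnectedComponent.exact (hu.trans hv.symm)
  cases p with
  | nil => exact (hne rfl).elim
  | cons hadj _ =>
    exact ⟨u, hu, _, (SimpleGraph.ConnectedComponent.sound hadj.reachable.symm).trans hu, hadj⟩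

/-- The union of the clique separators of all chain components is at most `3 k` times the
verification number: if `t` vertices of a component are intervened on by a verifying set, then
`t ≥ 1`, and the separator has at most `2 t + 1 ≤ 3 t` vertices. -/
theorem card_separatorUnion_le [Fintype V] {k : ℕ} (hk : 1 ≤ k) {Q : Finset V}
    (hQ : IsSeparatorUnion (undirectedPart (essentialGraph I G)) Q) :
    Q.card ≤ 3 * (k * verificationNumber k G) := by
  classical
  obtain ⟨J, hJk, hJ, hcard⟩ := exists_verifying G hk
  set U := undirectedPart (essentialGraph I G)
  obtain ⟨K, hK, hQK⟩ := hQ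
  set T : Finset V := J.biUnion id
  have hT : ∀ S ∈ (J : Set (Finset V)), S ⊆ T := fun S hS => Finset.subset_biUnion_of_mem id hS
  have hTk : T.card ≤ k * J.card := by
    rw [mul_comm]
    exact Finset.card_biUnion_le_card_mul J id k hJk
  have hfib : ∀ A : Finset V, A.card = ∑ H : U.ConnectedComponent,
      (A.filter fun v => U.connectedComponentMk v = H).card := fun A =>
    Finset.card_eq_sum_card_fiberwise (fun _ _ => Finset.mem_coe.2 (Finset.mem_univ _))
  have hle : ∀ H : U.ConnectedComponent, (Q.filter fun v => U.connectedComponentMk v = H).card ≤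
      3 * (T.filter fun v => U.connectedComponentMk v = H).card := by
    intro H
    by_cases hH : 2 ≤ H.supp.ncard
    · have hb := isBlock_supp H
      have hsub : (Q.filter fun v => U.connectedComponentMk v = H) ⊆ K H := by
        intro v hv
        obtain ⟨hvQ, hvH⟩ := Finset.mem_filter.1 hv
        obtain ⟨H', hH', hv'⟩ := (hQK v).1 hvQ
        have : U.connectedComponentMk v = H' := (hK H' hH').1 hv'
        rw [← hvH, this]
        exact hv'
      have h1 := card_clique_le hJ hT hb (K := K H) (fun v hv => (hK H hH).1 hv)
        (fun u hu w hw hne => (undirectedPart_adj_iff.1 ((hK H hH).2.1 hu hw hne)).1)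
      -- an edge of the component, as a clique with two vertices, shows that `t ≥ 1`
      obtain ⟨u, hu, v, hv, huv⟩ := exists_adj_of_two_le hH
      have h2 := card_clique_le hJ hT hb (K := {u, v}) (by
        intro a ha
        rcases Finset.mem_insert.1 ha with rfl | ha
        · exact hu
        · rw [Finset.mem_singleton.1 ha]; exact hv) (by
        have := (undirectedPart_adj_iff.1 huv).1
        intro a ha b hb hne
        simp only [Finset.mem_insert, Finset.mem_singleton] at ha hb
        rcases ha with rfl | rfl <;> rcases hb with rfl | rfl
        · exact (hne rfl).elim
        · exact this
        · exact this.symm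
        · exact (hne rfl).elim)
      rw [Finset.card_pair huv.ne] at h2
      have h3 := Finset.card_le_card hsub
      have h4 : (T.filter (· ∈ H.supp)) = T.filter fun v => U.connectedComponentMk v = H := by
        ext v; simp
      rw [h4] at h1 h2
      omega
    · have : (Q.filter fun v => U.connectedComponentMk v = H) = ∅ := by
        refine Finset.filter_eq_empty_iff.2 fun v hv hvH => ?_
        obtain ⟨H', hH', hv'⟩ := (hQK v).1 hv
        have : U.connectedComponentMk v = H' := (hK H' hH').1 hv'
        rw [hvH] at this
        exact hH (this ▸ hH')
      rw [this]
      simp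
  calc Q.card = _ := hfib Q
    _ ≤ ∑ H : U.ConnectedComponent, 3 * (T.filter fun v => U.connectedComponentMk v = H).card :=
        Finset.sum_le_sum fun H _ => hle H
    _ = 3 * T.card := by rw [← Finset.mul_sum, ← hfib T]
    _ ≤ _ := by rw [← hcard]; omega

end LowerBound

/-! ### Clique separators of chordal graphs -/

section Separators

variable {V : Type*}

/-- The graph `U` with all edges at vertices of `K` removed. -/
def avoid (U : SimpleGraph V) (K : Finset V) : SimpleGraph V where
  Adj u v := U.Adj u v ∧ u ∉ K ∧ v ∉ K
  symm := ⟨fun _ _ h => ⟨h.1.symm, h.2.2, h.2.1⟩⟩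
  loopless := ⟨fun _ h => h.1.ne rfl⟩

theorem avoid_le (U : SimpleGraph V) (K : Finset V) : avoid U K ≤ U := fun _ _ h => h.1

theorem avoid_empty (U : SimpleGraph V) : avoid U ∅ = U := by
  ext u v
  simp [avoid]

/-- The size of the connected component of `v`. -/
noncomputable def componentSize (U : SimpleGraph V) (v : V) : ℕ := {w | U.Reachable v w}.ncard

theorem componentSize_congr {U : SimpleGraph V} {u v : V} (h : U.Reachable u v) :
    componentSize U u = componentSize U v := by
  unfold componentSize
  congr 1
  ext w
  exact ⟨h.symm.trans, h.trans⟩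

theorem ncard_supp (U : SimpleGraph V) (H : U.ConnectedComponent) {v : V} (hv : v ∈ H.supp) :
    H.supp.ncard = componentSize U v := by
  unfold componentSize
  congr 1
  ext w
  constructor
  · intro hw
    exact SimpleGraph.ConnectedComponent.exact (Eq.trans hv (Eq.symm hw))
  · intro hw
    exact (SimpleGraph.ConnectedComponent.sound (SimpleGraph.Reachable.symm hw)).trans hv

theorem reachable_avoid_notMem {U : SimpleGraph V} {K : Finset V} {u v : V}
    (h : (avoid U K).Reachable u v) (hu : u ∉ K) : v ∉ K := by
  rw [SimpleGraph.reachable_iff_reflTransGen] at h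
  cases h with
  | refl => exact hu
  | tail _ h => exact h.2.2

/-- `v` lies in a component of `U - K` with more than half of the vertices of its component
in `U`. -/
def IsBig (U : SimpleGraph V) (K : Finset V) (v : V) : Prop :=
  v ∉ K ∧ 2 ≤ componentSize U v ∧ componentSize U v < 2 * componentSize (avoid U K) v

/-- `x` lies in a big component `C` of `U - K` and is adjacent to all vertices of `K` that have a
neighbour in `C`. -/
def IsGood (U : SimpleGraph V) (K : Finset V) (x : V) : Prop :=
  IsBig U K x ∧ ∀ w ∈ K, U.Reachable x w → (∃ d, IsBig U K d ∧ U.Adj d w) → U.Adj x w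

theorem IsBig.of_reachable {U : SimpleGraph V} {K : Finset V} {u v : V} (hu : IsBig U K u)
    (h : (avoid U K).Reachable u v) : IsBig U K v := by
  refine ⟨reachable_avoid_notMem h hu.1, ?_⟩
  rw [← componentSize_congr h, ← componentSize_congr (h.mono (avoid_le U K))]
  exact hu.2

theorem add_componentSize_le [Finite V] {U U₁ U₂ : SimpleGraph V} (h₁ : U₁ ≤ U) (h₂ : U₂ ≤ U)
    {u v : V} (h : U.Reachable u v) (hd : ∀ w, U₁.Reachable u w → ¬ U₂.Reachable v w) :
    componentSize U₁ u + componentSize U₂ v ≤ componentSize U u := by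
  unfold componentSize
  have hdisj : Disjoint {w | U₁.Reachable u w} {w | U₂.Reachable v w} :=
    Set.disjoint_left.2 hd
  rw [← Set.ncard_union_eq hdisj (Set.toFinite _) (Set.toFinite _)]
  refine Set.ncard_le_ncard ?_ (Set.toFinite _)
  rintro w (hw | hw)
  · exact SimpleGraph.Reachable.mono h₁ hw
  · exact h.trans (SimpleGraph.Reachable.mono h₂ hw)

/-- Each component of `U` contains at most one big component of `U - K`. -/
theorem IsBig.reachable [Finite V] {U : SimpleGraph V} {K : Finset V} {u v : V}
    (hu : IsBig U K u) (hv : IsBig U K v) (h : U.Reachable u v) :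
    (avoid U K).Reachable u v := by
  by_contra hn
  have h1 := add_componentSize_le (avoid_le U K) (avoid_le U K) h
    (fun w hw hw' => hn (SimpleGraph.Reachable.trans hw (SimpleGraph.Reachable.symm hw')))
  have h2 := componentSize_congr h
  have h3 := hu.2.2
  have h4 := hv.2.2
  omega

/-- The invariant of the search for separators: `K` meets each component of `U` in a clique, and
misses the isolated vertices. -/
structure IsCliqueFamily (U : SimpleGraph V) (K : Finset V) : Prop where
  adj : ∀ u ∈ K, ∀ w ∈ K, U.Reachable u w → u ≠ w → U.Adj u w
  two_le : ∀ u ∈ K, 2 ≤ componentSize U u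

/-- A big component contains a vertex adjacent to all vertices of the separator at its border. -/
theorem exists_isGood [Fintype V] {U : SimpleGraph V} (hU : ∀ A, EliminableOn U A)
    {K : Finset V} (hK : IsCliqueFamily U K) {d : V} (hd : IsBig U K d) :
    ∃ x, IsGood U K x ∧ U.Reachable d x := by
  classical
  set C : Finset V := Finset.univ.filter fun w => (avoid U K).Reachable d w with hC
  set N : Finset V := K.filter fun w => ∃ c ∈ C, U.Adj c w with hN
  have memC : ∀ w, w ∈ C ↔ (avoid U K).Reachable d w := fun w => by simp [hC]
  have hCd : ∀ w ∈ C, U.Reachable d w := fun w hw => ((memC w).1 hw).mono (avoid_le U K)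
  have hdC : d ∈ C := (memC d).2 (SimpleGraph.Reachable.refl d)
  have hNd : ∀ w ∈ N, U.Reachable d w := by
    intro w hw
    obtain ⟨-, c, hc, hcw⟩ := Finset.mem_filter.1 hw
    exact (hCd c hc).trans hcw.reachable
  have hconn : ∀ B ⊆ C, B.Nonempty → B ≠ C → ∃ b ∈ B, ∃ c ∈ C \ B, U.Adj b c := by
    intro B hBC ⟨b, hb⟩ hne
    obtain ⟨c, hcC, hcB⟩ := Finset.exists_of_ssubset (hBC.ssubset_of_ne hne)
    by_contra! hcut
    have hbc : (avoid U K).Reachable b c := ((memC b).1 (hBC hb)).symm.trans ((memC c).1 hcC)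
    rw [SimpleGraph.reachable_iff_reflTransGen] at hbc
    refine hcB ?_
    clear hcB hcC
    induction hbc with
    | refl => exact hb
    | tail _ h ih =>
      rename_i y z _
      by_contra hz
      refine hcut y ih z (Finset.mem_sdiff.2 ⟨(memC z).2 ?_, hz⟩) h.1
      exact ((memC y).1 (hBC ih)).trans (SimpleGraph.Adj.reachable h)
  obtain ⟨x, hx, hxN⟩ := (hU (C ∪ N)).exists_adj_all ⟨d, hdC⟩
    (Finset.disjoint_left.2 fun w hw hwN =>
      reachable_avoid_notMem ((memC w).1 hw) hd.1 (Finset.mem_filter.1 hwN).1) hconn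
    (fun u hu w hw hne => hK.adj u (Finset.mem_filter.1 hu).1 w (Finset.mem_filter.1 hw).1
      ((hNd u hu).symm.trans (hNd w hw)) hne)
    (fun w hw => (Finset.mem_filter.1 hw).2)
  refine ⟨x, ⟨hd.of_reachable ((memC x).1 hx), fun w hwK hxw ⟨e, he, hew⟩ => hxN w ?_⟩, hCd x hx⟩
  refine Finset.mem_filter.2 ⟨hwK, e, (memC e).2 (hd.reachable he ?_), hew⟩
  exact (hCd x hx).trans (hxw.trans hew.symm.reachable)

/-- Once all edges at the separators are oriented, the components have at most half their size. -/
theorem exists_twice_le [Finite V] {U U' : SimpleGraph V} (hle : U' ≤ U) {Q : Finset V}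
    (hQ : IsSeparatorUnion U Q) (hadj : ∀ u ∈ Q, ∀ v, ¬ U'.Adj u v)
    {H' : U'.ConnectedComponent} (hH' : 2 ≤ H'.supp.ncard) :
    ∃ H : U.ConnectedComponent, 2 * H'.supp.ncard ≤ H.supp.ncard := by
  obtain ⟨K, hK, hQK⟩ := hQ
  obtain ⟨u, hu, x, -, hux⟩ := exists_adj_of_two_le hH'
  set H := U.connectedComponentMk u with hHdef
  have hsub : ∀ v ∈ H'.supp, U.Reachable u v := fun v hv =>
    SimpleGraph.Reachable.mono hle (SimpleGraph.ConnectedComponent.exact (Eq.trans hu (Eq.symm hv)))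
  have hH : 2 ≤ H.supp.ncard := by
    refine hH'.trans (Set.ncard_le_ncard (fun v hv => ?_) (Set.toFinite _))
    exact SimpleGraph.ConnectedComponent.sound (hsub v hv).symm
  have hnotK : ∀ a b, U'.Adj a b → a ∉ K H := fun a b hab ha =>
    hadj a ((hQK a).2 ⟨H, hH, ha⟩) b hab
  have hu' : u ∈ H.supp \ (K H : Set V) := ⟨rfl, hnotK u x hux⟩
  have hreach : ∀ v, U'.Reachable u v → ∃ hv : v ∈ H.supp \ (K H : Set V),
      (U.induce (H.supp \ (K H : Set V))).Reachable ⟨u, hu'⟩ ⟨v, hv⟩ := by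
    intro v hv
    rw [SimpleGraph.reachable_iff_reflTransGen] at hv
    induction hv with
    | refl => exact ⟨hu', SimpleGraph.Reachable.refl _⟩
    | tail _ h ih =>
      rename_i y z _
      obtain ⟨hy, ih⟩ := ih
      have hz : z ∈ H.supp \ (K H : Set V) := by
        refine ⟨?_, hnotK z y h.symm⟩
        exact (SimpleGraph.ConnectedComponent.sound (hle h.symm).reachable).trans hy.1
      refine ⟨hz, ih.trans (SimpleGraph.Adj.reachable ?_)⟩
      exact hle h
  refine ⟨H, le_trans (Nat.mul_le_mul_left 2 ?_)
    ((hK H hH).2.2 ((U.induce (H.supp \ (K H : Set V))).connectedComponentMk ⟨u, hu'⟩))⟩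
  rw [← Set.ncard_image_of_injective _ Subtype.val_injective]
  refine Set.ncard_le_ncard (fun v hv => ?_) (Set.toFinite _)
  obtain ⟨hv', h⟩ := hreach v (SimpleGraph.ConnectedComponent.exact (Eq.trans hu (Eq.symm hv)))
  exact ⟨⟨v, hv'⟩, SimpleGraph.ConnectedComponent.sound h.symm, rfl⟩

variable [LinearOrder V]

/-- `x` is the first good vertex of its component. -/
def IsFirstGood (U : SimpleGraph V) (K : Finset V) (x : V) : Prop :=
  IsGood U K x ∧ ∀ y < x, U.Reachable x y → ¬ IsGood U K y

variable [Fintype V]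

open Classical in
/-- One step of the search for separators, in all components of `U` at once. In a component of `U`
that contains a big component `C` of `U - K`, replace `K` by its vertices with a neighbour in `C`,
and the first vertex of `C` adjacent to all of these. -/
noncomputable def separatorStep (U : SimpleGraph V) (K : Finset V) : Finset V :=
  Finset.univ.filter fun v =>
    if ∃ d, IsBig U K d ∧ U.Reachable v d then
      (v ∈ K ∧ ∃ d, IsBig U K d ∧ U.Adj d v) ∨ IsFirstGood U K v
    else v ∈ K

theorem mem_separatorStep {U : SimpleGraph V} {K : Finset V} {v d : V} (hd : IsBig U K d)
    (h : U.Reachable v d) : v ∈ separatorStep U K ↔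
      (v ∈ K ∧ ∃ d, IsBig U K d ∧ U.Adj d v) ∨ IsFirstGood U K v := by
  classical
  rw [separatorStep, Finset.mem_filter, if_pos ⟨d, hd, h⟩]
  simp

theorem mem_separatorStep' {U : SimpleGraph V} {K : Finset V} {v : V}
    (h : ¬ ∃ d, IsBig U K d ∧ U.Reachable v d) : v ∈ separatorStep U K ↔ v ∈ K := by
  classical
  rw [separatorStep, Finset.mem_filter, if_neg h]
  simp

theorem IsCliqueFamily.step {U : SimpleGraph V} {K : Finset V} (hK : IsCliqueFamily U K) :
    IsCliqueFamily U (separatorStep U K) where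
  adj := by
    intro u hu w hw huw hne
    by_cases h : ∃ d, IsBig U K d ∧ U.Reachable u d
    · obtain ⟨d, hd, hud⟩ := h
      rw [mem_separatorStep hd hud] at hu
      rw [mem_separatorStep hd (huw.symm.trans hud)] at hw
      rcases hu with ⟨huK, hu⟩ | hu <;> rcases hw with ⟨hwK, hw⟩ | hw
      · exact hK.adj u huK w hwK huw hne
      · exact (hw.1.2 u huK huw.symm hu).symm
      · exact hu.1.2 w hwK huw hw
      · rcases lt_or_gt_of_ne hne with hlt | hlt
        · exact (hw.2 u hlt huw.symm hu.1).elim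
        · exact (hu.2 w hlt huw hw.1).elim
    · have h' : ¬ ∃ d, IsBig U K d ∧ U.Reachable w d := fun ⟨d, hd, hwd⟩ =>
        h ⟨d, hd, huw.trans hwd⟩
      rw [mem_separatorStep' h] at hu
      rw [mem_separatorStep' h'] at hw
      exact hK.adj u hu w hw huw hne
  two_le := by
    intro u hu
    by_cases h : ∃ d, IsBig U K d ∧ U.Reachable u d
    · obtain ⟨d, hd, hud⟩ := h
      rw [componentSize_congr hud]
      exact hd.2.1
    · rw [mem_separatorStep' h] at hu
      exact hK.two_le u hu

/-- A step does not create vertices in big components. -/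
theorem IsBig.of_step {U : SimpleGraph V} {K : Finset V} {v : V}
    (hv : IsBig U (separatorStep U K) v) : IsBig U K v := by
  by_cases h : ∃ d, IsBig U K d ∧ U.Reachable v d
  · obtain ⟨d, hd, hvd⟩ := h
    refine hd.of_reachable ?_
    by_contra hn
    -- a path that avoids the new separator cannot enter the old big component
    have hdisj : ∀ w, (avoid U (separatorStep U K)).Reachable v w →
        ¬ (avoid U K).Reachable d w := by
      intro w hw
      have hvw := hw
      rw [SimpleGraph.reachable_iff_reflTransGen] at hw
      induction hw with
      | refl => exact hn
      | tail hw h ih =>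
        rename_i y z
        have hvy : (avoid U (separatorStep U K)).Reachable v y :=
          (SimpleGraph.reachable_iff_reflTransGen _ _).2 hw
        intro hz
        refine ih hvy ?_
        by_cases hyK : y ∈ K
        · refine (h.2.1 ((mem_separatorStep hd
            ((hvy.mono (avoid_le _ _)).symm.trans hvd)).2 (Or.inl ⟨hyK, z, ?_, h.1.symm⟩))).elim
          exact hd.of_reachable hz
        · have hadj : (avoid U K).Adj z y :=
            ⟨h.1.symm, (hd.of_reachable hz).1, hyK⟩
          exact hz.trans hadj.reachable
    have h1 := add_componentSize_le (avoid_le U (separatorStep U K)) (avoid_le U K) hvd hdisj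
    have h2 := componentSize_congr hvd
    have h3 := hv.2.2
    have h4 := hd.2.2
    omega
  · have hmem : ∀ w, U.Reachable v w → (w ∈ separatorStep U K ↔ w ∈ K) := fun w hw =>
      mem_separatorStep' fun ⟨d, hd, hwd⟩ => h ⟨d, hd, hw.trans hwd⟩
    refine ⟨fun hvK => hv.1 ((hmem v (SimpleGraph.Reachable.refl v)).2 hvK), hv.2.1,
      hv.2.2.trans_le ?_⟩
    refine Nat.mul_le_mul_left 2 (Set.ncard_le_ncard (fun w hw => ?_) (Set.toFinite _))
    simp only [Set.mem_ofPred_eq] at hw ⊢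
    have hw' := hw
    rw [SimpleGraph.reachable_iff_reflTransGen] at hw
    induction hw with
    | refl => exact SimpleGraph.Reachable.refl v
    | tail hw h ih =>
      rename_i y z
      have hvy := (SimpleGraph.reachable_iff_reflTransGen _ _).2 hw
      have hy := (hmem y (hvy.mono (avoid_le _ _)))
      have hz := (hmem z (hw'.mono (avoid_le _ _)))
      have hadj : (avoid U K).Adj y z :=
        ⟨h.1, fun h' => h.2.1 (hy.2 h'), fun h' => h.2.2 (hz.2 h')⟩
      exact (ih hvy).trans hadj.reachable

/-- The first good vertex of a component enters the separator, and leaves its big component. -/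
theorem exists_isBig_not_step {U : SimpleGraph V} (hU : ∀ A, EliminableOn U A) {K : Finset V}
    (hK : IsCliqueFamily U K) {d : V} (hd : IsBig U K d) :
    ∃ x, IsBig U K x ∧ ¬ IsBig U (separatorStep U K) x := by
  classical
  obtain ⟨x, hx, hdx⟩ := exists_isGood hU hK hd
  obtain ⟨y, hy, hmin⟩ := (Finset.univ.filter fun y => IsGood U K y ∧ U.Reachable d y).exists_min_image
    id ⟨x, by simp [hx, hdx]⟩
  simp only [Finset.mem_filter, Finset.mem_univ, true_and, id] at hy hmin
  refine ⟨y, hy.1.1, fun hbig => hbig.1 ((mem_separatorStep hd hy.2.symm).2 (Or.inr ⟨hy.1, ?_⟩))⟩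
  intro z hz hyz hgood
  exact absurd (hmin z ⟨hgood, hy.2.trans hyz⟩) (not_le.2 hz)

theorem IsCliqueFamily.iterate {U : SimpleGraph V} (m : ℕ) :
    IsCliqueFamily U ((separatorStep U)^[m] ∅) := by
  induction m with
  | zero => exact ⟨by simp, by simp⟩
  | succ m ih => rw [Function.iterate_succ_apply']; exact ih.step

/-- In every step the set of vertices in big components shrinks, until it is empty. -/
theorem not_isBig_iterate {U : SimpleGraph V} (hU : ∀ A, EliminableOn U A) (v : V) :
    ¬ IsBig U ((separatorStep U)^[Fintype.card V] ∅) v := by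
  classical
  have key : ∀ m, (Finset.univ.filter fun v => IsBig U ((separatorStep U)^[m] ∅) v).card ≤
      Fintype.card V - m := by
    intro m
    induction m with
    | zero => exact Finset.card_le_univ _
    | succ m ih =>
      have hsub : (Finset.univ.filter fun v => IsBig U ((separatorStep U)^[m + 1] ∅) v) ⊆
          Finset.univ.filter fun v => IsBig U ((separatorStep U)^[m] ∅) v := by
        intro v hv
        simp only [Finset.mem_filter, Finset.mem_univ, true_and] at hv ⊢
        rw [Function.iterate_succ_apply'] at hv
        exact hv.of_step
      rcases (Finset.univ.filter fun v => IsBig U ((separatorStep U)^[m] ∅) v).eq_empty_or_nonempty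
        with he | ⟨d, hd⟩
      · rw [he, Finset.subset_empty] at hsub
        rw [hsub]
        simp
      · simp only [Finset.mem_filter, Finset.mem_univ, true_and] at hd
        obtain ⟨x, hx, hx'⟩ := exists_isBig_not_step hU (IsCliqueFamily.iterate m) hd
        rw [← Function.iterate_succ_apply' (separatorStep U)] at hx'
        have := Finset.card_lt_card (Finset.ssubset_iff_of_subset hsub |>.2 ⟨x,
          Finset.mem_filter.2 ⟨Finset.mem_univ x, hx⟩, fun h => hx' (Finset.mem_filter.1 h).2⟩)
        omega
  have := key (Fintype.card V)
  rw [Nat.sub_self, Nat.le_zero, Finset.card_eq_zero, Finset.filter_eq_empty_iff] at this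
  exact this (Finset.mem_univ v)

/-- The union of separators found by the search. -/
noncomputable def separatorUnion (U : SimpleGraph V) : Finset V :=
  (separatorStep U)^[Fintype.card V] ∅

theorem isSeparatorUnion_separatorUnion {U : SimpleGraph V} (hU : ∀ A, EliminableOn U A) :
    IsSeparatorUnion U (separatorUnion U) := by
  classical
  have hfam : IsCliqueFamily U (separatorUnion U) := IsCliqueFamily.iterate _
  refine ⟨fun H => (separatorUnion U).filter (· ∈ H.supp), fun H hH => ⟨?_, ?_, ?_⟩, fun v => ?_⟩
  · intro v hv
    exact (Finset.mem_filter.1 hv).2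
  · intro u hu w hw hne
    obtain ⟨hu, huH⟩ := Finset.mem_filter.1 hu
    obtain ⟨hw, hwH⟩ := Finset.mem_filter.1 hw
    exact hfam.adj u hu w hw (SimpleGraph.ConnectedComponent.exact (Eq.trans huH (Eq.symm hwH))) hne
  · intro D
    obtain ⟨⟨d, hdH, hdK⟩, rfl⟩ := D.exists_rep
    have hd : d ∉ separatorUnion U := fun h =>
      hdK (Finset.mem_coe.2 (Finset.mem_filter.2 ⟨h, hdH⟩))
    have hsize := ncard_supp U H hdH
    have hbig : ¬ IsBig U (separatorUnion U) d := not_isBig_iterate hU d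
    have hle : 2 * componentSize (avoid U (separatorUnion U)) d ≤ componentSize U d := by
      by_contra hlt
      exact hbig ⟨hd, by omega, by omega⟩
    rw [hsize]
    refine le_trans (Nat.mul_le_mul_left 2 ?_) hle
    let f : U.induce (H.supp \ (((separatorUnion U).filter (· ∈ H.supp) : Finset V) : Set V)) →g
        avoid U (separatorUnion U) :=
      ⟨Subtype.val, by
        rintro ⟨a, haH, haK⟩ ⟨b, hbH, hbK⟩ hab
        refine ⟨hab, fun h => haK ?_, fun h => hbK ?_⟩
        · exact Finset.mem_coe.2 (Finset.mem_filter.2 ⟨h, haH⟩)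
        · exact Finset.mem_coe.2 (Finset.mem_filter.2 ⟨h, hbH⟩)⟩
    refine Set.ncard_le_ncard_of_injOn Subtype.val (fun x hx => ?_) Subtype.val_injective.injOn
      (Set.toFinite _)
    exact ((SimpleGraph.ConnectedComponent.exact hx).map f).symm
  · constructor
    · intro hv
      refine ⟨U.connectedComponentMk v, ?_, by simp [hv]⟩
      rw [ncard_supp U _ (v := v) rfl]
      exact hfam.two_le v hv
    · rintro ⟨H, -, hv⟩
      exact (Finset.mem_filter.1 hv).1

end Separators

/-! ### Balanced labellings -/

section Labels

/-- The label of the number `i` in position `x`: the sum of its digits `0, …, x` in base `a`,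
modulo `a`. -/
def digitLabel (a : ℕ) : ℕ → ℕ → ℕ
  | 0, i => i % a
  | x + 1, i => (digitLabel a x (i / a) + i % a) % a

theorem digitLabel_lt {a : ℕ} (ha : 0 < a) (x i : ℕ) : digitLabel a x i < a := by
  cases x <;> exact Nat.mod_lt _ ha

theorem eq_of_add_mod_eq {a p i j : ℕ} (hi : i < a) (hj : j < a) (h : (p + i) % a = (p + j) % a) :
    i = j := by
  have : i ≡ j [MOD a] := Nat.ModEq.add_left_cancel' p h
  rwa [Nat.ModEq, Nat.mod_eq_of_lt hi, Nat.mod_eq_of_lt hj] at this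

theorem eq_of_digitLabel_eq {a : ℕ} (ha : 0 < a) {l i j : ℕ} (hi : i < a ^ l) (hj : j < a ^ l)
    (h : ∀ x < l, digitLabel a x i = digitLabel a x j) : i = j := by
  induction l generalizing i j with
  | zero => simp at hi hj; omega
  | succ l ih =>
    have h0 : i % a = j % a := h 0 (Nat.succ_pos l)
    have hdiv : i / a = j / a := by
      refine ih ?_ ?_ fun x hx => ?_
      · rw [Nat.div_lt_iff_lt_mul ha, ← pow_succ]; exact hi
      · rw [Nat.div_lt_iff_lt_mul ha, ← pow_succ]; exact hj
      · have := h (x + 1) (Nat.succ_lt_succ hx)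
        simp only [digitLabel, h0, Nat.add_comm _ (j % a)] at this
        exact eq_of_add_mod_eq (digitLabel_lt ha _ _) (digitLabel_lt ha _ _) this
    rw [← Nat.div_add_mod i a, ← Nat.div_add_mod j a, hdiv, h0]

/-- Among `a` numbers with the same quotient by `a`, every letter is used once in each position. -/
theorem mod_eq_of_digitLabel_eq {a : ℕ} (ha : 0 < a) {x i j : ℕ} (hdiv : i / a = j / a)
    (h : digitLabel a x i = digitLabel a x j) : i = j := by
  have : i % a = j % a := by
    cases x with
    | zero => exact h
    | succ x =>
      simp only [digitLabel, hdiv] at h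
      exact eq_of_add_mod_eq (Nat.mod_lt _ ha) (Nat.mod_lt _ ha) h
  rw [← Nat.div_add_mod i a, ← Nat.div_add_mod j a, hdiv, this]

theorem ceil_div_le_iff {m k j : ℕ} (hk : 0 < k) : ⌈(m : ℚ) / (k : ℚ)⌉₊ ≤ j ↔ m ≤ j * k := by
  rw [Nat.ceil_le, div_le_iff₀ (by exact_mod_cast hk)]
  exact_mod_cast Iff.rfl

theorem alphabetSize_eq {k m : ℕ} (hm : 0 < m) :
    alphabetSize k m = if m ≤ 2 * k then 2 else ⌈(m : ℚ) / (k : ℚ)⌉₊ := by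
  have hm' : (0 : ℚ) < m := by exact_mod_cast hm
  unfold alphabetSize
  split_ifs with h
  · have h' : (m : ℚ) ≤ 2 * k := by exact_mod_cast h
    rw [min_eq_right (by linarith)]
    have : (m : ℚ) / (m / 2) = (2 : ℕ) := by field_simp; norm_num
    rw [this, Nat.ceil_natCast]
  · have h' : (2 * k : ℚ) < m := by exact_mod_cast not_le.1 h
    rw [min_eq_left (by linarith)]

theorem le_alphabetSize_mul {k m : ℕ} (hk : 0 < k) (hm : 0 < m) : m ≤ alphabetSize k m * k := by
  rw [alphabetSize_eq hm]
  split_ifs with h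
  · exact h
  · exact (ceil_div_le_iff hk).1 le_rfl

theorem two_le_alphabetSize {k m : ℕ} (hk : 0 < k) (hm : 0 < m) : 2 ≤ alphabetSize k m := by
  rw [alphabetSize_eq hm]
  split_ifs with h
  · exact le_rfl
  · by_contra hlt
    have := (ceil_div_le_iff (m := m) hk).1 (show _ ≤ 1 by omega)
    omega

theorem alphabetSize_le {k m r : ℕ} (hk : 0 < k) (hm : 0 < m) (hr : 2 ≤ r) (h : m ≤ r * k) :
    alphabetSize k m ≤ r := by
  rw [alphabetSize_eq hm]
  split_ifs
  · exact hr
  · exact (ceil_div_le_iff hk).2 h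

theorem clog_alphabetSize_le {k m : ℕ} (hk : 0 < k) (hm : 0 < m) :
    Nat.clog (alphabetSize k m) m ≤ Nat.clog 2 k + 1 := by
  refine Nat.clog_le_of_le_pow ((le_alphabetSize_mul hk hm).trans ?_)
  rw [pow_succ, mul_comm]
  refine Nat.mul_le_mul_right _ ((Nat.le_pow_clog one_lt_two k).trans ?_)
  exact Nat.pow_le_pow_left (two_le_alphabetSize hk hm) _

variable {V : Type*} [LinearOrder V]

/-- The number of elements of `Q` below `v`. -/
def rankIn (Q : Finset V) (v : V) : ℕ := (Q.filter (· < v)).card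

theorem rankIn_lt {Q : Finset V} {v : V} (hv : v ∈ Q) : rankIn Q v < Q.card := by
  refine Finset.card_lt_card ⟨Finset.filter_subset _ _, fun h => ?_⟩
  exact lt_irrefl v (Finset.mem_filter.1 (h hv)).2

theorem rankIn_injOn (Q : Finset V) : Set.InjOn (rankIn Q) (Q : Set V) := by
  have key : ∀ u ∈ Q, ∀ v, u < v → rankIn Q u < rankIn Q v := by
    intro u hu v huv
    refine Finset.card_lt_card ⟨fun w hw => ?_, fun h => ?_⟩
    · obtain ⟨hwQ, hwu⟩ := Finset.mem_filter.1 hw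
      exact Finset.mem_filter.2 ⟨hwQ, hwu.trans huv⟩
    · exact lt_irrefl u (Finset.mem_filter.1 (h (Finset.mem_filter.2 ⟨hu, huv⟩))).2
  intro u hu v hv h
  by_contra hne
  rcases lt_or_gt_of_ne hne with hlt | hlt
  · have := key u hu v hlt; omega
  · have := key v hv u hlt; omega

/-- Labelling the vertices of `Q` by their ranks is balanced: the vertices that use a given letter
in a given position are determined by the quotients of their ranks by `a`. -/
theorem isLabelling_digitLabel {Q : Finset V} {a l : ℕ} (ha : 0 < a) (hl : Q.card ≤ a ^ l) :
    IsLabelling Q (fun v (x : Fin l) => (⟨digitLabel a x (rankIn Q v), digitLabel_lt ha _ _⟩ :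
      Fin a)) where
  distinct := by
    intro u hu v hv h
    refine rankIn_injOn Q hu hv (eq_of_digitLabel_eq ha ((rankIn_lt hu).trans_le hl)
      ((rankIn_lt hv).trans_le hl) fun x hx => ?_)
    exact congrArg Fin.val (congrFun h ⟨x, hx⟩)
  balanced := by
    intro x y
    refine (Finset.card_le_card_of_injOn (t := Finset.range ⌈(Q.card : ℚ) / (a : ℚ)⌉₊)
      (fun v => rankIn Q v / a) ?_ ?_).trans_eq (Finset.card_range _)
    · intro v hv
      have hv' := rankIn_lt (Finset.mem_filter.1 hv).1
      simp only [Finset.coe_range, Set.mem_Iio]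
      rw [Nat.div_lt_iff_lt_mul ha]
      exact hv'.trans_le ((ceil_div_le_iff ha).1 le_rfl)
    · intro u hu v hv h
      obtain ⟨huQ, hu⟩ := Finset.mem_filter.1 hu
      obtain ⟨hvQ, hv⟩ := Finset.mem_filter.1 hv
      refine rankIn_injOn Q huQ hvQ (mod_eq_of_digitLabel_eq ha h (x := x) ?_)
      exact congrArg Fin.val (hu.trans hv.symm)

end Labels

/-! ### Runs of the search -/

section Runs

variable {V : Type*}

theorem interventions_append (Cs : List (Finset (Finset V))) (C : Finset (Finset V)) :
    interventions (Cs ++ [C]) = interventions Cs ∪ {S | S ∈ C} := by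
  ext S
  simp [interventions, or_and_right, exists_or]

/-- The empty clique is no separator of a largest component. -/
theorem IsSeparatorUnion.card_pos [Finite V] {E : Digraph V} {Q : Finset V}
    (hQ : IsSeparatorUnion (undirectedPart E) Q) (hE : ¬ FullyOriented E) : 0 < Q.card := by
  rw [Finset.card_pos, Finset.nonempty_iff_ne_empty]
  rintro rfl
  simp only [FullyOriented, not_forall, not_not] at hE
  obtain ⟨u, v, huv⟩ := hE
  -- a largest component would be at most half as large as another component
  have : Nonempty V := ⟨u⟩
  obtain ⟨H, hmax⟩ := Finite.exists_max fun H : (undirectedPart E).ConnectedComponent =>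
    H.supp.ncard
  have hH : 2 ≤ H.supp.ncard := by
    refine le_trans ?_ (hmax ((undirectedPart E).connectedComponentMk u))
    refine (Set.one_lt_ncard_iff (Set.toFinite _)).2 ⟨u, v, rfl, ?_, huv.ne⟩
    exact SimpleGraph.ConnectedComponent.sound huv.symm.reachable
  obtain ⟨H', hH'⟩ := exists_twice_le le_rfl hQ (by simp) hH
  have := hmax H'
  omega

variable [DecidableEq V] {I : Set (Finset V)} {G : DAG V} {k : ℕ}

/-- The interventions of an iteration separate every vertex of the separators from every other
vertex. -/
theorem IsBatch.exists_separated {E : Digraph V} {C : Finset (Finset V)} (hk : 1 < k)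
    (hC : IsBatch k E C) : ∃ Q, IsSeparatorUnion (undirectedPart E) Q ∧
      ∀ u ∈ Q, ∀ v, u ≠ v → ∃ S ∈ C, ¬ (u ∈ S ↔ v ∈ S) := by
  obtain ⟨Q, hQ, hC⟩ := hC
  refine ⟨Q, hQ, fun u hu v huv => ?_⟩
  split_ifs at hC with h
  · refine ⟨{u}, hC ▸ Finset.mem_image_of_mem _ hu, ?_⟩
    simpa using huv.symm
  · obtain ⟨lab, hlab, rfl⟩ := hC
    have hpos : 0 < Q.card := Finset.card_pos.2 ⟨u, hu⟩
    have mem : ∀ x, (Q.filter fun w => lab w x = lab u x) ∈ Finset.univ.image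
        fun p : Fin (Nat.clog (alphabetSize k Q.card) Q.card) × Fin (alphabetSize k Q.card) =>
          Q.filter fun v => lab v p.1 = p.2 := fun x =>
      Finset.mem_image.2 ⟨(x, lab u x), Finset.mem_univ _, rfl⟩
    by_cases hv : v ∈ Q
    · have hne : lab u ≠ lab v := fun h => huv (hlab.distinct hu hv h)
      obtain ⟨x, hx⟩ := Function.ne_iff.1 hne
      refine ⟨_, mem x, ?_⟩
      simp [hu, hv, hx.symm]
    · have hl : 0 < Nat.clog (alphabetSize k Q.card) Q.card :=
        Nat.clog_pos (two_le_alphabetSize (by omega) hpos) (by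
          have := fun h1 => h (Or.inr h1)
          omega)
      refine ⟨_, mem ⟨0, hl⟩, ?_⟩
      simp [hu, hv]

theorem SearchRun.exists_of_mem {Cs : List (Finset (Finset V))} (h : SearchRun k G Cs)
    {C : Finset (Finset V)} (hC : C ∈ Cs) : ∃ I : Set (Finset V),
      ¬ FullyOriented (essentialGraph I G) ∧ IsBatch k (essentialGraph I G) C := by
  induction h with
  | start => simp at hC
  | iterate Cs C' run unfinished batch ih =>
    rcases List.mem_append.1 hC with hC | hC
    · exact ih hC
    · rw [List.mem_singleton] at hC
      subst hC
      exact ⟨_, unfinished, batch⟩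

variable [Fintype V]

/-- The number of interventions in an iteration with separators of total size `m` is bounded by
`12 / log 2 · log k · ν` when `m ≤ 3 k ν`: there are at most `4 ν` letters and at most
`2 + log₂ k` positions. -/
theorem clog_mul_alphabetSize_le {k m ν : ℕ} (hk : 1 < k) (hm : 0 < m) (h : m ≤ 3 * (k * ν)) :
    ((Nat.clog (alphabetSize k m) m * alphabetSize k m : ℕ) : ℝ) ≤
      12 / Real.log 2 * (Real.log k * ν) := by
  have hν : 1 ≤ ν := by
    rcases Nat.eq_zero_or_pos ν with rfl | h'
    · simp at h; omega
    · exact h'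
  have ha : alphabetSize k m ≤ 4 * ν := by
    refine alphabetSize_le (by omega) hm (by omega) (h.trans ?_)
    calc 3 * (k * ν) ≤ 4 * (k * ν) := by omega
      _ = 4 * ν * k := by ring
  have hl := clog_alphabetSize_le (k := k) (by omega) hm
  have h2 : 0 < Real.log 2 := Real.log_pos one_lt_two
  have hk2 : Real.log 2 ≤ Real.log k := Real.log_le_log two_pos (by exact_mod_cast hk)
  have hclog : (Nat.clog 2 k : ℝ) * Real.log 2 ≤ Real.log k + Real.log 2 := by
    have hlt := Nat.pow_pred_clog_lt_self one_lt_two hk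
    have hle : Nat.clog 2 k ≤ (Nat.clog 2 k).pred + 1 := by simp only [Nat.pred_eq_sub_one]; omega
    have hle' : (Nat.clog 2 k : ℝ) ≤ ((Nat.clog 2 k).pred : ℝ) + 1 := by exact_mod_cast hle
    have : ((Nat.clog 2 k).pred : ℝ) * Real.log 2 ≤ Real.log k := by
      rw [← Real.log_pow]
      exact Real.log_le_log (by positivity) (by exact_mod_cast hlt.le)
    nlinarith
  have hl' : (Nat.clog (alphabetSize k m) m : ℝ) * Real.log 2 ≤ 3 * Real.log k := by
    have : (Nat.clog (alphabetSize k m) m : ℝ) ≤ Nat.clog 2 k + 1 := by exact_mod_cast hl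
    nlinarith
  have ha' : (alphabetSize k m : ℝ) ≤ 4 * ν := by exact_mod_cast ha
  have hlog : (Nat.clog (alphabetSize k m) m : ℝ) ≤ 3 * Real.log k / Real.log 2 :=
    (le_div_iff₀ h2).2 hl'
  push_cast
  calc (Nat.clog (alphabetSize k m) m : ℝ) * alphabetSize k m
      ≤ 3 * Real.log k / Real.log 2 * (4 * ν) :=
        mul_le_mul hlog ha' (by positivity) (by positivity)
    _ = 12 / Real.log 2 * (Real.log k * ν) := by ring

/-- An iteration with the single intervention of a single vertex stays within the bound. -/
theorem one_le_bound {k ν : ℕ} (hk : 1 < k) (hν : 1 ≤ ν) :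
    (1 : ℝ) ≤ 12 / Real.log 2 * (Real.log k * ν) := by
  have h2 : 0 < Real.log 2 := Real.log_pos one_lt_two
  have hk2 : Real.log 2 ≤ Real.log k := Real.log_le_log two_pos (by exact_mod_cast hk)
  have hν' : (1 : ℝ) ≤ ν := by exact_mod_cast hν
  rw [div_mul_eq_mul_div, le_div_iff₀ h2]
  nlinarith

theorem IsBatch.card_mem_le {E : Digraph V} {C : Finset (Finset V)} (hk : 1 < k)
    (hE : ¬ FullyOriented E) (hC : IsBatch k E C) : ∀ S ∈ C, S.card ≤ k := by
  obtain ⟨Q, hQ, hC⟩ := hC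
  have hpos := hQ.card_pos hE
  intro S hS
  split_ifs at hC with h
  · rw [hC] at hS
    obtain ⟨v, -, rfl⟩ := Finset.mem_image.1 hS
    rw [Finset.card_singleton]
    exact hk.le
  · obtain ⟨lab, hlab, rfl⟩ := hC
    obtain ⟨p, -, rfl⟩ := Finset.mem_image.1 hS
    refine (hlab.balanced p.1 p.2).trans ?_
    rw [ceil_div_le_iff (by have := two_le_alphabetSize (k := k) (by omega) hpos; omega), mul_comm]
    exact le_alphabetSize_mul (by omega) hpos

theorem IsBatch.card_le {C : Finset (Finset V)} (hk : 1 < k)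
    (hE : ¬ FullyOriented (essentialGraph I G)) (hC : IsBatch k (essentialGraph I G) C) :
    (C.card : ℝ) ≤ 12 / Real.log 2 * (Real.log k * verificationNumber k G) := by
  obtain ⟨Q, hQ, hC⟩ := hC
  have hpos := hQ.card_pos hE
  have hle := card_separatorUnion_le (by omega) hQ (k := k)
  split_ifs at hC with h
  · have hQ1 : Q.card = 1 := h.resolve_left (by omega)
    rw [hC]
    have h1 : (Q.image fun v => ({v} : Finset V)).card ≤ 1 := Finset.card_image_le.trans hQ1.le
    refine le_trans (by exact_mod_cast h1) (one_le_bound hk ?_)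
    rcases Nat.eq_zero_or_pos (verificationNumber k G) with h0 | h0
    · rw [h0] at hle; omega
    · exact h0
  · obtain ⟨lab, -, rfl⟩ := hC
    refine le_trans ?_ (clog_mul_alphabetSize_le hk hpos hle)
    have := Finset.card_image_le (s := Finset.univ)
      (f := fun p : Fin (Nat.clog (alphabetSize k Q.card) Q.card) × Fin (alphabetSize k Q.card) =>
        Q.filter fun v => lab v p.1 = p.2)
    rw [Finset.card_univ, Fintype.card_prod, Fintype.card_fin, Fintype.card_fin] at this
    exact_mod_cast this

/-- After `i` iterations, components with an edge have at most `n / 2 ^ i` vertices. -/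
theorem SearchRun.two_pow_mul_le (hk : 1 < k) {Cs : List (Finset (Finset V))}
    (h : SearchRun k G Cs)
    (H : (undirectedPart (essentialGraph (interventions Cs) G)).ConnectedComponent)
    (hH : 2 ≤ H.supp.ncard) : 2 ^ Cs.length * H.supp.ncard ≤ Fintype.card V := by
  induction h with
  | start =>
    rw [List.length_nil, pow_zero, one_mul]
    exact (Set.ncard_le_ncard (Set.subset_univ _)).trans_eq
      ((Set.ncard_univ V).trans Nat.card_eq_fintype_card)
  | iterate Cs C _ _ batch ih =>
    obtain ⟨Q, hQ, hsep⟩ := batch.exists_separated hk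
    have hle : undirectedPart (essentialGraph (interventions (Cs ++ [C])) G) ≤
        undirectedPart (essentialGraph (interventions Cs) G) := by
      refine undirectedPart_anti ?_
      rw [interventions_append]
      exact Set.subset_union_left
    obtain ⟨H₀, hH₀⟩ := exists_twice_le hle hQ (fun u hu v huv => by
      obtain ⟨S, hS, hsep⟩ := hsep u hu v huv.ne
      refine not_adj_of_separated ?_ hsep huv
      rw [interventions_append]
      exact Or.inr hS) hH
    have := ih H₀ (by omega)
    rw [List.length_append, List.length_singleton, pow_succ, mul_assoc]
    exact (Nat.mul_le_mul_left _ hH₀).trans this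

/-- The last iteration started with a component that had an edge, hence at least two vertices. -/
theorem SearchRun.two_pow_length_le (hk : 1 < k) {Cs : List (Finset (Finset V))}
    (h : SearchRun k G Cs) (hne : Cs ≠ []) : 2 ^ Cs.length ≤ Fintype.card V := by
  cases h with
  | start => exact (hne rfl).elim
  | iterate Cs C run unfinished _ =>
    simp only [FullyOriented, not_forall, not_not] at unfinished
    obtain ⟨u, v, huv⟩ := unfinished
    set U := undirectedPart (essentialGraph (interventions Cs) G)
    have hH : 2 ≤ (U.connectedComponentMk u).supp.ncard :=
      (Set.one_lt_ncard_iff (Set.toFinite _)).2 ⟨u, v, rfl,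
        SimpleGraph.ConnectedComponent.sound huv.symm.reachable, huv.ne⟩
    refine le_trans ?_ (run.two_pow_mul_le hk _ hH)
    rw [List.length_append, List.length_singleton, pow_succ]
    exact Nat.mul_le_mul_left _ hH

theorem SearchRun.length_mul_log_le (hk : 1 < k) {Cs : List (Finset (Finset V))}
    (h : SearchRun k G Cs) : (Cs.length : ℝ) * Real.log 2 ≤ Real.log (Fintype.card V) := by
  rcases eq_or_ne Cs [] with rfl | hne
  · simpa using Real.log_natCast_nonneg _
  · rw [← Real.log_pow]
    exact Real.log_le_log (by positivity) (by exact_mod_cast h.two_pow_length_le hk hne)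

/-- If each of the at most `log n / log 2` iterations costs at most `12 / log 2 · log k · ν`, the
total cost is `O(log n · log k · ν)`. -/
theorem sum_le_of_forall_le {α : Type*} {L : List α} {f : α → ℕ} {n k ν : ℕ}
    (hL : (L.length : ℝ) * Real.log 2 ≤ Real.log n)
    (hf : ∀ x ∈ L, (f x : ℝ) ≤ 12 / Real.log 2 * (Real.log k * ν)) :
    ((L.map f).sum : ℝ) ≤ 12 / Real.log 2 ^ 2 * (Real.log n * Real.log k * ν) := by
  have h2 : 0 < Real.log 2 := Real.log_pos one_lt_two
  have hsum : ((L.map f).sum : ℝ) ≤ L.length * (12 / Real.log 2 * (Real.log k * ν)) := by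
    clear hL
    induction L with
    | nil => simp
    | cons x L ih =>
      have h1 := hf x (by simp)
      have h2 := ih fun y hy => hf y (by simp [hy])
      simp only [List.map_cons, List.sum_cons, List.length_cons]
      push_cast at h2 ⊢
      linarith
  refine hsum.trans ?_
  have hb : 0 ≤ 12 / Real.log 2 * (Real.log k * ν) :=
    mul_nonneg (by positivity) (mul_nonneg (Real.log_natCast_nonneg _) (by positivity))
  calc L.length * (12 / Real.log 2 * (Real.log k * ν))
      ≤ Real.log n / Real.log 2 * (12 / Real.log 2 * (Real.log k * ν)) :=
        mul_le_mul_of_nonneg_right ((le_div_iff₀ h2).2 hL) hb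
    _ = _ := by field_simp

end Runs

/-! ### Running programs -/

section Running

variable {n : ℕ} {G : DAG (Fin n)}

/-- `P` runs from the state `s` to the state `s'` in at most `T` steps, whatever programs wait on
the stack. -/
def Runs (G : DAG (Fin n)) (P : Program) (s s' : State n) (T : ℕ) : Prop :=
  ∃ t ≤ T, ∀ L, (step G)^[t] (P :: L, s) = (L, s')

theorem Runs.mono {P : Program} {s s' : State n} {T T' : ℕ} (h : Runs G P s s' T)
    (hT : T ≤ T') : Runs G P s s' T' := by
  obtain ⟨t, ht, h⟩ := h
  exact ⟨t, ht.trans hT, h⟩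

theorem Runs.of_step {P : Program} {s s' : State n} (h : ∀ L, step G (P :: L, s) = (L, s')) :
    Runs G P s s' 1 :=
  ⟨1, le_rfl, h⟩

theorem Runs.seq {P P' : Program} {s s₁ s₂ : State n} {T T' : ℕ} (h : Runs G P s s₁ T)
    (h' : Runs G P' s₁ s₂ T') : Runs G (.seq P P') s s₂ (T + T' + 1) := by
  obtain ⟨t, ht, h⟩ := h
  obtain ⟨t', ht', h'⟩ := h'
  refine ⟨t' + t + 1, by omega, fun L => ?_⟩
  rw [Function.iterate_succ_apply, Function.iterate_add_apply]
  change (step G)^[t'] ((step G)^[t] (P :: P' :: L, s)) = _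
  rw [h, h']

theorem Runs.const (s : State n) (x c : ℕ) :
    Runs G (.const x c) s { s with reg := Function.update s.reg x c } 1 :=
  .of_step fun _ => rfl

theorem Runs.add (s : State n) (x y z : ℕ) :
    Runs G (.add x y z) s { s with reg := Function.update s.reg x (s.reg y + s.reg z) } 1 :=
  .of_step fun _ => rfl

theorem Runs.sub (s : State n) (x y z : ℕ) :
    Runs G (.sub x y z) s { s with reg := Function.update s.reg x (s.reg y - s.reg z) } 1 :=
  .of_step fun _ => rfl

theorem Runs.read (s : State n) (x A i j : ℕ) : Runs G (.read x A i j) s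
    { s with reg := Function.update s.reg x (s.arr A (s.reg i) (s.reg j)) } 1 :=
  .of_step fun _ => rfl

theorem Runs.write (s : State n) (A i j x : ℕ) : Runs G (.write A i j x) s
    { s with arr := Function.update s.arr A (Function.update (s.arr A) (s.reg i)
        (Function.update (s.arr A (s.reg i)) (s.reg j) (s.reg x))) } 1 :=
  .of_step fun _ => rfl

theorem Runs.intervene (s : State n) (A i : ℕ) : Runs G (.intervene A i) s
    (s.doIntervene G (Finset.univ.filter fun v : Fin n => s.arr A (s.reg i) v ≠ 0)) 1 :=
  .of_step fun _ => rfl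

theorem Runs.ite_pos {P P' : Program} {s s' : State n} {x T : ℕ} (hx : s.reg x ≠ 0)
    (h : Runs G P s s' T) : Runs G (.ite x P P') s s' (T + 1) := by
  obtain ⟨t, ht, h⟩ := h
  refine ⟨t + 1, by omega, fun L => ?_⟩
  rw [Function.iterate_succ_apply]
  simp only [step, if_pos hx, h]

theorem Runs.ite_neg {P P' : Program} {s s' : State n} {x T : ℕ} (hx : s.reg x = 0)
    (h : Runs G P' s s' T) : Runs G (.ite x P P') s s' (T + 1) := by
  obtain ⟨t, ht, h⟩ := h
  refine ⟨t + 1, by omega, fun L => ?_⟩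
  rw [Function.iterate_succ_apply]
  simp only [step, hx, ne_eq, not_true, if_false, h]

theorem Runs.while_zero {P : Program} {s : State n} {x : ℕ} (hx : s.reg x = 0) :
    Runs G (.while x P) s s 1 :=
  .of_step fun _ => by simp [step, hx]

theorem Runs.while_succ {P : Program} {s s₁ s₂ : State n} {x T T' : ℕ} (hx : s.reg x ≠ 0)
    (h : Runs G P s s₁ T) (h' : Runs G (.while x P) s₁ s₂ T') :
    Runs G (.while x P) s s₂ (T + T' + 1) := by
  obtain ⟨t, ht, h⟩ := h
  obtain ⟨t', ht', h'⟩ := h'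
  refine ⟨t' + t + 1, by omega, fun L => ?_⟩
  rw [Function.iterate_succ_apply, Function.iterate_add_apply]
  simp only [step, if_pos hx, h, h']

/-- `x := y`, with the auxiliary register `z`. -/
def copy (x y z : ℕ) : Program := .seq (.const z 0) (.add x y z)

theorem copy_runs (s : State n) {x y z : ℕ} (hyz : y ≠ z) :
    ∃ s', Runs G (copy x y z) s s' 3 ∧ s'.arr = s.arr ∧ s'.performed = s.performed ∧
      s'.reg x = s.reg y ∧ ∀ w, w ≠ x → w ≠ z → s'.reg w = s.reg w :=
  ⟨_, (Runs.const s z 0).seq (Runs.add _ x y z), rfl, rfl, by simp [hyz],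
    fun w hwx hwz => by simp [Function.update_apply, hwx, hwz]⟩

/-- `x := x + 1` and `r := r - 1`, with the auxiliary register `z`. -/
def countStep (x r z : ℕ) : Program := .seq (.const z 1) (.seq (.add x x z) (.sub r r z))

theorem countStep_runs (s : State n) {x r z : ℕ} (hxr : x ≠ r) (hxz : x ≠ z) (hrz : r ≠ z) :
    ∃ s', Runs G (countStep x r z) s s' 5 ∧ s'.arr = s.arr ∧ s'.performed = s.performed ∧
      s'.reg x = s.reg x + 1 ∧ s'.reg r = s.reg r - 1 ∧
      ∀ w, w ≠ x → w ≠ r → w ≠ z → s'.reg w = s.reg w :=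
  ⟨_, (Runs.const s z 1).seq ((Runs.add _ x x z).seq (Runs.sub _ r r z)), rfl, rfl,
    by simp [Function.update_apply, hxr, hxz],
    by simp [Function.update_apply, hxr.symm, hxz.symm, hrz],
    fun w hwx hwr hwz => by simp [Function.update_apply, hwx, hwr, hwz]⟩

/-- Execute `P` for `x = 0, …, n - 1`, where `n` is in register `0`. Register `r` counts down, and
register `r + 1` keeps the old value of `x`. -/
def forLoop (x r : ℕ) (P : Program) : Program :=
  .seq (copy (r + 1) x (r + 2)) <| .seq (.const x 0) <| .seq (copy r 0 (r + 2)) <|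
  .seq (.while r (.seq P (countStep x r (r + 2)))) (copy x (r + 1) (r + 2))

/-- The loop rule. The invariant `Inv i`, which holds before the `i`-th execution of the body, may
speak about the memory and the registers below `r` other than `x`. -/
theorem forLoop_runs {P : Program} {x r T : ℕ} (hx0 : x ≠ 0) (hxr : x < r)
    {Inv : ℕ → State n → Prop}
    (hInv : ∀ i s s', Inv i s → s'.arr = s.arr → s'.performed = s.performed →
      (∀ y < r, y ≠ x → s'.reg y = s.reg y) → Inv i s')
    (hP : ∀ i < n, ∀ s, Inv i s → s.reg x = i → ∃ s', Runs G P s s' T ∧ Inv (i + 1) s' ∧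
      s'.reg x = i ∧ s'.reg r = s.reg r ∧ s'.reg (r + 1) = s.reg (r + 1))
    {s : State n} (h0 : Inv 0 s) (hn : s.reg 0 = n) :
    ∃ s', Runs G (forLoop x r P) s s' (n * (T + 7) + 15) ∧ Inv n s' ∧ s'.reg x = s.reg x := by
  have hloop : ∀ j i s, i + j = n → Inv i s → s.reg x = i → s.reg r = j →
      ∃ s', Runs G (.while r (.seq P (countStep x r (r + 2)))) s s' (j * (T + 7) + 1) ∧
        Inv n s' ∧ s'.reg (r + 1) = s.reg (r + 1) := by
    intro j
    induction j with
    | zero =>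
      intro i s hij hI hx hr
      refine ⟨s, (Runs.while_zero hr).mono (by omega), ?_, rfl⟩
      rwa [show n = i by omega]
    | succ j ih =>
      intro i s hij hI hx hr
      obtain ⟨s₁, h₁, hI₁, hx₁, hr₁, hs₁⟩ := hP i (by omega) s hI hx
      obtain ⟨s₂, h₂, ha₂, hp₂, hx₂, hr₂, hs₂⟩ := countStep_runs (G := G) s₁ (x := x) (r := r)
        (z := r + 2) (by omega) (by omega) (by omega)
      obtain ⟨s', h', hI', hs'⟩ := ih (i + 1) s₂ (by omega)
        (hInv _ _ _ hI₁ ha₂ hp₂ fun y hy hyx => hs₂ y hyx (by omega) (by omega))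
        (by omega) (by omega)
      refine ⟨s', (Runs.while_succ (by omega) (h₁.seq h₂) h').mono ?_, hI', ?_⟩
      · rw [Nat.succ_mul]; omega
      · rw [hs', hs₂ _ (by omega) (by omega) (by omega), hs₁]
  obtain ⟨s₁, h₁, ha₁, hp₁, hx₁, hs₁⟩ := copy_runs (G := G) s (x := r + 1) (y := x) (z := r + 2)
    (by omega)
  have hs₂ : ∀ y, y ≠ x → Function.update s₁.reg x 0 y = s₁.reg y := fun y hy =>
    Function.update_of_ne hy _ _
  obtain ⟨s₃, h₃, ha₃, hp₃, hx₃, hs₃⟩ := copy_runs (G := G)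
    { s₁ with reg := Function.update s₁.reg x 0 } (x := r) (y := 0) (z := r + 2) (by omega)
  simp only at ha₃ hp₃ hx₃ hs₃
  obtain ⟨s₄, h₄, hI₄, hr₄⟩ := hloop n 0 s₃ (by omega)
    (hInv 0 s s₃ h0 (ha₃.trans ha₁) (hp₃.trans hp₁) fun y hy hyx => by
      rw [hs₃ y (by omega) (by omega), hs₂ y hyx, hs₁ y (by omega) (by omega)])
    (by rw [hs₃ x (by omega) (by omega), Function.update_self])
    (by rw [hx₃, hs₂ 0 hx0.symm, hs₁ 0 (by omega) (by omega), hn])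
  obtain ⟨s₅, h₅, ha₅, hp₅, hx₅, hs₅⟩ := copy_runs (G := G) s₄ (x := x) (y := r + 1) (z := r + 2)
    (by omega)
  refine ⟨s₅, (h₁.seq ((Runs.const _ _ _).seq (h₃.seq (h₄.seq h₅)))).mono (by omega),
    hInv n s₄ s₅ hI₄ ha₅ hp₅ fun y hy hyx => hs₅ y hyx (by omega), ?_⟩
  rw [hx₅, hr₄, hs₃ _ (by omega) (by omega), hs₂ _ (by omega), hx₁]

end Running

/-! ### A language of bounded loops and its compilation -/

section Language

/-- Terms for natural numbers: variables, the input `k`, constants, sums, truncated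
differences, array entries, case distinctions by whether a term is nonzero, and sums over
`x < n`. There are eight variables. -/
inductive Term
  | var (x : Fin 8)
  | bound
  | const (c : ℕ)
  | add (t u : Term)
  | sub (t u : Term)
  | read (A : ℕ) (t u : Term)
  | cond (c t u : Term)
  | sum (x : Fin 8) (t : Term)

/-- The value of a term, for arrays `a` and values `e` of the variables. -/
def Term.eval (n k : ℕ) (a : ℕ → ℕ → ℕ → ℕ) : Term → (Fin 8 → ℕ) → ℕ
  | .var x, e => e x
  | .bound, _ => k
  | .const c, _ => c
  | .add t u, e => t.eval n k a e + u.eval n k a e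
  | .sub t u, e => t.eval n k a e - u.eval n k a e
  | .read A t u, e => a A (t.eval n k a e) (u.eval n k a e)
  | .cond c t u, e => if c.eval n k a e ≠ 0 then t.eval n k a e else u.eval n k a e
  | .sum x t, e => ∑ i ∈ Finset.range n, t.eval n k a (Function.update e x i)

/-- The program that computes a term into register `d`, without changing the registers below `d`.
Variable `x` lives in register `x + 2`, and array `A` in array `2 A`. -/
def Term.compile : Term → ℕ → Program
  | .var x, d => copy d (x + 2) (d + 1)
  | .bound, d => copy d 1 (d + 1)
  | .const c, d => .const d c
  | .add t u, d => .seq (t.compile d) (.seq (u.compile (d + 1)) (.add d d (d + 1)))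
  | .sub t u, d => .seq (t.compile d) (.seq (u.compile (d + 1)) (.sub d d (d + 1)))
  | .read A t u, d => .seq (t.compile d) (.seq (u.compile (d + 1)) (.read d (2 * A) d (d + 1)))
  | .cond c t u, d => .seq (c.compile d) (.ite d (t.compile d) (u.compile d))
  | .sum x t, d => .seq (.const d 0)
      (forLoop (x + 2) (d + 1) (.seq (t.compile (d + 4)) (.add d d (d + 4))))

/-- A bound on the number of steps of a compiled term, as a polynomial in `n`. -/
noncomputable def Term.cost : Term → Polynomial ℕ
  | .var _ => 3
  | .bound => 3
  | .const _ => 1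
  | .add t u => t.cost + u.cost + 3
  | .sub t u => t.cost + u.cost + 3
  | .read _ t u => t.cost + u.cost + 3
  | .cond c t u => c.cost + t.cost + u.cost + 2
  | .sum _ t => Polynomial.X * (t.cost + 9) + 17

variable {n : ℕ}

/-- The registers and arrays of the state `s` hold the inputs `n` and `k`, the values `e` of the
variables, and the arrays `a`. -/
structure Represents (s : State n) (k : ℕ) (e : Fin 8 → ℕ) (a : ℕ → ℕ → ℕ → ℕ) : Prop where
  size : s.reg 0 = n
  bound : s.reg 1 = k
  var : ∀ x : Fin 8, s.reg (x + 2) = e x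
  arr : ∀ A, s.arr (2 * A) = a A

theorem Represents.congr {s s' : State n} {k : ℕ} {e : Fin 8 → ℕ} {a : ℕ → ℕ → ℕ → ℕ}
    (h : Represents s k e a) (harr : s'.arr = s.arr) (hreg : ∀ y < 10, s'.reg y = s.reg y) :
    Represents s' k e a where
  size := (hreg 0 (by omega)).trans h.size
  bound := (hreg 1 (by omega)).trans h.bound
  var x := (hreg _ (by omega)).trans (h.var x)
  arr A := by rw [harr, h.arr A]

theorem Represents.update {s s' : State n} {k : ℕ} {e : Fin 8 → ℕ} {a a' : ℕ → ℕ → ℕ → ℕ}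
    (h : Represents s k e a) (harr : ∀ A, s'.arr (2 * A) = a' A) {x : Fin 8} {i : ℕ}
    (hx : s'.reg (x + 2) = i) (hreg : ∀ y : ℕ, y < 10 → y ≠ (x : ℕ) + 2 → s'.reg y = s.reg y) :
    Represents s' k (Function.update e x i) a' where
  size := (hreg 0 (by omega) (by omega)).trans h.size
  bound := (hreg 1 (by omega) (by omega)).trans h.bound
  var z := by
    by_cases hz : z = x
    · rw [hz, hx, Function.update_self]
    · rw [Function.update_of_ne hz, hreg _ (by omega) (by
        intro h; exact hz (Fin.ext (by omega))), h.var z]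
  arr := harr

/-- Compiled terms are evaluated correctly, within the stated number of steps. -/
theorem Term.runs (G : DAG (Fin n)) {k : ℕ} {a : ℕ → ℕ → ℕ → ℕ} (t : Term) {d : ℕ} (hd : 10 ≤ d)
    {s : State n} {e : Fin 8 → ℕ} (h : Represents s k e a) :
    ∃ s', Runs G (t.compile d) s s' (t.cost.eval n) ∧ s'.arr = s.arr ∧
      s'.performed = s.performed ∧ s'.reg d = t.eval n k a e ∧ ∀ y < d, s'.reg y = s.reg y := by
  have hcopy : ∀ {d : ℕ}, 10 ≤ d → ∀ (s : State n) (y v : ℕ), y < 10 → s.reg y = v →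
      ∃ s', Runs G (copy d y (d + 1)) s s' 3 ∧ s'.arr = s.arr ∧
      s'.performed = s.performed ∧ s'.reg d = v ∧ ∀ y < d, s'.reg y = s.reg y := by
    intro d hd s y v hy hv
    obtain ⟨s', h1, h2, h3, h4, h5⟩ := copy_runs (G := G) s (x := d) (y := y) (z := d + 1)
      (by omega)
    exact ⟨s', h1, h2, h3, h4.trans hv, fun w hw => h5 w (by omega) (by omega)⟩
  -- evaluation of two terms into the registers `d` and `d + 1`
  have hpair : ∀ {t u : Term} {d : ℕ}, 10 ≤ d → ∀ {s : State n} {e : Fin 8 → ℕ},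
      (∀ {d : ℕ}, 10 ≤ d → ∀ {s : State n} {e : Fin 8 → ℕ}, Represents s k e a →
        ∃ s', Runs G (t.compile d) s s' (t.cost.eval n) ∧ s'.arr = s.arr ∧
        s'.performed = s.performed ∧ s'.reg d = t.eval n k a e ∧ ∀ y < d, s'.reg y = s.reg y) →
      (∀ {d : ℕ}, 10 ≤ d → ∀ {s : State n} {e : Fin 8 → ℕ}, Represents s k e a →
        ∃ s', Runs G (u.compile d) s s' (u.cost.eval n) ∧ s'.arr = s.arr ∧
        s'.performed = s.performed ∧ s'.reg d = u.eval n k a e ∧ ∀ y < d, s'.reg y = s.reg y) →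
      Represents s k e a → ∀ {P : Program} {f : State n → ℕ},
      (∀ s : State n, Runs G P s { s with reg := Function.update s.reg d (f s) } 1) →
      ∃ s' s₁, Runs G (.seq (t.compile d) (.seq (u.compile (d + 1)) P)) s s'
        ((t.cost + u.cost + 3).eval n) ∧ s'.arr = s.arr ∧ s'.performed = s.performed ∧
        s'.reg d = f s₁ ∧ (∀ y < d, s'.reg y = s.reg y) ∧ s₁.reg d = t.eval n k a e ∧
        s₁.reg (d + 1) = u.eval n k a e ∧ s₁.arr = s.arr := by
    intro t u d hd s e iht ihu h P f hP
    obtain ⟨s₁, h1, ha1, hp1, hv1, hr1⟩ := iht hd h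
    obtain ⟨s₂, h2, ha2, hp2, hv2, hr2⟩ := ihu (show 10 ≤ d + 1 by omega)
      (h.congr ha1 fun y hy => hr1 y (by omega))
    refine ⟨_, s₂, (h1.seq (h2.seq (hP s₂))).mono ?_, ha2.trans ha1, hp2.trans hp1,
      Function.update_self .., fun y hy => ?_, ?_, hv2, ha2.trans ha1⟩
    · simp only [Polynomial.eval_add, Polynomial.eval_ofNat]; omega
    · exact (Function.update_of_ne (by omega) _ _).trans ((hr2 y (by omega)).trans (hr1 y hy))
    · rw [hr2 d (by omega), hv1]
  induction t generalizing d s e with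
  | var x =>
    obtain ⟨s', h'⟩ := hcopy hd s (x + 2) (e x) (by omega) (h.var x)
    exact ⟨s', by simpa [Term.compile, Term.cost, Term.eval] using h'⟩
  | bound =>
    obtain ⟨s', h'⟩ := hcopy hd s 1 k (by omega) h.bound
    exact ⟨s', by simpa [Term.compile, Term.cost, Term.eval] using h'⟩
  | const c =>
    refine ⟨_, (Runs.const s d c).mono ?_, rfl, rfl, Function.update_self .., fun y hy => ?_⟩
    · simp [Term.cost]
    · exact Function.update_of_ne (by omega) _ _
  | add t u iht ihu =>
    obtain ⟨s', s₁, h1, h2, h3, h4, h5, h6, h7, -⟩ := hpair hd iht ihu h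
      (P := .add d d (d + 1)) (f := fun s => s.reg d + s.reg (d + 1)) fun s => Runs.add s _ _ _
    exact ⟨s', h1, h2, h3, by rw [h4, h6, h7]; rfl, h5⟩
  | sub t u iht ihu =>
    obtain ⟨s', s₁, h1, h2, h3, h4, h5, h6, h7, -⟩ := hpair hd iht ihu h
      (P := .sub d d (d + 1)) (f := fun s => s.reg d - s.reg (d + 1)) fun s => Runs.sub s _ _ _
    exact ⟨s', h1, h2, h3, by rw [h4, h6, h7]; rfl, h5⟩
  | read A t u iht ihu =>
    obtain ⟨s', s₁, h1, h2, h3, h4, h5, h6, h7, h8⟩ := hpair hd iht ihu h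
      (P := .read d (2 * A) d (d + 1)) (f := fun s => s.arr (2 * A) (s.reg d) (s.reg (d + 1)))
      fun s => Runs.read s _ _ _ _
    exact ⟨s', h1, h2, h3, by rw [h4, h6, h7, h8, h.arr]; rfl, h5⟩
  | cond c t u ihc iht ihu =>
    obtain ⟨s₁, h1, ha1, hp1, hv1, hr1⟩ := ihc hd h
    have h' := h.congr ha1 fun y hy => hr1 y (by omega)
    by_cases hc : c.eval n k a e ≠ 0
    · obtain ⟨s₂, h2, ha2, hp2, hv2, hr2⟩ := iht hd h'
      refine ⟨s₂, (h1.seq (h2.ite_pos (hv1 ▸ hc))).mono ?_, ha2.trans ha1, hp2.trans hp1, ?_,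
        fun y hy => (hr2 y hy).trans (hr1 y hy)⟩
      · simp only [Term.cost, Polynomial.eval_add, Polynomial.eval_ofNat]; omega
      · rw [hv2, Term.eval, if_pos hc]
    · obtain ⟨s₂, h2, ha2, hp2, hv2, hr2⟩ := ihu hd h'
      refine ⟨s₂, (h1.seq (h2.ite_neg (hv1.trans (not_not.1 hc)))).mono ?_, ha2.trans ha1,
        hp2.trans hp1, ?_, fun y hy => (hr2 y hy).trans (hr1 y hy)⟩
      · simp only [Term.cost, Polynomial.eval_add, Polynomial.eval_ofNat]; omega
      · rw [hv2, Term.eval, if_neg hc]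
  | sum x t ih =>
    have hx : (x : ℕ) + 2 < 10 := by omega
    obtain ⟨s', h1, ⟨ha, hp, hv, hr⟩, hx'⟩ := forLoop_runs (G := G)
      (P := .seq (t.compile (d + 4)) (.add d d (d + 4))) (x := x + 2) (r := d + 1)
      (T := t.cost.eval n + 2) (by omega) (by omega)
      (Inv := fun i s' => s'.arr = s.arr ∧ s'.performed = s.performed ∧
        s'.reg d = ∑ j ∈ Finset.range i, t.eval n k a (Function.update e x j) ∧
        ∀ y < d, y ≠ (x : ℕ) + 2 → s'.reg y = s.reg y)
      (by
        rintro i s₁ s₂ ⟨ha, hp, hv, hr⟩ ha' hp' hr'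
        exact ⟨ha'.trans ha, hp'.trans hp, (hr' d (by omega) (by omega)).trans hv,
          fun y hy hyx => (hr' y (by omega) hyx).trans (hr y hy hyx)⟩)
      (by
        rintro i hi s₁ ⟨ha, hp, hv, hr⟩ hxi
        obtain ⟨s₂, h2, ha2, hp2, hv2, hr2⟩ := ih (show 10 ≤ d + 4 by omega)
          (h.update (s' := s₁) (a' := a) (fun A => by rw [ha, h.arr A]) hxi
            fun y hy hyx => hr y (by omega) hyx)
        refine ⟨_, h2.seq (Runs.add s₂ d d (d + 4)), ⟨ha2.trans ha, hp2.trans hp, ?_, ?_⟩,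
          ?_, ?_, ?_⟩
        · refine (Function.update_self ..).trans ?_
          rw [Finset.sum_range_succ, hv2, hr2 d (by omega), hv]
        · intro y hy hyx
          exact (Function.update_of_ne (by omega) _ _).trans
            ((hr2 y (by omega)).trans (hr y hy hyx))
        · exact (Function.update_of_ne (by omega) _ _).trans ((hr2 _ (by omega)).trans hxi)
        · exact (Function.update_of_ne (by omega) _ _).trans (hr2 _ (by omega))
        · exact (Function.update_of_ne (by omega) _ _).trans (hr2 _ (by omega)))
      (s := { s with reg := Function.update s.reg d 0 })
      ⟨rfl, rfl, by simp, fun y hy _ => Function.update_of_ne (by omega) _ _⟩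
      ((Function.update_of_ne (by omega) _ _).trans h.size)
    refine ⟨s', ((Runs.const s d 0).seq h1).mono ?_, ha, hp, hv, fun y hy => ?_⟩
    · simp only [Term.cost, Polynomial.eval_add, Polynomial.eval_mul, Polynomial.eval_X,
        Polynomial.eval_ofNat]
      rw [show t.cost.eval n + 2 + 7 = t.cost.eval n + 9 from rfl]
      omega
    · by_cases hyx : y = (x : ℕ) + 2
      · rw [hyx, hx']; exact Function.update_of_ne (by omega) _ _
      · exact hr y hy hyx

/-- The memory seen by commands: the arrays and the interventions performed so far. -/
structure Memory (n : ℕ) where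
  arr : ℕ → ℕ → ℕ → ℕ
  performed : List (Finset (Fin n))

/-- Commands: overwrite the `n × n` entries of an array simultaneously by a term in the variables
`0` and `1`, execute one command after another, execute a command if a term is nonzero, execute a
command for all `x < n`, and intervene on a row of an array. -/
inductive Cmd
  | fill (A : ℕ) (t : Term)
  | seq (c c' : Cmd)
  | when (t : Term) (c : Cmd)
  | loop (x : Fin 8) (c : Cmd)
  | intervene (A : ℕ) (x : Fin 8)

/-- The array `b` with its `n × n` entries overwritten by `f`. -/
def fillWith (n : ℕ) (b f : ℕ → ℕ → ℕ) (i j : ℕ) : ℕ := if i < n ∧ j < n then f i j else b i j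

/-- The effect of a command on the memory, for values `e` of the variables. -/
noncomputable def Cmd.den (G : DAG (Fin n)) (k : ℕ) : Cmd → (Fin 8 → ℕ) → Memory n → Memory n
  | .fill A t, e, m => { m with arr := Function.update m.arr A (fillWith n (m.arr A) fun i j =>
      t.eval n k m.arr (Function.update (Function.update e 0 i) 1 j)) }
  | .seq c c', e, m => c'.den G k e (c.den G k e m)
  | .when t c, e, m => if t.eval n k m.arr e ≠ 0 then c.den G k e m else m
  | .loop x c, e, m =>
      (List.range n).foldl (fun m i => c.den G k (Function.update e x i) m) m
  | .intervene A x, e, m =>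
      let S := Finset.univ.filter fun v : Fin n => m.arr A (e x) v ≠ 0
      { arr := Function.update m.arr 0 (adjMatrix (essentialGraph {T | T ∈ m.performed ++ [S]} G))
        performed := m.performed ++ [S] }

/-- The compiled command, which uses the registers from `d` on for auxiliary values. The entries of
an array to be overwritten are computed into array `1` first. -/
def Cmd.compile : Cmd → ℕ → Program
  | .fill A t, d =>
    .seq (forLoop 2 d (forLoop 3 (d + 3) (.seq (t.compile (d + 6)) (.write 1 2 3 (d + 6)))))
      (forLoop 2 d (forLoop 3 (d + 3) (.seq (.read (d + 6) 1 2 3) (.write (2 * A) 2 3 (d + 6)))))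
  | .seq c c', d => .seq (c.compile d) (c'.compile d)
  | .when t c, d => .seq (t.compile d) (.ite d (c.compile d) (.const d 0))
  | .loop x c, d => forLoop (x + 2) d (c.compile (d + 3))
  | .intervene A x, _ => .intervene (2 * A) (x + 2)

/-- A bound on the number of steps of a compiled command, as a polynomial in `n`. -/
noncomputable def Cmd.cost : Cmd → Polynomial ℕ
  | .fill _ t => Polynomial.X * (Polynomial.X * (t.cost + 9) + 22) +
      (Polynomial.X * (Polynomial.X * 10 + 22)) + 31
  | .seq c c' => c.cost + c'.cost + 1
  | .when t c => t.cost + c.cost + 3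
  | .loop _ c => Polynomial.X * (c.cost + 7) + 15
  | .intervene _ _ => 1

/-- A double loop whose body writes `f i j` into the entry `i, j` of array `B`. -/
theorem doubleLoop_runs {G : DAG (Fin n)} {P : Program} {d T B : ℕ} (hd : 10 ≤ d)
    {f : ℕ → ℕ → ℕ} {s : State n} (hn : s.reg 0 = n)
    (hP : ∀ i < n, ∀ j < n, ∀ s₁ : State n, (∀ A, A ≠ B → s₁.arr A = s.arr A) →
      s₁.performed = s.performed → s₁.reg 2 = i → s₁.reg 3 = j →
      (∀ y < 10, y ≠ 2 → y ≠ 3 → s₁.reg y = s.reg y) →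
      ∃ s₂, Runs G P s₁ s₂ T ∧ s₂.performed = s₁.performed ∧
        s₂.arr = Function.update s₁.arr B (Function.update (s₁.arr B) i
          (Function.update (s₁.arr B i) j (f i j))) ∧
        ∀ y < d + 6, s₂.reg y = s₁.reg y) :
    ∃ s', Runs G (forLoop 2 d (forLoop 3 (d + 3) P)) s s' (n * (n * (T + 7) + 22) + 15) ∧
      s'.arr = Function.update s.arr B (fillWith n (s.arr B) f) ∧
      s'.performed = s.performed ∧ ∀ y < d, s'.reg y = s.reg y := by
  -- the array after the rows before `i` and the first `j` entries of row `i` have been written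
  set part : ℕ → ℕ → ℕ → ℕ → ℕ := fun i j u v =>
    if u < n ∧ v < n ∧ (u < i ∨ (u = i ∧ v < j)) then f u v else s.arr B u v with hpart
  have hrow : ∀ i, part i n = part (i + 1) 0 := by
    intro i
    funext u v
    simp only [hpart]
    congr 1
    refine propext ⟨fun h => ⟨h.1, h.2.1, by omega⟩, fun h => ⟨h.1, h.2.1, by omega⟩⟩
  have hcell : ∀ i < n, ∀ j < n, Function.update (part i j) i
      (Function.update (part i j i) j (f i j)) = part i (j + 1) := by
    intro i hi j hj
    funext u v
    by_cases hu : u = i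
    · subst hu
      rw [Function.update_self]
      by_cases hv : v = j
      · subst hv
        rw [Function.update_self]
        simp [hpart, hi, hj]
      · rw [Function.update_of_ne hv]
        simp only [hpart, lt_irrefl, false_or, true_and]
        congr 1
        refine propext ⟨fun h => ⟨h.1, h.2.1, by omega⟩, fun h => ⟨h.1, h.2.1, by omega⟩⟩
    · rw [Function.update_of_ne hu]
      simp only [hpart]
      congr 1
      refine propext ⟨fun h => ⟨h.1, h.2.1, by omega⟩, fun h => ⟨h.1, h.2.1, by omega⟩⟩
  obtain ⟨s', h1, ⟨ha, hp, hr⟩, h2⟩ := forLoop_runs (G := G) (P := forLoop 3 (d + 3) P) (x := 2)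
    (r := d) (T := n * (T + 7) + 15) (by omega) (by omega)
    (Inv := fun i s₁ => s₁.arr = Function.update s.arr B (part i 0) ∧
      s₁.performed = s.performed ∧ ∀ y < d, y ≠ 2 → s₁.reg y = s.reg y)
    (by
      rintro i s₁ s₂ ⟨ha, hp, hr⟩ ha' hp' hr'
      exact ⟨ha'.trans ha, hp'.trans hp, fun y hy hy2 => (hr' y hy hy2).trans (hr y hy hy2)⟩)
    (by
      rintro i hi s₁ ⟨ha, hp, hr⟩ hi2
      obtain ⟨s₂, h1, ⟨ha2, hp2, hr2⟩, h3⟩ := forLoop_runs (G := G) (P := P) (x := 3)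
        (r := d + 3) (T := T) (by omega) (by omega)
        (Inv := fun j s₂ => s₂.arr = Function.update s.arr B (part i j) ∧
          s₂.performed = s.performed ∧ ∀ y < d + 3, y ≠ 3 → s₂.reg y = s₁.reg y)
        (by
          rintro j s₁ s₂ ⟨ha, hp, hr⟩ ha' hp' hr'
          exact ⟨ha'.trans ha, hp'.trans hp, fun y hy hy2 => (hr' y hy hy2).trans (hr y hy hy2)⟩)
        (by
          rintro j hj s₂ ⟨ha2, hp2, hr2⟩ hj3
          obtain ⟨s₃, h1, hp3, ha3, hr3⟩ := hP i hi j hj s₂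
            (fun A hA => by rw [ha2, Function.update_of_ne hA]) hp2
            ((hr2 2 (by omega) (by omega)).trans hi2) hj3
            (fun y hy hy2 hy3 => (hr2 y (by omega) hy3).trans (hr y (by omega) hy2))
          refine ⟨s₃, h1, ⟨?_, hp3.trans hp2, fun y hy hy3 => ?_⟩, ?_, ?_, ?_⟩
          · rw [ha3, ha2, Function.update_self, Function.update_idem, hcell i hi j hj]
          · rw [hr3 y (by omega), hr2 y hy hy3]
          · rw [hr3 _ (by omega), hj3]
          · rw [hr3 _ (by omega)]
          · rw [hr3 _ (by omega)])
        (s := s₁) ⟨ha, hp, fun _ _ _ => rfl⟩ ((hr 0 (by omega) (by omega)).trans hn)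
      refine ⟨s₂, h1, ⟨by rw [ha2, hrow], hp2, fun y hy hy2 => ?_⟩, ?_, ?_, ?_⟩
      · by_cases hy3 : y = 3
        · rw [hy3, h3, hr 3 (by omega) (by omega)]
        · rw [hr2 y (by omega) hy3, hr y hy hy2]
      · rw [hr2 2 (by omega) (by omega), hi2]
      · exact hr2 _ (by omega) (by omega)
      · exact hr2 _ (by omega) (by omega))
    (s := s) ⟨by simp [hpart], rfl, fun _ _ _ => rfl⟩ hn
  refine ⟨s', h1.mono ?_, ?_, hp, fun y hy => ?_⟩
  · rw [show n * (T + 7) + 15 + 7 = n * (T + 7) + 22 from rfl]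
  · rw [ha]
    congr 1
    funext u v
    simp only [hpart, fillWith]
    congr 1
    refine propext ⟨fun h => ⟨h.1, h.2.1⟩, fun h => ⟨h.1, h.2, Or.inl h.1⟩⟩
  · by_cases hy2 : y = 2
    · rw [hy2, h2]
    · exact hr y hy hy2

/-- Compiled commands have the stated effect, within the stated number of steps. -/
theorem Cmd.runs (G : DAG (Fin n)) {k : ℕ} (c : Cmd) {d : ℕ} (hd : 10 ≤ d)
    {s : State n} {e : Fin 8 → ℕ} {m : Memory n} (h : Represents s k e m.arr)
    (hm : s.performed = m.performed) :
    ∃ s', Runs G (c.compile d) s s' (c.cost.eval n) ∧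
      (∀ A, s'.arr (2 * A) = (c.den G k e m).arr A) ∧
      s'.performed = (c.den G k e m).performed ∧ ∀ y < d, s'.reg y = s.reg y := by
  induction c generalizing d s e m with
  | fill A t =>
    set f : ℕ → ℕ → ℕ := fun i j =>
      t.eval n k m.arr (Function.update (Function.update e 0 i) 1 j) with hf
    have h01 : ∀ {s₁ : State n} {i j : ℕ}, (∀ A, s₁.arr (2 * A) = m.arr A) → s₁.reg 2 = i →
        s₁.reg 3 = j → (∀ y < 10, y ≠ 2 → y ≠ 3 → s₁.reg y = s.reg y) →
        Represents s₁ k (Function.update (Function.update e 0 i) 1 j) m.arr := by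
      intro s₁ i j ha hi hj hr
      refine ⟨(hr 0 (by omega) (by omega) (by omega)).trans h.size,
        (hr 1 (by omega) (by omega) (by omega)).trans h.bound, fun x => ?_, ha⟩
      by_cases hx1 : x = 1
      · rw [hx1, Function.update_self]; exact hj
      rw [Function.update_of_ne hx1]
      by_cases hx0 : x = 0
      · rw [hx0, Function.update_self]; exact hi
      rw [Function.update_of_ne hx0, hr _ (by omega) (by omega) (by omega), h.var]
    obtain ⟨s₁, h1, ha1, hp1, hr1⟩ := doubleLoop_runs (G := G)
      (P := .seq (t.compile (d + 6)) (.write 1 2 3 (d + 6))) (T := t.cost.eval n + 2) (B := 1)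
      (f := f) hd h.size (by
        intro i hi j hj s₁ ha hp hi2 hj3 hr
        obtain ⟨s₂, h2, ha2, hp2, hv2, hr2⟩ := t.runs G (show 10 ≤ d + 6 by omega)
          (h01 (fun A => (ha _ (by omega)).trans (h.arr A)) hi2 hj3 hr)
        refine ⟨_, h2.seq (Runs.write s₂ 1 2 3 (d + 6)), hp2, ?_, hr2⟩
        simp only [ha2, hv2, hr2 2 (by omega), hr2 3 (by omega), hi2, hj3, hf])
    obtain ⟨s₂, h2, ha2, hp2, hr2⟩ := doubleLoop_runs (G := G)
      (P := .seq (.read (d + 6) 1 2 3) (.write (2 * A) 2 3 (d + 6))) (T := 3) (B := 2 * A)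
      (f := f) hd (s := s₁) ((hr1 0 (by omega)).trans h.size) (by
        intro i hi j hj s₂ ha hp hi2 hj3 hr
        refine ⟨_, (Runs.read s₂ (d + 6) 1 2 3).seq (Runs.write _ (2 * A) 2 3 (d + 6)), rfl, ?_,
          fun y hy => Function.update_of_ne (by omega) _ _⟩
        have : s₂.arr 1 i j = f i j := by
          rw [ha 1 (by omega), ha1, Function.update_self, fillWith, if_pos ⟨hi, hj⟩]
        simp [hi2, hj3, this])
    refine ⟨s₂, (h1.seq h2).mono ?_, fun B => ?_, (hp2.trans hp1).trans hm, fun y hy =>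
      (hr2 y hy).trans (hr1 y hy)⟩
    · simp only [Cmd.cost, Polynomial.eval_add, Polynomial.eval_mul, Polynomial.eval_X,
        Polynomial.eval_ofNat]
      rw [show t.cost.eval n + 2 + 7 = t.cost.eval n + 9 from rfl, show 3 + 7 = 10 from rfl]
      omega
    · have hodd : ∀ B, s₁.arr (2 * B) = m.arr B := fun B => by
        rw [ha1, Function.update_of_ne (by omega), h.arr]
      simp only [Cmd.den]
      rw [ha2]
      by_cases hB : B = A
      · rw [hB, Function.update_self, Function.update_self, hodd]
      · rw [Function.update_of_ne (by omega), Function.update_of_ne hB, hodd]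
  | seq c c' ih ih' =>
    obtain ⟨s₁, h1, ha1, hp1, hr1⟩ := ih hd h hm
    obtain ⟨s₂, h2, ha2, hp2, hr2⟩ := ih' hd (s := s₁) (e := e)
      (⟨(hr1 0 (by omega)).trans h.size, (hr1 1 (by omega)).trans h.bound,
        fun x => (hr1 _ (by omega)).trans (h.var x), ha1⟩) hp1
    refine ⟨s₂, (h1.seq h2).mono ?_, ha2, hp2, fun y hy => (hr2 y hy).trans (hr1 y hy)⟩
    simp [Cmd.cost]
  | when t c ih =>
    obtain ⟨s₁, h1, ha1, hp1, hv1, hr1⟩ := t.runs G hd h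
    have h' := h.congr ha1 fun y hy => hr1 y (by omega)
    by_cases hc : t.eval n k m.arr e ≠ 0
    · obtain ⟨s₂, h2, ha2, hp2, hr2⟩ := ih hd h' (hp1.trans hm)
      refine ⟨s₂, (h1.seq (h2.ite_pos (hv1 ▸ hc))).mono ?_, ?_, ?_,
        fun y hy => (hr2 y hy).trans (hr1 y hy)⟩
      · simp only [Cmd.cost, Polynomial.eval_add, Polynomial.eval_ofNat]; omega
      · simpa only [Cmd.den, if_pos hc] using ha2
      · simpa only [Cmd.den, if_pos hc] using hp2
    · refine ⟨_, (h1.seq ((Runs.const s₁ d 0).ite_neg (hv1.trans (not_not.1 hc)))).mono ?_, ?_,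
        ?_, fun y hy => (Function.update_of_ne (by omega) _ _).trans (hr1 y hy)⟩
      · simp only [Cmd.cost, Polynomial.eval_add, Polynomial.eval_ofNat]; omega
      · simpa only [Cmd.den, if_neg hc] using h'.arr
      · simpa only [Cmd.den, if_neg hc] using hp1.trans hm
  | loop x c ih =>
    obtain ⟨s', h1, ⟨ha, hp, hr⟩, hx⟩ := forLoop_runs (G := G) (P := c.compile (d + 3))
      (x := x + 2) (r := d) (T := c.cost.eval n) (by omega) (by omega)
      (Inv := fun i s' =>
        (∀ A, s'.arr (2 * A) = ((List.range i).foldl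
          (fun m i => c.den G k (Function.update e x i) m) m).arr A) ∧
        s'.performed = ((List.range i).foldl
          (fun m i => c.den G k (Function.update e x i) m) m).performed ∧
        ∀ y < d, y ≠ (x : ℕ) + 2 → s'.reg y = s.reg y)
      (by
        rintro i s₁ s₂ ⟨ha, hp, hr⟩ ha' hp' hr'
        exact ⟨fun A => by rw [ha', ha], hp'.trans hp,
          fun y hy hyx => (hr' y hy hyx).trans (hr y hy hyx)⟩)
      (by
        rintro i hi s₁ ⟨ha, hp, hr⟩ hxi
        obtain ⟨s₂, h2, ha2, hp2, hr2⟩ := ih (show 10 ≤ d + 3 by omega)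
          (h.update ha hxi fun y hy hyx => hr y (by omega) hyx) hp
        refine ⟨s₂, h2, ⟨fun A => ?_, ?_, fun y hy hyx => ?_⟩, ?_, hr2 _ (by omega),
          hr2 _ (by omega)⟩
        · rw [ha2, List.range_succ, List.foldl_append]; rfl
        · rw [hp2, List.range_succ, List.foldl_append]; rfl
        · rw [hr2 y (by omega), hr y hy hyx]
        · rw [hr2 _ (by omega), hxi])
      (s := s) ⟨h.arr, hm, fun _ _ _ => rfl⟩ h.size
    refine ⟨s', h1.mono ?_, ha, hp, fun y hy => ?_⟩
    · simp [Cmd.cost]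
    · by_cases hyx : y = (x : ℕ) + 2
      · rw [hyx, hx]
      · exact hr y hy hyx
  | intervene A x =>
    refine ⟨_, (Runs.intervene s (2 * A) (x + 2)).mono (by simp [Cmd.cost]), fun B => ?_, ?_,
      fun _ _ => rfl⟩
    · simp only [State.doIntervene, Cmd.den, h.arr, h.var, hm]
      by_cases hB : B = 0
      · rw [hB, Function.update_self, Function.update_self]
      · rw [Function.update_of_ne (by omega), Function.update_of_ne hB, h.arr]
    · simp only [State.doIntervene, Cmd.den, h.arr, h.var, hm]

/-- The memory at the start. -/
noncomputable def initialMemory (G : DAG (Fin n)) : Memory n where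
  arr A := if A = 0 then adjMatrix (essentialGraph ∅ G) else fun _ _ => 0
  performed := []

/-- A compiled command halts in polynomial time. -/
theorem Cmd.haltsIn (c : Cmd) (k : ℕ) (G : DAG (Fin n)) :
    ∃ s, HaltsIn (c.compile 10) k G (c.cost.eval n) s ∧
      s.arr 0 = (c.den G k (fun _ => 0) (initialMemory G)).arr 0 ∧
      s.performed = (c.den G k (fun _ => 0) (initialMemory G)).performed := by
  obtain ⟨s, ⟨t, ht, hrun⟩, ha, hp, -⟩ := c.runs G (k := k) le_rfl (s := initialState k G)
    (e := fun _ => 0) (m := initialMemory G)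
    ⟨rfl, rfl, fun x => by simp [initialState], fun A => by simp [initialState, initialMemory]⟩ rfl
  refine ⟨s, ?_, ha 0, hp⟩
  obtain ⟨r, hr⟩ := Nat.exists_eq_add_of_le' ht
  rw [HaltsIn, hr, Function.iterate_add_apply, hrun []]
  exact Function.iterate_fixed rfl r

end Language

/-! ### Logical and arithmetical terms -/

section Terms

namespace Term

/-- A term read as a condition: it is nonzero. -/
def Holds (n k : ℕ) (a : ℕ → ℕ → ℕ → ℕ) (t : Term) (e : Fin 8 → ℕ) : Prop := t.eval n k a e ≠ 0

/-- Negation. -/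
def not (t : Term) : Term := .cond t (.const 0) (.const 1)

/-- Conjunction. -/
def and (t u : Term) : Term := .cond t u (.const 0)

/-- Disjunction. -/
def or (t u : Term) : Term := .cond t (.const 1) u

/-- Implication. -/
def imp (t u : Term) : Term := .cond t u (.const 1)

/-- The comparison `t < u`. -/
def lt (t u : Term) : Term := .sub u t

/-- Equality of values. -/
def eq (t u : Term) : Term := ((lt t u).or (lt u t)).not

/-- `∃ x < n, t`. -/
def ex (x : Fin 8) (t : Term) : Term := .sum x t

/-- `∀ x < n, t`. -/
def all (x : Fin 8) (t : Term) : Term := (ex x t.not).not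

/-- The number of `x < n` with `t`. -/
def count (x : Fin 8) (t : Term) : Term := .sum x (.cond t (.const 1) (.const 0))

/-- The product `t * u` for `t ≤ n`, as the sum of `u` over all `x < t`. -/
def mul (x : Fin 8) (t u : Term) : Term := .sum x (.cond (lt (.var x) t) u (.const 0))

/-- The entry of the array `A` at two variables. -/
def entry (A : ℕ) (x y : Fin 8) : Term := .read A (.var x) (.var y)

variable {n k : ℕ} {a : ℕ → ℕ → ℕ → ℕ} {t u c : Term} {e : Fin 8 → ℕ} {x y : Fin 8} {A : ℕ}

@[simp] theorem holds_not : t.not.Holds n k a e ↔ ¬ t.Holds n k a e := by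
  simp only [Holds, not, eval]; split_ifs <;> simp_all

@[simp] theorem holds_and : (t.and u).Holds n k a e ↔ t.Holds n k a e ∧ u.Holds n k a e := by
  simp only [Holds, and, eval]; split_ifs <;> simp_all

@[simp] theorem holds_or : (t.or u).Holds n k a e ↔ t.Holds n k a e ∨ u.Holds n k a e := by
  simp only [Holds, or, eval]; split_ifs <;> simp_all

@[simp] theorem holds_imp : (t.imp u).Holds n k a e ↔ (t.Holds n k a e → u.Holds n k a e) := by
  simp only [Holds, imp, eval]; split_ifs <;> simp_all

@[simp] theorem holds_lt : (t.lt u).Holds n k a e ↔ t.eval n k a e < u.eval n k a e := by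
  simp only [Holds, lt, eval]; omega

@[simp] theorem holds_eq : (t.eq u).Holds n k a e ↔ t.eval n k a e = u.eval n k a e := by
  simp only [eq, holds_not, holds_or, holds_lt]; omega

@[simp] theorem holds_cond : (cond c t u).Holds n k a e ↔
    (c.Holds n k a e ∧ t.Holds n k a e) ∨ (¬ c.Holds n k a e ∧ u.Holds n k a e) := by
  simp only [Holds, eval]; split_ifs <;> simp_all

@[simp] theorem holds_ex :
    (t.ex x).Holds n k a e ↔ ∃ i : Fin n, t.Holds n k a (Function.update e x i) := by
  simp only [Holds, ex, eval, ne_eq, Finset.sum_eq_zero_iff, Finset.mem_range, not_forall]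
  exact ⟨fun ⟨i, hi, h⟩ => ⟨⟨i, hi⟩, h⟩, fun ⟨i, h⟩ => ⟨i, i.2, h⟩⟩

@[simp] theorem holds_all :
    (t.all x).Holds n k a e ↔ ∀ i : Fin n, t.Holds n k a (Function.update e x i) := by
  simp only [all, holds_not, holds_ex, not_exists, not_not]

open Classical in
theorem eval_count : (t.count x).eval n k a e =
    (Finset.univ.filter fun i : Fin n => t.Holds n k a (Function.update e x i)).card := by
  simp only [count, eval, Finset.card_filter]
  refine (Fin.sum_univ_eq_sum_range
    (fun i => if t.eval n k a (Function.update e x i) ≠ 0 then 1 else 0) n).symm.trans ?_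
  exact Finset.sum_congr rfl fun _ _ => by unfold Holds; congr

theorem eval_mul {p q : ℕ} (ht : ∀ i, t.eval n k a (Function.update e x i) = p)
    (hu : ∀ i, u.eval n k a (Function.update e x i) = q) (hp : p ≤ n) :
    (mul x t u).eval n k a e = p * q := by
  have h : ∀ i, (cond (lt (.var x) t) u (.const 0)).eval n k a (Function.update e x i) =
      if i < p then q else 0 := by
    intro i
    have := @holds_lt n k a (.var x) t (Function.update e x i)
    simp only [Holds, eval, ht, Function.update_self] at this
    simp only [eval, hu, this]
  simp only [mul]
  rw [eval]
  simp only [h]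
  rw [← Finset.sum_filter, Finset.sum_const, smul_eq_mul]
  congr 1
  rw [show (Finset.range n).filter (fun i => i < p) = Finset.range p by
    ext i; simp only [Finset.mem_filter, Finset.mem_range]; omega, Finset.card_range]

theorem holds_entry : (entry A x y).Holds n k a e ↔ a A (e x) (e y) ≠ 0 := Iff.rfl

end Term

variable {n k : ℕ}

/-- The array `b` stores the relation `R`. A set is stored as a relation that depends on the
second argument only. -/
def Stores (b : ℕ → ℕ → ℕ) (R : Fin n → Fin n → Prop) : Prop := ∀ u v : Fin n, b u v ≠ 0 ↔ R u v

theorem stores_adjMatrix (D : Digraph (Fin n)) : Stores (adjMatrix D) D.Adj := by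
  intro u v
  simp only [adjMatrix]
  split_ifs with h
  · obtain ⟨_, _, h⟩ := h
    simpa using h
  · simpa using fun h' => h ⟨u.2, v.2, h'⟩

/-- The arrays that a command may change. -/
def Cmd.writes : Cmd → List ℕ
  | .fill A _ => [A]
  | .seq c c' => c.writes ++ c'.writes
  | .when _ c => c.writes
  | .loop _ c => c.writes
  | .intervene _ _ => [0]

variable {G : DAG (Fin n)}

theorem Cmd.loop_induction {c : Cmd} {x : Fin 8} {e : Fin 8 → ℕ} {m : Memory n}
    {Inv : ℕ → Memory n → Prop} (h0 : Inv 0 m)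
    (hs : ∀ i < n, ∀ m, Inv i m → Inv (i + 1) (c.den G k (Function.update e x i) m)) :
    Inv n ((Cmd.loop x c).den G k e m) := by
  have : ∀ j ≤ n, Inv j ((List.range j).foldl
      (fun m i => c.den G k (Function.update e x i) m) m) := by
    intro j hj
    induction j with
    | zero => exact h0
    | succ j ih =>
      rw [List.range_succ, List.foldl_append]
      exact hs j (by omega) _ (ih (by omega))
  exact this n le_rfl

theorem Cmd.den_arr_of_notMem {c : Cmd} {A : ℕ} (hA : A ∉ c.writes) (e : Fin 8 → ℕ)
    (m : Memory n) : (c.den G k e m).arr A = m.arr A := by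
  induction c generalizing e m with
  | fill B t =>
    simp only [writes, List.mem_singleton] at hA
    simp only [den]
    exact Function.update_of_ne hA _ _
  | seq c c' ih ih' =>
    simp only [writes, List.mem_append, not_or] at hA
    simp only [den, ih' hA.2, ih hA.1]
  | when t c ih =>
    simp only [den]
    split_ifs
    exacts [ih hA e m, rfl]
  | loop x c ih =>
    exact Cmd.loop_induction (Inv := fun _ m' => m'.arr A = m.arr A) rfl
      fun i _ m' h => (ih hA _ _).trans h
  | intervene B x =>
    simp only [writes, List.mem_singleton] at hA
    simp only [den]
    exact Function.update_of_ne hA _ _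

theorem Cmd.den_performed_of_notMem {c : Cmd} (hc : 0 ∉ c.writes) (e : Fin 8 → ℕ)
    (m : Memory n) : (c.den G k e m).performed = m.performed := by
  induction c generalizing e m with
  | fill B t => rfl
  | seq c c' ih ih' =>
    simp only [writes, List.mem_append, not_or] at hc
    simp only [den, ih' hc.2, ih hc.1]
  | when t c ih =>
    simp only [den]
    split_ifs
    exacts [ih hc e m, rfl]
  | loop x c ih =>
    exact Cmd.loop_induction (Inv := fun _ m' => m'.performed = m.performed) rfl
      fun i _ m' h => (ih hc _ _).trans h
  | intervene B x => simp [writes] at hc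

theorem Cmd.den_fill {A : ℕ} {t : Term} {e : Fin 8 → ℕ} {m : Memory n} {u v : ℕ} (hu : u < n)
    (hv : v < n) : ((Cmd.fill A t).den G k e m).arr A u v =
      t.eval n k m.arr (Function.update (Function.update e 0 u) 1 v) := by
  simp only [den, Function.update_self, fillWith, hu, hv, and_self, if_true]

theorem Cmd.den_fill_ne {A B : ℕ} (h : A ≠ B) {t : Term} {e : Fin 8 → ℕ} {m : Memory n} :
    ((Cmd.fill B t).den G k e m).arr A = m.arr A := Function.update_of_ne h _ _

theorem Cmd.stores_fill {A : ℕ} {t : Term} {e : Fin 8 → ℕ} {m : Memory n} :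
    Stores (((Cmd.fill A t).den G k e m).arr A) fun u v : Fin n =>
      t.Holds n k m.arr (Function.update (Function.update e 0 u) 1 v) := by
  intro u v
  rw [Cmd.den_fill u.2 v.2]
  rfl

theorem Stores.congr {b : ℕ → ℕ → ℕ} {R R' : Fin n → Fin n → Prop} (h : Stores b R)
    (hR : ∀ u v, R u v ↔ R' u v) : Stores b R' := fun u v => (h u v).trans (hR u v)

end Terms

/-! ### Computing the separators -/

section SeparatorProgram

open Term

variable {n k : ℕ} {G : DAG (Fin n)} {U : SimpleGraph (Fin n)}

/-- Array `1` := the undirected part of the graph in array `0`. -/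
def edgesCmd : Cmd := .fill 1 ((entry 0 0 1).and (entry 0 1 0))

/-- Array `A` := reachability in the graph in array `1` without the edges at the set in
array `2`. -/
def reachCmd (A : ℕ) : Cmd :=
  .seq (.fill A (.eq (.var 0) (.var 1)))
    (.loop 5 (.fill A ((entry A 0 1).or (.ex 2 ((entry A 0 2).and ((entry 1 2 1).and
      ((entry 2 2 2).not.and (entry 2 1 1).not)))))))

/-- One step of the search for separators: array `4` is reachability outside the set `K` in
array `2`, array `5` the set of vertices in big components, array `6` the set of good vertices. -/
def separatorStepCmd : Cmd :=
  .seq (reachCmd 4) <|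
  .seq (.fill 5 ((entry 2 1 1).not.and ((lt (.const 1) (count 2 (entry 3 1 2))).and
    (lt (count 2 (entry 3 1 2)) (.add (count 2 (entry 4 1 2)) (count 2 (entry 4 1 2))))))) <|
  .seq (.fill 6 ((entry 5 1 1).and (.all 2 ((entry 2 2 2).imp ((entry 3 1 2).imp
    ((ex 3 ((entry 5 3 3).and (entry 1 3 2))).imp (entry 1 1 2)))))))
    (.fill 2 (.cond (.ex 2 ((entry 5 2 2).and (entry 3 1 2)))
      (((entry 2 1 1).and (.ex 2 ((entry 5 2 2).and (entry 1 2 1)))).or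
        ((entry 6 1 1).and (.all 2 ((lt (.var 2) (.var 1)).imp ((entry 3 1 2).imp
          (entry 6 2 2).not)))))
      (entry 2 1 1)))

/-- Array `2` := the union of clique separators of the graph in array `1`. -/
def separatorsCmd : Cmd :=
  .seq (.fill 2 (.const 0)) (.seq (reachCmd 3) (.loop 6 separatorStepCmd))

theorem edgesCmd_spec {I : Set (Finset (Fin n))} {e : Fin 8 → ℕ} {m : Memory n}
    (h0 : m.arr 0 = adjMatrix (essentialGraph I G)) :
    Stores ((edgesCmd.den G k e m).arr 1) (undirectedPart (essentialGraph I G)).Adj := by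
  refine Cmd.stores_fill.congr fun u v => ?_
  have h := stores_adjMatrix (essentialGraph I G)
  simp only [holds_and, holds_entry, h0]
  simp only [Function.update_apply]
  simp only [Fin.reduceEq, if_true, if_false, ne_eq]
  rw [← ne_eq, ← ne_eq, h, h]
  refine ⟨fun ⟨h1, h2⟩ => ⟨?_, h1, h2⟩, fun h => h.2⟩
  rintro rfl
  exact (essentialGraph_joined h1).elim (G.not_adj_self u) (G.not_adj_self u)

theorem exists_walk_length_succ {W : SimpleGraph (Fin n)} {u v : Fin n} {j : ℕ} :
    (∃ p : W.Walk u v, p.length ≤ j + 1) ↔ (∃ p : W.Walk u v, p.length ≤ j) ∨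
      ∃ w, (∃ p : W.Walk u w, p.length ≤ j) ∧ W.Adj w v := by
  constructor
  · rintro ⟨p, hp⟩
    cases p with
    | nil => exact Or.inl ⟨.nil, Nat.zero_le _⟩
    | cons h q =>
      obtain ⟨w, p', h', heq⟩ := SimpleGraph.Walk.exists_cons_eq_concat h q
      rw [heq, SimpleGraph.Walk.length_concat] at hp
      exact Or.inr ⟨w, ⟨p', by omega⟩, h'⟩
  · rintro (⟨p, hp⟩ | ⟨w, ⟨p, hp⟩, hwv⟩)
    · exact ⟨p, by omega⟩
    · exact ⟨p.concat hwv, by rw [SimpleGraph.Walk.length_concat]; omega⟩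

theorem exists_walk_length_le_iff {W : SimpleGraph (Fin n)} {u v : Fin n} :
    (∃ p : W.Walk u v, p.length ≤ n) ↔ W.Reachable u v := by
  constructor
  · rintro ⟨p, -⟩
    exact ⟨p⟩
  · intro h
    obtain ⟨p, hp⟩ := h.exists_isPath
    have := hp.length_lt
    rw [Fintype.card_fin] at this
    exact ⟨p, this.le⟩

theorem reachCmd_spec {A : ℕ} (hA : A ≠ 1 ∧ A ≠ 2) {K : Finset (Fin n)} {e : Fin 8 → ℕ}
    {m : Memory n} (h1 : Stores (m.arr 1) U.Adj) (h2 : Stores (m.arr 2) fun _ v => v ∈ K) :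
    Stores (((reachCmd A).den G k e m).arr A) (avoid U K).Reachable := by
  refine Stores.congr (R := fun u v => ∃ p : (avoid U K).Walk u v, p.length ≤ n) ?_
    fun u v => exists_walk_length_le_iff
  refine (Cmd.loop_induction (c := .fill A ((entry A 0 1).or (.ex 2 ((entry A 0 2).and
    ((entry 1 2 1).and ((entry 2 2 2).not.and (entry 2 1 1).not)))))) (x := 5) (e := e)
    (Inv := fun j m => Stores (m.arr A) (fun u v => ∃ p : (avoid U K).Walk u v, p.length ≤ j) ∧
      Stores (m.arr 1) U.Adj ∧ Stores (m.arr 2) fun _ v => v ∈ K) ⟨?_, ?_, ?_⟩ ?_).1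
  · refine Cmd.stores_fill.congr fun u v => ?_
    simp only [holds_eq, Term.eval, Function.update_apply, Fin.reduceEq, if_true, if_false]
    constructor
    · intro h
      obtain rfl := Fin.ext h
      exact ⟨.nil, le_rfl⟩
    · rintro ⟨p, hp⟩
      rw [SimpleGraph.Walk.eq_of_length_eq_zero (Nat.le_zero.1 hp)]
  · rwa [Cmd.den_arr_of_notMem (by simpa [Cmd.writes] using hA.1.symm)]
  · rwa [Cmd.den_arr_of_notMem (by simpa [Cmd.writes] using hA.2.symm)]
  · rintro j - m ⟨h, h1, h2⟩
    refine ⟨Cmd.stores_fill.congr fun u v => ?_, ?_, ?_⟩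
    · simp only [holds_or, holds_ex, holds_and, holds_not, holds_entry, Function.update_apply,
        Fin.reduceEq, if_true, if_false]
      rw [exists_walk_length_succ, h]
      refine or_congr Iff.rfl (exists_congr fun w => ?_)
      rw [h, h1, h2, h2]
      rfl
    · rwa [Cmd.den_arr_of_notMem (by simpa [Cmd.writes] using hA.1.symm)]
    · rwa [Cmd.den_arr_of_notMem (by simpa [Cmd.writes] using hA.2.symm)]

theorem componentSize_eq_card (W : SimpleGraph (Fin n)) (v : Fin n)
    [DecidablePred fun w => W.Reachable v w] :
    componentSize W v = (Finset.univ.filter fun w => W.Reachable v w).card := by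
  rw [componentSize, ← Set.ncard_coe_finset]
  congr 1
  ext w
  simp

theorem eval_count_entry {W : SimpleGraph (Fin n)} {a : ℕ → ℕ → ℕ → ℕ} {A : ℕ}
    (h : Stores (a A) W.Reachable) {e : Fin 8 → ℕ} {v : Fin n} (hv : e 1 = v) :
    (count 2 (entry A 1 2)).eval n k a e = componentSize W v := by
  classical
  rw [eval_count, componentSize_eq_card]
  congr 1
  ext w
  simp only [Finset.mem_filter, Finset.mem_univ, true_and, holds_entry, Function.update_apply,
    Fin.reduceEq, if_true, if_false, hv]
  exact h v w

theorem separatorStepCmd_spec {K : Finset (Fin n)} {e : Fin 8 → ℕ} {m : Memory n}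
    (h1 : Stores (m.arr 1) U.Adj) (h2 : Stores (m.arr 2) fun _ v => v ∈ K)
    (h3 : Stores (m.arr 3) U.Reachable) :
    Stores ((separatorStepCmd.den G k e m).arr 2) fun _ v => v ∈ separatorStep U K := by
  classical
  simp only [separatorStepCmd, Cmd.den.eq_2]
  have h4 := reachCmd_spec (k := k) (G := G) (A := 4) (by omega) h1 h2 (e := e)
  rw [← Cmd.den_arr_of_notMem (c := reachCmd 4) (by simp [Cmd.writes, reachCmd]) e m (G := G)
    (k := k)] at h1 h2 h3
  generalize (reachCmd 4).den G k e m = m at *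
  have h5 : Stores ((Cmd.den G k _ e m).arr 5) fun _ v : Fin n => IsBig U K v :=
    (Cmd.stores_fill (t := (entry 2 1 1).not.and ((lt (.const 1) (count 2 (entry 3 1 2))).and
      (lt (count 2 (entry 3 1 2)) (.add (count 2 (entry 4 1 2)) (count 2 (entry 4 1 2))))))).congr
      fun u v => by
    simp only [holds_and, holds_not, holds_lt, Term.eval, holds_entry, Function.update_self]
    rw [h2, eval_count_entry (v := v) h3 (Function.update_self ..),
      eval_count_entry (v := v) h4 (Function.update_self ..), ← two_mul]
    rfl
  generalize hm' : Cmd.den G k (.fill 5 _) e m = m' at *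
  replace h1 : Stores (m'.arr 1) U.Adj := by rwa [← hm', Cmd.den_fill_ne (by decide)]
  replace h2 : Stores (m'.arr 2) fun _ v => v ∈ K := by rwa [← hm', Cmd.den_fill_ne (by decide)]
  replace h3 : Stores (m'.arr 3) U.Reachable := by rwa [← hm', Cmd.den_fill_ne (by decide)]
  clear hm' h4
  have h6 : Stores ((Cmd.den G k _ e m').arr 6) fun _ v : Fin n => IsGood U K v :=
    (Cmd.stores_fill (t := (entry 5 1 1).and (.all 2 ((entry 2 2 2).imp ((entry 3 1 2).imp
      ((ex 3 ((entry 5 3 3).and (entry 1 3 2))).imp (entry 1 1 2))))))).congr fun u v => by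
    simp only [holds_and, holds_all, holds_imp, holds_ex, holds_entry, Function.update_apply,
      Fin.reduceEq, if_true, if_false]
    refine and_congr (h5 v v) (forall_congr' fun w => ?_)
    rw [h2, h3, h1]
    refine imp_congr_right fun _ => imp_congr_right fun _ => imp_congr_left ?_
    exact exists_congr fun d => and_congr (h5 d d) (h1 d w)
  generalize hm'' : Cmd.den G k (.fill 6 _) e m' = m'' at *
  replace h1 : Stores (m''.arr 1) U.Adj := by rwa [← hm'', Cmd.den_fill_ne (by decide)]
  replace h2 : Stores (m''.arr 2) fun _ v => v ∈ K := by rwa [← hm'', Cmd.den_fill_ne (by decide)]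
  replace h3 : Stores (m''.arr 3) U.Reachable := by rwa [← hm'', Cmd.den_fill_ne (by decide)]
  replace h5 : Stores (m''.arr 5) fun _ v => IsBig U K v := by
    rwa [← hm'', Cmd.den_fill_ne (by decide)]
  clear hm''
  refine Cmd.stores_fill.congr fun u v => ?_
  simp only [holds_cond, holds_or, holds_and, holds_not, holds_lt, holds_all, holds_imp, holds_ex,
    holds_entry, Term.eval, Function.update_apply, Fin.reduceEq, if_true, if_false]
  have hbig : (∃ d : Fin n, m''.arr 5 d d ≠ 0 ∧ m''.arr 3 v d ≠ 0) ↔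
      ∃ d, IsBig U K d ∧ U.Reachable v d :=
    exists_congr fun d => and_congr (h5 d d) (h3 v d)
  have hnear : (∃ d : Fin n, m''.arr 5 d d ≠ 0 ∧ m''.arr 1 d v ≠ 0) ↔
      ∃ d, IsBig U K d ∧ U.Adj d v :=
    exists_congr fun d => and_congr (h5 d d) (h1 d v)
  have hfirst : (m''.arr 6 v v ≠ 0 ∧ ∀ y : Fin n, (y : ℕ) < v → m''.arr 3 v y ≠ 0 →
      ¬ m''.arr 6 y y ≠ 0) ↔ IsFirstGood U K v :=
    and_congr (h6 v v) (forall_congr' fun y => imp_congr_right fun _ =>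
      imp_congr (h3 v y) (not_congr (h6 y y)))
  rw [hbig, hnear, hfirst, h2]
  by_cases h : ∃ d, IsBig U K d ∧ U.Reachable v d
  · obtain ⟨d, hd, hvd⟩ := h
    rw [mem_separatorStep hd hvd]
    simp only [show ∃ d, IsBig U K d ∧ U.Reachable v d from ⟨d, hd, hvd⟩, true_and, not_true,
      false_and, or_false]
  · rw [mem_separatorStep' h]
    simp only [h, false_and, not_false_eq_true, true_and, false_or]

theorem separatorsCmd_spec {e : Fin 8 → ℕ} {m : Memory n} (h1 : Stores (m.arr 1) U.Adj) :
    Stores ((separatorsCmd.den G k e m).arr 2) fun _ v => v ∈ separatorUnion U := by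
  simp only [separatorsCmd, Cmd.den.eq_2]
  have h2 : Stores ((Cmd.den G k _ e m).arr 2) fun _ v : Fin n => v ∈ (∅ : Finset (Fin n)) :=
    (Cmd.stores_fill (t := .const 0)).congr fun u v => by simp [Holds, Term.eval]
  rw [← Cmd.den_arr_of_notMem (c := .fill 2 (.const 0)) (by simp [Cmd.writes]) e m (G := G)
    (k := k)] at h1
  generalize Cmd.den G k (.fill 2 (.const 0)) e m = m at *
  have h3 := reachCmd_spec (k := k) (G := G) (A := 3) (by omega) h1 h2 (e := e)
  rw [avoid_empty] at h3
  rw [← Cmd.den_arr_of_notMem (c := reachCmd 3) (by simp [Cmd.writes, reachCmd]) e m (G := G)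
    (k := k)] at h1 h2
  generalize Cmd.den G k (reachCmd 3) e m = m at *
  have := Cmd.loop_induction (G := G) (k := k) (c := separatorStepCmd) (x := 6) (e := e) (m := m)
    (Inv := fun j m => Stores (m.arr 1) U.Adj ∧
      (Stores (m.arr 2) fun _ v => v ∈ (separatorStep U)^[j] ∅) ∧
      Stores (m.arr 3) U.Reachable) ⟨h1, h2, h3⟩ (by
    rintro j - m ⟨h1, h2, h3⟩
    refine ⟨?_, ?_, ?_⟩
    · rwa [Cmd.den_arr_of_notMem (by simp [Cmd.writes, separatorStepCmd, reachCmd])]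
    · rw [Function.iterate_succ_apply']
      exact separatorStepCmd_spec h1 h2 h3
    · rwa [Cmd.den_arr_of_notMem (by simp [Cmd.writes, separatorStepCmd, reachCmd])])
  rw [separatorUnion, Fintype.card_fin]
  exact this.2.1

end SeparatorProgram

/-! ### Computing the labels and performing the interventions -/

section LabelProgram

open Term

variable {n k : ℕ} {G : DAG (Fin n)}

/-- The size of the set `Q` in array `2`. -/
def cardTerm : Term := count 2 (entry 2 2 2)

/-- The number of letters: `2` if `|Q| ≤ 2 k`, and otherwise `⌈|Q| / k⌉`, which is the number of `j`
with `j * k < |Q|`. -/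
def alphabetTerm : Term :=
  .cond (lt (.add .bound .bound) cardTerm) (count 3 (lt (mul 4 (.var 3) .bound) cardTerm))
    (.const 2)

/-- The quotient of variable `1` by the number `a` of letters: the number of `j` for which
`(j + 1) * a` is at most the variable. -/
def quotTerm : Term :=
  count 3 (lt (.var 1) (mul 4 (.add (.var 3) (.const 1)) alphabetTerm)).not

/-- The remainder of variable `1` modulo the number of letters. -/
def remTerm : Term := .sub (.var 1) (mul 4 quotTerm alphabetTerm)

/-- The number of elements of `Q` below variable `1`. -/
def rankTerm : Term := count 2 ((entry 2 2 2).and (lt (.var 2) (.var 1)))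

/-- Array `7` := the powers of the number of letters. One round computes row `x` from row
`x - 1`. -/
def powersCmd : Cmd :=
  .loop 6 (.fill 7 (.cond (.var 0) (mul 4 alphabetTerm (.read 7 (.sub (.var 0) (.const 1))
    (.var 1))) (.const 1)))

/-- Array `8` := the labels of the numbers below `n`. One round computes row `x` from row
`x - 1`. -/
def labelsCmd : Cmd :=
  let s : Term := .add (.read 8 (.sub (.var 0) (.const 1)) quotTerm) remTerm
  .loop 6 (.fill 8 (.cond (.var 0) (.cond (lt s alphabetTerm) s (.sub s alphabetTerm)) remTerm))

/-- Perform the interventions of one iteration. Variables `6` and `7` run through the positions `x`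
and the letters `y`. The positions in use are those with `a ^ x < |Q|`, where `a` is the number of
letters. Row `x` of array `9` holds the intervention. -/
def performCmd : Cmd :=
  .loop 6 <| .loop 7 <| .when
    (((eq cardTerm (.const 1)).and ((eq (.var 6) (.const 0)).and (eq (.var 7) (.const 0)))).or
      ((eq cardTerm (.const 1)).not.and
        ((lt (entry 7 6 6) cardTerm).and (lt (.var 7) alphabetTerm)))) <|
    .seq (.fill 9 ((entry 2 1 1).and
      ((eq cardTerm (.const 1)).or (eq (.read 8 (.var 6) rankTerm) (.var 7))))) (.intervene 9 6)

variable {Q : Finset (Fin n)} {a : ℕ → ℕ → ℕ → ℕ} {e : Fin 8 → ℕ}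

theorem card_le_n (Q : Finset (Fin n)) : Q.card ≤ n := by
  simpa using Finset.card_le_univ Q

theorem eval_cardTerm (hQ : Stores (a 2) fun _ v => v ∈ Q) :
    cardTerm.eval n k a e = Q.card := by
  classical
  rw [cardTerm, eval_count]
  congr 1
  ext v
  simp only [Finset.mem_filter, Finset.mem_univ, true_and, holds_entry, Function.update_self]
  exact hQ v v

theorem card_filter_val_lt (j : ℕ) (hj : j ≤ n) {p : Fin n → Prop} [DecidablePred p]
    (h : ∀ i : Fin n, p i ↔ (i : ℕ) < j) : (Finset.univ.filter p).card = j := by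
  rw [Finset.filter_congr fun i _ => h i]
  have := Fin.card_filter_val_lt (n := n) (m := j)
  rw [min_eq_right hj] at this
  exact this

theorem alphabetSize_le_n (hk : 0 < k) (hn : 2 ≤ n) (hpos : 0 < Q.card) :
    alphabetSize k Q.card ≤ n :=
  alphabetSize_le hk hpos hn ((card_le_n Q).trans (Nat.le_mul_of_pos_right n hk))

theorem eval_alphabetTerm (hQ : Stores (a 2) fun _ v => v ∈ Q) (hk : 0 < k) (hn : 2 ≤ n)
    (hpos : 0 < Q.card) : alphabetTerm.eval n k a e = alphabetSize k Q.card := by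
  classical
  have hle := alphabetSize_le_n hk hn hpos
  have hlt := @holds_lt n k a (.add .bound .bound) cardTerm e
  rw [eval_cardTerm hQ] at hlt
  simp only [Term.eval] at hlt
  rw [alphabetSize_eq hpos] at hle ⊢
  rw [alphabetTerm, Term.eval]
  by_cases h : Q.card ≤ 2 * k
  · rw [if_pos h, if_neg]
    · rfl
    · change ¬ Holds _ _ _ _ _
      rw [hlt]
      omega
  · rw [if_neg h] at hle ⊢
    rw [if_pos, eval_count]
    · refine card_filter_val_lt _ hle fun j => ?_
      rw [holds_lt, eval_cardTerm hQ, eval_mul (p := j) (q := k)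
        (fun i => by simp [Term.eval]) (fun i => rfl) j.2.le,
        ← not_iff_not, not_lt, not_lt, ceil_div_le_iff hk]
    · change Holds _ _ _ _ _
      rw [hlt]
      omega

theorem eval_quotTerm (hQ : Stores (a 2) fun _ v => v ∈ Q) (hk : 0 < k) (hn : 2 ≤ n)
    (hpos : 0 < Q.card) (he : e 1 < n) :
    quotTerm.eval n k a e = e 1 / alphabetSize k Q.card := by
  classical
  have ha : 0 < alphabetSize k Q.card := by have := two_le_alphabetSize hk hpos; omega
  rw [quotTerm, eval_count]
  refine card_filter_val_lt _ ((Nat.div_le_self _ _).trans he.le) fun j => ?_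
  rw [holds_not, holds_lt, eval_mul (p := j + 1) (q := alphabetSize k Q.card)
    (fun i => by simp [Term.eval])
    (fun i => eval_alphabetTerm hQ hk hn hpos) j.2, not_lt, ← Nat.le_div_iff_mul_le ha]
  simp only [Term.eval, Function.update_apply, Fin.reduceEq, if_false]
  exact Iff.rfl

theorem eval_remTerm (hQ : Stores (a 2) fun _ v => v ∈ Q) (hk : 0 < k) (hn : 2 ≤ n)
    (hpos : 0 < Q.card) (he : e 1 < n) :
    remTerm.eval n k a e = e 1 % alphabetSize k Q.card := by
  rw [remTerm, Term.eval, eval_mul (p := e 1 / alphabetSize k Q.card)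
    (q := alphabetSize k Q.card) (fun i => ?_) (fun i => eval_alphabetTerm hQ hk hn hpos)
    ((Nat.div_le_self _ _).trans he.le)]
  · rw [Term.eval, Nat.mod_eq_sub_div_mul]
  · rw [eval_quotTerm hQ hk hn hpos] <;> simp [he]

theorem eval_rankTerm (hQ : Stores (a 2) fun _ v => v ∈ Q) {v : Fin n} (he : e 1 = v) :
    rankTerm.eval n k a e = rankIn Q v := by
  classical
  rw [rankTerm, eval_count, rankIn]
  congr 1
  ext u
  simp only [Finset.mem_filter, Finset.mem_univ, true_and, holds_and, holds_entry, holds_lt,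
    Term.eval, Function.update_apply, Fin.reduceEq, if_true, if_false, he]
  exact and_congr (hQ u u) Iff.rfl

theorem powersCmd_spec {m : Memory n} (hQ : Stores (m.arr 2) fun _ v => v ∈ Q) (hk : 0 < k)
    (hn : 2 ≤ n) (hpos : 0 < Q.card) {u v : ℕ} (hu : u < n) (hv : v < n) :
    (powersCmd.den G k e m).arr 7 u v = alphabetSize k Q.card ^ u := by
  refine (Cmd.loop_induction (Inv := fun j m => (Stores (m.arr 2) fun _ v => v ∈ Q) ∧
    ∀ u v, u < n → v < n → u < j → m.arr 7 u v = alphabetSize k Q.card ^ u) ⟨hQ, ?_⟩ ?_).2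
    u v hu hv hu
  · intro u v _ _ h; omega
  rintro j - m ⟨hQ, ih⟩
  refine ⟨by rwa [Cmd.den_fill_ne (by decide)], fun u v hu hv huj => ?_⟩
  rw [Cmd.den_fill hu hv, Term.eval]
  simp only [Term.eval, Function.update_apply, Fin.reduceEq, if_false, if_true]
  rcases u with _ | u
  · simp
  · rw [if_pos (Nat.succ_ne_zero u), eval_mul (p := alphabetSize k Q.card)
      (q := alphabetSize k Q.card ^ u) (fun i => eval_alphabetTerm hQ hk hn hpos) (fun i => ?_)
      (alphabetSize_le_n hk hn hpos), pow_succ, mul_comm]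
    simp only [Term.eval, Function.update_apply, Fin.reduceEq, if_false, if_true,
      Nat.add_sub_cancel]
    exact ih u v (by omega) hv (by omega)

theorem labelsCmd_spec {m : Memory n} (hQ : Stores (m.arr 2) fun _ v => v ∈ Q) (hk : 0 < k)
    (hn : 2 ≤ n) (hpos : 0 < Q.card) {u v : ℕ} (hu : u < n) (hv : v < n) :
    (labelsCmd.den G k e m).arr 8 u v = digitLabel (alphabetSize k Q.card) u v := by
  have ha : 0 < alphabetSize k Q.card := by have := two_le_alphabetSize hk hpos; omega
  refine (Cmd.loop_induction (Inv := fun j m => (Stores (m.arr 2) fun _ v => v ∈ Q) ∧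
    ∀ u v, u < n → v < n → u < j → m.arr 8 u v = digitLabel (alphabetSize k Q.card) u v)
    ⟨hQ, ?_⟩ ?_).2 u v hu hv hu
  · intro u v _ _ h; omega
  rintro j - m ⟨hQ, ih⟩
  refine ⟨by rwa [Cmd.den_fill_ne (by decide)], fun u v hu hv huj => ?_⟩
  rw [Cmd.den_fill hu hv, Term.eval]
  have he1 : Function.update (Function.update (Function.update e 6 j) 0 u) 1 v 1 = v :=
    Function.update_self ..
  have he0 : Function.update (Function.update (Function.update e 6 j) 0 u) 1 v 0 = u := by
    simp
  generalize Function.update (Function.update (Function.update e 6 j) 0 u) 1 v = e' at *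
  have hrem := eval_remTerm (e := e') hQ hk hn hpos (by rw [he1]; exact hv)
  have hquot := eval_quotTerm (e := e') hQ hk hn hpos (by rw [he1]; exact hv)
  rw [he1] at hrem hquot
  rcases u with _ | u
  · rw [if_neg (by simp [Term.eval, he0]), hrem]
    rfl
  · rw [if_pos (by simp [Term.eval, he0])]
    have hsum : (Term.add (.read 8 (.sub (.var 0) (.const 1)) quotTerm) remTerm).eval n k m.arr e' =
        digitLabel (alphabetSize k Q.card) u (v / alphabetSize k Q.card) +
          v % alphabetSize k Q.card := by
      simp only [Term.eval, hrem, hquot, he0, Nat.add_sub_cancel]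
      rw [ih u _ (by omega) ((Nat.div_le_self _ _).trans_lt hv) (by omega)]
    have hlt := @holds_lt n k m.arr (.add (.read 8 (.sub (.var 0) (.const 1)) quotTerm) remTerm)
      alphabetTerm e'
    rw [hsum, eval_alphabetTerm hQ hk hn hpos] at hlt
    have h1 := digitLabel_lt ha u (v / alphabetSize k Q.card)
    have h2 := Nat.mod_lt v ha
    rw [Term.eval, digitLabel]
    by_cases h : digitLabel (alphabetSize k Q.card) u (v / alphabetSize k Q.card) +
          v % alphabetSize k Q.card < alphabetSize k Q.card
    · rw [if_pos (show _ ≠ 0 from hlt.2 h), hsum, Nat.mod_eq_of_lt h]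
    · rw [if_neg (show ¬ _ ≠ 0 from fun h' => h (hlt.1 h')), Term.eval, hsum, eval_alphabetTerm hQ hk hn hpos,
        Nat.mod_eq_sub_mod (not_lt.1 h)]
      exact (Nat.mod_eq_of_lt (by omega)).symm

/-- The intervention for letter `y` in position `x` of the labels. If `Q` is a single vertex, the
intervention is `Q`. -/
def labelClass (k : ℕ) (Q : Finset (Fin n)) (x y : ℕ) : Finset (Fin n) :=
  Q.filter fun v => Q.card = 1 ∨ digitLabel (alphabetSize k Q.card) x (rankIn Q v) = y

/-- Position `x` and letter `y` occur in the labels. If there is a single vertex, only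
`x = y = 0` is used. -/
def IsLabelEntry (k m x y : ℕ) : Prop :=
  (m = 1 ∧ x = 0 ∧ y = 0) ∨ (m ≠ 1 ∧ alphabetSize k m ^ x < m ∧ y < alphabetSize k m)

open Classical in
/-- The interventions of one iteration, in the order in which the program performs them. -/
noncomputable def batchList (k : ℕ) (Q : Finset (Fin n)) : List (Finset (Fin n)) :=
  (List.range n).flatMap fun x => (List.range n).flatMap fun y =>
    if IsLabelEntry k Q.card x y then [labelClass k Q x y] else []

theorem performCmd_spec {m : Memory n}
    (h0 : m.arr 0 = adjMatrix (essentialGraph {S | S ∈ m.performed} G))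
    (hQ : Stores (m.arr 2) fun _ v => v ∈ Q) (hk : 0 < k) (hn : 2 ≤ n) (hpos : 0 < Q.card)
    (h7 : ∀ u v, u < n → v < n → m.arr 7 u v = alphabetSize k Q.card ^ u)
    (h8 : ∀ u v, u < n → v < n → m.arr 8 u v = digitLabel (alphabetSize k Q.card) u v) :
    (performCmd.den G k e m).performed = m.performed ++ batchList k Q ∧
    (performCmd.den G k e m).arr 0 =
      adjMatrix (essentialGraph {S | S ∈ (performCmd.den G k e m).performed} G) := by
  classical
  set Inv : List (Finset (Fin n)) → Memory n → Prop := fun L m' =>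
    m'.performed = m.performed ++ L ∧
    m'.arr 0 = adjMatrix (essentialGraph {S | S ∈ m'.performed} G) ∧
    m'.arr 2 = m.arr 2 ∧ m'.arr 7 = m.arr 7 ∧ m'.arr 8 = m.arr 8 with hInv
  suffices h : Inv (batchList k Q) (performCmd.den G k e m) from ⟨h.1, h.2.1⟩
  refine Cmd.loop_induction (Inv := fun i => Inv ((List.range i).flatMap fun x =>
    (List.range n).flatMap fun y =>
      if IsLabelEntry k Q.card x y then [labelClass k Q x y] else []))
    ⟨by simp, h0, rfl, rfl, rfl⟩ fun x hx m₁ h₁ => ?_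
  rw [List.range_succ, List.flatMap_append, List.flatMap_singleton]
  refine Cmd.loop_induction (Inv := fun j => Inv (_ ++ (List.range j).flatMap fun y =>
      if IsLabelEntry k Q.card x y then [labelClass k Q x y] else []))
    (by simpa using h₁) fun y hy m₂ h₂ => ?_
  rw [List.range_succ, List.flatMap_append, List.flatMap_singleton, ← List.append_assoc]
  generalize (_ ++ (List.range y).flatMap _ : List (Finset (Fin n))) = L at h₂
  obtain ⟨hp, ha0, ha2, ha7, ha8⟩ := h₂
  have he6 : Function.update (Function.update e 6 x) 7 y 6 = x := by simp
  have he7 : Function.update (Function.update e 6 x) 7 y 7 = y := Function.update_self ..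
  generalize Function.update (Function.update e 6 x) 7 y = e' at *
  have hQ₂ : Stores (m₂.arr 2) fun _ v => v ∈ Q := ha2 ▸ hQ
  have hcond : (((eq cardTerm (.const 1)).and ((eq (.var 6) (.const 0)).and
      (eq (.var 7) (.const 0)))).or ((eq cardTerm (.const 1)).not.and
        ((lt (entry 7 6 6) cardTerm).and (lt (.var 7) alphabetTerm)))).Holds n k m₂.arr e' ↔
      IsLabelEntry k Q.card x y := by
    simp only [holds_or, holds_and, holds_not, holds_eq, holds_lt, eval_cardTerm hQ₂,
      eval_alphabetTerm hQ₂ hk hn hpos, entry, Term.eval, he6, he7, ha7, h7 x x hx hx]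
    rfl
  rw [Cmd.den]
  by_cases h : IsLabelEntry k Q.card x y
  · rw [if_pos (show _ ≠ 0 from hcond.2 h), if_pos h, Cmd.den]
    have hclass : (Finset.univ.filter fun v : Fin n => ((Cmd.fill 9 ((entry 2 1 1).and
        ((eq cardTerm (.const 1)).or (eq (.read 8 (.var 6) rankTerm) (.var 7))))).den G k e' m₂).arr
          9 (e' 6) v ≠ 0) = labelClass k Q x y := by
      ext v
      have := Cmd.stores_fill (G := G) (k := k) (A := 9) (t := (entry 2 1 1).and
        ((eq cardTerm (.const 1)).or (eq (.read 8 (.var 6) rankTerm) (.var 7)))) (e := e') (m := m₂)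
        ⟨x, hx⟩ v
      rw [Finset.mem_filter, he6, and_iff_right (Finset.mem_univ v), this, labelClass,
        Finset.mem_filter]
      have hr : rankIn Q v < n := by
        refine lt_of_le_of_lt (Finset.card_le_card (t := Finset.univ.filter (· < v))
          fun u hu => ?_) (lt_of_eq_of_lt (card_filter_val_lt v v.2.le fun i => Iff.rfl) v.2)
        simpa using (Finset.mem_filter.1 hu).2
      simp only [holds_and, holds_or, holds_eq, holds_entry, eval_cardTerm hQ₂, Term.eval,
        eval_rankTerm hQ₂ (Function.update_self ..), Function.update_apply, Fin.reduceEq,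
        if_true, if_false, he6, he7, ha8, h8 x _ hx hr]
      exact and_congr (hQ₂ v v) Iff.rfl
    simp only [Cmd.den.eq_5, hclass, hInv]
    refine ⟨?_, Function.update_self .., ?_, ?_, ?_⟩
    · rw [Cmd.den_performed_of_notMem (by simp [Cmd.writes]), hp, List.append_assoc]
    · rw [Function.update_of_ne (by decide), Cmd.den_fill_ne (by decide), ha2]
    · rw [Function.update_of_ne (by decide), Cmd.den_fill_ne (by decide), ha7]
    · rw [Function.update_of_ne (by decide), Cmd.den_fill_ne (by decide), ha8]
  · rw [if_neg (show ¬ _ ≠ 0 from fun h' => h (hcond.1 h')), if_neg h, List.append_nil]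
    exact ⟨hp, ha0, ha2, ha7, ha8⟩

theorem mem_batchList {S : Finset (Fin n)} : S ∈ batchList k Q ↔
    ∃ x < n, ∃ y < n, IsLabelEntry k Q.card x y ∧ S = labelClass k Q x y := by
  simp only [batchList, List.mem_flatMap, List.mem_range]
  refine exists_congr fun x => and_congr_right fun _ => exists_congr fun y =>
    and_congr_right fun _ => ?_
  split_ifs with h <;> simp [h]

/-- The performed interventions are those of an iteration of the search. -/
theorem isBatch_batchList {E : Digraph (Fin n)} (hk : 1 < k) (hn : 2 ≤ n)
    (hQ : IsSeparatorUnion (undirectedPart E) Q) (hpos : 0 < Q.card) :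
    IsBatch k E (batchList k Q).toFinset := by
  refine ⟨Q, hQ, ?_⟩
  split_ifs with h
  · have h1 : Q.card = 1 := h.resolve_left (by omega)
    obtain ⟨v, rfl⟩ := Finset.card_eq_one.1 h1
    ext S
    simp only [List.mem_toFinset, mem_batchList, Finset.image_singleton, Finset.mem_singleton,
      IsLabelEntry, labelClass, Finset.card_singleton, ne_eq, not_true, false_and, or_false,
      true_and, true_or, Finset.filter_true]
    exact ⟨fun ⟨_, _, _, _, _, h⟩ => h, fun h => ⟨0, by omega, 0, by omega, ⟨rfl, rfl⟩, h⟩⟩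
  · have h1 : Q.card ≠ 1 := fun h1 => h (Or.inr h1)
    have ha := two_le_alphabetSize (k := k) (by omega) hpos
    refine ⟨_, isLabelling_digitLabel (by omega) (Nat.le_pow_clog (by omega) _), ?_⟩
    ext S
    simp only [List.mem_toFinset, mem_batchList, Finset.mem_image, Finset.mem_univ, true_and,
      IsLabelEntry, labelClass, h1, false_and, false_or, ne_eq, not_false_eq_true, Prod.exists,
      ← Nat.lt_clog_iff_pow_lt (show 1 < alphabetSize k Q.card by omega), Fin.ext_iff]
    constructor
    · rintro ⟨x, -, y, -, ⟨hx, hy⟩, rfl⟩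
      exact ⟨⟨x, hx⟩, ⟨y, hy⟩, rfl⟩
    · rintro ⟨x, y, rfl⟩
      refine ⟨x, ?_, y, y.2.trans_le (alphabetSize_le_n (by omega) hn hpos), ⟨x.2, y.2⟩, rfl⟩
      have hx := (Nat.lt_clog_iff_pow_lt (show 1 < alphabetSize k Q.card by omega)).1 x.2
      exact ((Nat.lt_pow_self ha).trans hx).trans_le (card_le_n Q)

theorem length_flatMap_range {α : Type*} (f : ℕ → List α) (j : ℕ) :
    ((List.range j).flatMap f).length = ∑ i ∈ Finset.range j, (f i).length := by
  induction j with
  | zero => simp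
  | succ j ih => simp [List.range_succ, Finset.sum_range_succ, ih]

theorem length_batchList_le (hk : 1 < k) (hpos : 0 < Q.card) {ν : ℕ}
    (h : Q.card ≤ 3 * (k * ν)) :
    ((batchList k Q).length : ℝ) ≤ 12 / Real.log 2 * (Real.log k * ν) := by
  classical
  have hlen : (batchList k Q).length = ((Finset.range n ×ˢ Finset.range n).filter fun p =>
      IsLabelEntry k Q.card p.1 p.2).card := by
    simp only [batchList, length_flatMap_range, Finset.card_filter, Finset.sum_product]
    refine Finset.sum_congr rfl fun x _ => Finset.sum_congr rfl fun y _ => ?_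
    split_ifs <;> rfl
  rw [hlen]
  by_cases h1 : Q.card = 1
  · refine le_trans (b := (1 : ℝ)) ?_ (one_le_bound hk ?_)
    · have : ((Finset.range n ×ˢ Finset.range n).filter fun p =>
          IsLabelEntry k Q.card p.1 p.2).card ≤ 1 := by
        refine Finset.card_le_one.2 fun p hp q hq => ?_
        have hp := (Finset.mem_filter.1 hp).2
        have hq := (Finset.mem_filter.1 hq).2
        simp only [IsLabelEntry, h1, ne_eq, not_true, false_and, or_false, true_and] at hp hq
        exact Prod.ext (hp.1.trans hq.1.symm) (hp.2.trans hq.2.symm)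
      exact_mod_cast this
    · rcases Nat.eq_zero_or_pos ν with rfl | h0
      · omega
      · exact h0
  · refine le_trans ?_ (clog_mul_alphabetSize_le hk hpos h)
    have ha := two_le_alphabetSize (k := k) (by omega) hpos
    have : ((Finset.range n ×ˢ Finset.range n).filter fun p =>
          IsLabelEntry k Q.card p.1 p.2) ⊆
        Finset.range (Nat.clog (alphabetSize k Q.card) Q.card) ×ˢ
          Finset.range (alphabetSize k Q.card) := by
      intro p hp
      have hp := (Finset.mem_filter.1 hp).2
      simp only [IsLabelEntry, h1, false_and, false_or, ne_eq, not_false_eq_true, true_and,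
        ← Nat.lt_clog_iff_pow_lt (show 1 < alphabetSize k Q.card by omega)] at hp
      exact Finset.mem_product.2 ⟨Finset.mem_range.2 hp.1, Finset.mem_range.2 hp.2⟩
    have := Finset.card_le_card this
    rw [Finset.card_product, Finset.card_range, Finset.card_range] at this
    exact_mod_cast this

end LabelProgram

/-! ### The program -/

section SearchProgram

open Term

variable {n k : ℕ} {G : DAG (Fin n)}

/-- One iteration of the search. Array `0` holds the current essential graph, array `1` its
undirected part, array `2` the union of separators, arrays `7` and `8` the powers of the number of
letters and the labels. -/
def iterationCmd : Cmd :=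
  .seq edgesCmd (.seq separatorsCmd (.seq powersCmd (.seq labelsCmd performCmd)))

/-- The search: `n` times, an iteration is performed if there is an unoriented edge. -/
def searchCmd : Cmd :=
  .loop 7 (.when (.ex 2 (.ex 3 ((entry 0 2 3).and (entry 0 3 2)))) iterationCmd)

theorem isSeparatorUnion_essentialGraph (I : Set (Finset (Fin n))) (G : DAG (Fin n)) :
    IsSeparatorUnion (undirectedPart (essentialGraph I G))
      (separatorUnion (undirectedPart (essentialGraph I G))) :=
  isSeparatorUnion_separatorUnion eliminableOn_undirectedPart

theorem two_le_of_not_fullyOriented {E : Digraph (Fin n)} (hE : ¬ FullyOriented E) : 2 ≤ n := by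
  simp only [FullyOriented, not_forall, not_not] at hE
  obtain ⟨u, v, huv⟩ := hE
  have := Fin.val_ne_of_ne huv.1
  omega

theorem iterationCmd_spec {e : Fin 8 → ℕ} {m : Memory n} (hk : 1 < k)
    (h0 : m.arr 0 = adjMatrix (essentialGraph {S | S ∈ m.performed} G))
    (hE : ¬ FullyOriented (essentialGraph {S | S ∈ m.performed} G)) :
    (iterationCmd.den G k e m).performed = m.performed ++ batchList k
      (separatorUnion (undirectedPart (essentialGraph {S | S ∈ m.performed} G))) ∧
    (iterationCmd.den G k e m).arr 0 =
      adjMatrix (essentialGraph {S | S ∈ (iterationCmd.den G k e m).performed} G) := by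
  have hn := two_le_of_not_fullyOriented hE
  have hpos := (isSeparatorUnion_essentialGraph _ G).card_pos hE
  set Q := separatorUnion (undirectedPart (essentialGraph {S | S ∈ m.performed} G)) with hQdef
  simp only [iterationCmd, Cmd.den.eq_2]
  have h1 := edgesCmd_spec (k := k) (e := e) h0
  have hp₁ := Cmd.den_performed_of_notMem (c := edgesCmd) (by simp [Cmd.writes, edgesCmd]) e m
    (G := G) (k := k)
  have ha₁ := Cmd.den_arr_of_notMem (c := edgesCmd) (A := 0) (by simp [Cmd.writes, edgesCmd]) e m
    (G := G) (k := k)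
  generalize edgesCmd.den G k e m = m₁ at *
  have h2 := separatorsCmd_spec (G := G) (k := k) (e := e) h1
  rw [← hQdef] at h2
  have hp₂ := Cmd.den_performed_of_notMem (c := separatorsCmd)
    (by simp [Cmd.writes, separatorsCmd, separatorStepCmd, reachCmd]) e m₁ (G := G) (k := k)
  have ha₂ := Cmd.den_arr_of_notMem (c := separatorsCmd) (A := 0)
    (by simp [Cmd.writes, separatorsCmd, separatorStepCmd, reachCmd]) e m₁ (G := G) (k := k)
  generalize separatorsCmd.den G k e m₁ = m₂ at *
  have h7 := fun u v => powersCmd_spec (G := G) (e := e) h2 (by omega : 0 < k) hn hpos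
    (u := u) (v := v)
  have hp₃ := Cmd.den_performed_of_notMem (c := powersCmd) (by simp [Cmd.writes, powersCmd]) e m₂
    (G := G) (k := k)
  have hf₃ := fun A (hA : A ≠ 7) => Cmd.den_arr_of_notMem (c := powersCmd) (A := A)
    (by simpa [Cmd.writes, powersCmd] using hA) e m₂ (G := G) (k := k)
  generalize powersCmd.den G k e m₂ = m₃ at *
  have h2' : Stores (m₃.arr 2) fun _ v => v ∈ Q := by rwa [hf₃ 2 (by decide)]
  have h8 := fun u v => labelsCmd_spec (G := G) (e := e) h2' (by omega : 0 < k) hn hpos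
    (u := u) (v := v)
  have hp₄ := Cmd.den_performed_of_notMem (c := labelsCmd) (by simp [Cmd.writes, labelsCmd]) e m₃
    (G := G) (k := k)
  have hf₄ := fun A (hA : A ≠ 8) => Cmd.den_arr_of_notMem (c := labelsCmd) (A := A)
    (by simpa [Cmd.writes, labelsCmd] using hA) e m₃ (G := G) (k := k)
  generalize labelsCmd.den G k e m₃ = m₄ at *
  have hp : m₄.performed = m.performed := by rw [hp₄, hp₃, hp₂, hp₁]
  rw [← hp]
  refine performCmd_spec ?_ ?_ (by omega) hn hpos ?_ h8
  · rw [hf₄ 0 (by decide), hf₃ 0 (by decide), ha₂, ha₁, h0, hp]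
  · rwa [hf₄ 2 (by decide)]
  · rwa [hf₄ 7 (by decide)]

theorem interventions_map_toFinset (Ls : List (List (Finset (Fin n)))) :
    interventions (Ls.map List.toFinset) = {S | S ∈ Ls.flatten} := by
  ext S
  simp [interventions]

/-- The batches `Ls` performed by the program when the memory is `m`. -/
structure IsPartialRun (k : ℕ) (G : DAG (Fin n)) (m : Memory n)
    (Ls : List (List (Finset (Fin n)))) : Prop where
  performed : m.performed = Ls.flatten
  run : SearchRun k G (Ls.map List.toFinset)
  arr : m.arr 0 = adjMatrix (essentialGraph {S | S ∈ m.performed} G)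
  length_le : ∀ L ∈ Ls, (L.length : ℝ) ≤ 12 / Real.log 2 * (Real.log k * verificationNumber k G)

theorem IsPartialRun.iterate {e : Fin 8 → ℕ} {m : Memory n} {Ls : List (List (Finset (Fin n)))}
    (hk : 1 < k) (h : IsPartialRun k G m Ls)
    (hE : ¬ FullyOriented (essentialGraph {S | S ∈ m.performed} G)) :
    ∃ L, IsPartialRun k G (iterationCmd.den G k e m) (Ls ++ [L]) := by
  obtain ⟨hp, ha⟩ := iterationCmd_spec (e := e) hk h.arr hE
  have hQ := isSeparatorUnion_essentialGraph {S | S ∈ m.performed} G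
  have hpos := hQ.card_pos hE
  refine ⟨batchList k (separatorUnion (undirectedPart
    (essentialGraph {S | S ∈ m.performed} G))), ⟨?_, ?_, ha, ?_⟩⟩
  · rw [hp, h.performed, List.flatten_append, List.flatten_singleton]
  · rw [List.map_append, List.map_singleton]
    have heq : interventions (Ls.map List.toFinset) = {S | S ∈ m.performed} := by
      rw [interventions_map_toFinset, h.performed]
    refine .iterate _ _ h.run (heq ▸ hE) ?_
    rw [heq]
    exact isBatch_batchList hk (two_le_of_not_fullyOriented hE) hQ hpos
  · intro L hL
    rcases List.mem_append.1 hL with hL | hL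
    · exact h.length_le L hL
    · rw [List.mem_singleton.1 hL]
      exact length_batchList_le hk hpos (card_separatorUnion_le hk.le hQ)

/-- After `n` rounds no unoriented edge is left, since `i` iterations need at least `2 ^ i`
vertices. -/
theorem searchCmd_spec (hk : 1 < k) {e : Fin 8 → ℕ} :
    ∃ Ls, IsPartialRun k G (searchCmd.den G k e (initialMemory G)) Ls ∧
      FullyOriented (essentialGraph {S | S ∈ Ls.flatten} G) := by
  have key := Cmd.loop_induction (G := G) (k := k) (x := 7) (e := e) (m := initialMemory G)
    (c := .when (.ex 2 (.ex 3 ((entry 0 2 3).and (entry 0 3 2)))) iterationCmd)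
    (Inv := fun i m => ∃ Ls, IsPartialRun k G m Ls ∧
      (FullyOriented (essentialGraph {S | S ∈ m.performed} G) ∨ Ls.length = i)) ?_ ?_
  · obtain ⟨Ls, h, hE⟩ := key
    refine ⟨Ls, h, ?_⟩
    rw [← h.performed]
    by_contra hE'
    have hlen : Ls.length = n := hE.resolve_left hE'
    have hn := two_le_of_not_fullyOriented hE'
    have := h.run.two_pow_length_le hk (by rintro h0; simp [List.map_eq_nil_iff.1 h0] at hlen; omega)
    rw [List.length_map, hlen, Fintype.card_fin] at this
    exact absurd this (not_le.2 n.lt_two_pow_self)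
  · refine ⟨[], ⟨rfl, .start, ?_, by simp⟩, Or.inr rfl⟩
    simp [initialMemory]
  · rintro i - m ⟨Ls, h, hE⟩
    have hcond : (ex 2 (.ex 3 ((entry 0 2 3).and (entry 0 3 2)))).Holds n k m.arr
        (Function.update e 7 i) ↔ ¬ FullyOriented (essentialGraph {S | S ∈ m.performed} G) := by
      simp only [holds_ex, holds_and, holds_entry, Function.update_apply, Fin.reduceEq, if_true,
        if_false, FullyOriented, not_forall, not_not]
      refine exists_congr fun u => exists_congr fun v => ?_
      rw [h.arr]
      have hs := stores_adjMatrix (essentialGraph {S | S ∈ m.performed} G)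
      rw [hs, hs]
      refine ⟨fun ⟨h1, h2⟩ => ⟨?_, h1, h2⟩, fun h => h.2⟩
      rintro rfl
      exact (essentialGraph_joined h1).elim (G.not_adj_self u) (G.not_adj_self u)
    rw [Cmd.den]
    by_cases hE' : FullyOriented (essentialGraph {S | S ∈ m.performed} G)
    · rw [if_neg (show ¬ _ ≠ 0 from fun h' => hcond.1 h' hE')]
      exact ⟨Ls, h, Or.inl hE'⟩
    · rw [if_pos (show _ ≠ 0 from hcond.2 hE')]
      obtain ⟨L, hL⟩ := h.iterate (e := Function.update e 7 i) hk hE'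
      exact ⟨_, hL, Or.inr (by rw [List.length_append, hE.resolve_left hE']; rfl)⟩

end SearchProgram

end CausalSearch

theorem mainTheorem8 :
    ∃ (P : Program) (p : Polynomial ℕ) (c : ℝ), ∀ (n k : ℕ) (G : DAG (Fin n)), 1 < k →
      -- the guarantees hold for every run of the algorithm, whichever separators and labels it picks
      (∀ Cs : List (Finset (Finset (Fin n))), SearchRun k G Cs →
        (∀ C ∈ Cs, ∀ S ∈ C, S.card ≤ k) ∧
        (Cs.length : ℝ) ≤ c * Real.log n ∧
        ((Cs.map Finset.card).sum : ℝ) ≤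
          c * (Real.log n * Real.log k * (verificationNumber k G : ℝ)) ∧
        (FullyOriented (essentialGraph (interventions Cs) G) →
          essentialGraph (interventions Cs) G = G.graph) ∧
        (¬ FullyOriented (essentialGraph (interventions Cs) G) →
          ∃ C, IsBatch k (essentialGraph (interventions Cs) G) C)) ∧
      -- the program `P` carries out a complete run of the algorithm in polynomial time
      ∃ (s : State n) (Ls : List (List (Finset (Fin n)))),
        HaltsIn P k G (p.eval n) s ∧
        s.performed = Ls.flatten ∧
        SearchRun k G (Ls.map List.toFinset) ∧
        (∀ S ∈ s.performed, S.card ≤ k) ∧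
        essentialGraph {S | S ∈ s.performed} G = G.graph ∧
        s.arr 0 = adjMatrix G.graph ∧
        (s.performed.length : ℝ) ≤
          c * (Real.log n * Real.log k * (verificationNumber k G : ℝ)) := by
  -- registers `0` to `9` hold the inputs and the variables
  refine ⟨searchCmd.compile 10, searchCmd.cost, 12 / Real.log 2 ^ 2, fun n k G hk =>
    ⟨fun Cs run => ⟨?_, ?_, ?_, essentialGraph_eq_of_fullyOriented, ?_⟩, ?_⟩⟩
  · intro C hC
    obtain ⟨I, hE, hb⟩ := run.exists_of_mem hC
    exact hb.card_mem_le hk hE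
  · have h := run.length_mul_log_le hk
    rw [Fintype.card_fin] at h
    have h2 : 0 < Real.log 2 := Real.log_pos one_lt_two
    rw [div_mul_eq_mul_div, le_div_iff₀ (by positivity)]
    have hlen : (0 : ℝ) ≤ Cs.length := Nat.cast_nonneg _
    -- `1 / log 2` is at most the constant, since `log 2 < 1`
    nlinarith [Real.log_two_lt_d9, Real.log_natCast_nonneg n]
  · refine sum_le_of_forall_le (by simpa using run.length_mul_log_le hk) fun C hC => ?_
    obtain ⟨I, hE, hb⟩ := run.exists_of_mem hC
    exact hb.card_le hk hE
  · intro hE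
    have hQ := isSeparatorUnion_essentialGraph (interventions Cs) G
    exact ⟨_, isBatch_batchList hk (two_le_of_not_fullyOriented hE) hQ (hQ.card_pos hE)⟩
  · obtain ⟨s, hs, harr, hperf⟩ := searchCmd.haltsIn k G
    obtain ⟨Ls, h, hE⟩ := searchCmd_spec (G := G) hk (e := fun _ => 0)
    have hS := hperf.trans h.performed
    have hG := essentialGraph_eq_of_fullyOriented hE
    refine ⟨s, Ls, hs, hS, h.run, fun S hSmem => ?_, by rw [hS, hG], ?_, ?_⟩
    · rw [hS, List.mem_flatten] at hSmem
      obtain ⟨L, hL, hSL⟩ := hSmem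
      obtain ⟨I, hE, hb⟩ := h.run.exists_of_mem (List.mem_map_of_mem hL)
      exact hb.card_mem_le hk hE S (List.mem_toFinset.2 hSL)
    · rw [harr, h.arr, h.performed, hG]
    · rw [hS, List.length_flatten]
      refine sum_le_of_forall_le ?_ h.length_le
      simpa using h.run.length_mul_log_le hk
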